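/- For integers $p,q\ge 0$ let $\varphi_{p,q}=p\langle -1\rangle\perp q\langle 1\rangle$ over $\mathbb{R}$, let $\mathrm{C}^{p,q}$ be its Clifford algebra (with $v^2=\varphi_{p,q}(v)$ for $v\in\mathbb{R}^{p+q}$), and let $\mathrm{C}_0^{p,q}$ be the even part. Let $\sigma_0$ be the canonical (reversing) involution of $\mathrm{C}_0^{p,q}$, and for $v\in\mathbb{R}^{p+q}$ with $\varphi_{p,q}(v)\neq 0$ let $\sigma_1^v$ be the involution $x\mapsto v\,\sigma_0(x)\,v^{-1}$. For a ring with involution $(A,\sigma)$ and $i\in\mathbb{Z}$, let $W^i(A,\sigma)$ be the $i$-th (Balmer) Witt group of the homotopy category of bounded complexes of finitely generated projective left $A$-modules with the duality induced by $\mathrm{Hom}_A(-,A)$, made into left modules via $\sigma$. Write $\mathbb{Z}_2=\mathbb{Z}/2\mathbb{Z}$. Theorem. Let $n\ge 1$ be an integer, and let $i\in\mathbb{Z}$. If $i$ is odd, then $W^i(\mathrm{C}_0^{0,n},\sigma_0)$ and $W^i(\mathrm{C}_0^{1,n-1},\sigma_0)$ vanish, and so do $W^i(\mathrm{C}_0^{0,n},\sigma_1^v)$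 and $W^i(\mathrm{C}_0^{1,n-1},\sigma_1^v)$, for every $v$ in $\mathbb{R}^{n}$ with $\varphi_{0,n}(v)\ne0$, respectively $\varphi_{1,n-1}(v)\neq 0$. If $i$ is even, these groups are isomorphic to the groups in the following table, which depend only on $n \bmod 8$ and on $i \bmod 4$; the two entries of each pair are the groups for $i\equiv 0$ and for $i\equiv 2\pmod 4$. $$ \begin{array}{|c||c|c|c|c|} \hline n \bmod 8 & W^i(\mathrm{C}_0^{0,n},\sigma_0) & W^i(\mathrm{C}_0^{1,n-1},\sigma_0) & W^i(\mathrm{C}_0^{0,n},\sigma_1^v) & W^i(\mathrm{C}_0^{1,n-1},\sigma_1^v)\\ \hline 1 & \mathbb{Z},\ 0 & \mathbb{Z},\ 0 & \mathbb{Z},\ 0 & \mathbb{Z},\ 0\\ 2 & \mathbb{Z},\ \mathbb{Z} & 0,\ 0 & \mathbb{Z}_2,\ 0 & \mathbb{Z}^2,\ 0\\ 3 & \mathbb{Z},\ \mathbb{Z}_2 & 0,\ \mathbb{Z} & \mathbb{Z}_2,\ \mathbb{Z} & \mathbb{Z},\ 0\\ 4 & \mathbb{Z}^2,\ \mathbb{Z}_2^2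 & 0,\ \mathbb{Z}_2 & 0,\ 0 & \mathbb{Z},\ \mathbb{Z}\\ 5 & \mathbb{Z},\ \mathbb{Z}_2 & \mathbb{Z},\ \mathbb{Z}_2 & \mathbb{Z},\ \mathbb{Z}_2 & \mathbb{Z},\ \mathbb{Z}_2\\ 6 & \mathbb{Z},\ \mathbb{Z} & 0,\ 0 & 0,\ \mathbb{Z}_2 & \mathbb{Z}^2,\ \mathbb{Z}_2^2\\ 7 & \mathbb{Z},\ 0 & \mathbb{Z}_2,\ \mathbb{Z} & 0,\ \mathbb{Z} & \mathbb{Z},\ \mathbb{Z}_2\\ 0 & \mathbb{Z}^2,\ 0 & \mathbb{Z}_2,\ 0 & 0,\ 0 & \mathbb{Z},\ \mathbb{Z}\\ \hline \end{array} $$ -/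

import Mathlib

universe u

/-! ### Duals of modules over a ring with involution -/

section Dual

open CategoryTheory

variable {A : Type u} [Ring A]

/-- The `σ`-dual of a left `A`-module `M`: the left `A`-linear maps `M → A`, with the
left `A`-module structure `(a • f) x = f x * σ a`. -/
def HermDual (_σ : RingInvo A) (M : Type u) [AddCommGroup M] [Module A M] : Type u :=
  M →ₗ[A] A

namespace HermDual

variable (σ : RingInvo A) (M : Type u) [AddCommGroup M] [Module A M]

instance : AddCommGroup (HermDual σ M) := inferInstanceAs (AddCommGroup (M →ₗ[A] A))

instance : FunLike (HermDual σ M) M A := inferInstanceAs (FunLike (M →ₗ[A] A) M A)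

instance : Module A (HermDual σ M) :=
  Module.compHom (M →ₗ[A] A) ((σ : A ≃+* Aᵐᵒᵖ) : A →+* Aᵐᵒᵖ)

variable {σ M}

@[ext] lemma ext {f g : HermDual σ M} (h : ∀ x, f x = g x) : f = g := LinearMap.ext h

@[simp] lemma smul_apply (a : A) (f : HermDual σ M) (x : M) :
    (a • f) x = f x * (σ a).unop := rfl

@[simp] lemma add_apply (f g : HermDual σ M) (x : M) : (f + g) x = f x + g x := rfl

@[simp] lemma neg_apply (f : HermDual σ M) (x : M) : (-f) x = -(f x) := rfl

@[simp] lemma zero_apply (x : M) : (0 : HermDual σ M) x = 0 := rfl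

@[simp] lemma apply_add (f : HermDual σ M) (x y : M) : f (x + y) = f x + f y :=
  LinearMap.map_add (show M →ₗ[A] A from f) x y

@[simp] lemma apply_smul (f : HermDual σ M) (a : A) (x : M) : f (a • x) = a * f x :=
  LinearMap.map_smul (show M →ₗ[A] A from f) a x

end HermDual

/-- The transpose `f ↦ f ∘ u` of a map of `A`-modules. -/
def hermDualMap (σ : RingInvo A) {M N : ModuleCat.{u} A} (u : M ⟶ N) :
    ModuleCat.of A (HermDual σ N) ⟶ ModuleCat.of A (HermDual σ M) :=
  ModuleCat.ofHom
    { toFun := fun f => LinearMap.comp (show N →ₗ[A] A from f) u.hom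
      map_add' := fun _ _ => rfl
      map_smul' := fun _ _ => rfl }

/-- The canonical map `M → M^{##}`, `x ↦ (f ↦ σ (f x))`. -/
def hermEval (σ : RingInvo A) (M : ModuleCat.{u} A) :
    M ⟶ ModuleCat.of A (HermDual σ (HermDual σ M)) :=
  ModuleCat.ofHom
    { toFun := fun x =>
        ({ toFun := fun f => (σ (f x)).unop
           map_add' := fun f g => by simp
           map_smul' := fun a f => by simp } : HermDual σ M →ₗ[A] A)
      map_add' := fun x y => HermDual.ext fun f => by
        change (σ (f (x + y))).unop = (σ (f x)).unop + (σ (f y)).unop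
        simp
      map_smul' := fun a x => HermDual.ext fun f => by
        change (σ (f (a • x))).unop = (σ (f x)).unop * (σ a).unop
        simp }

@[simp] lemma hermDualMap_apply (σ : RingInvo A) {M N : ModuleCat.{u} A} (u : M ⟶ N)
    (f : HermDual σ N) (x : M) :
    ((hermDualMap σ u).hom f : HermDual σ M) x = f (u.hom x) := rfl

@[simp] lemma hermEval_apply (σ : RingInvo A) (M : ModuleCat.{u} A) (x : M)
    (f : HermDual σ M) :
    ((hermEval σ M).hom x : HermDual σ (HermDual σ M)) f = (σ (f x)).unop := rfl

lemma hermDualMap_id (σ : RingInvo A) (M : ModuleCat.{u} A) :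
    hermDualMap σ (𝟙 M) = 𝟙 _ := rfl

lemma hermDualMap_comp (σ : RingInvo A) {M N P : ModuleCat.{u} A} (u : M ⟶ N) (v : N ⟶ P) :
    hermDualMap σ (u ≫ v) = hermDualMap σ v ≫ hermDualMap σ u := rfl

lemma hermDualMap_zero (σ : RingInvo A) (M N : ModuleCat.{u} A) :
    hermDualMap σ (0 : M ⟶ N) = 0 :=
  ModuleCat.hom_ext <| LinearMap.ext fun (f : HermDual σ N) => HermDual.ext (σ := σ) fun x => by
    change f (0 : N) = 0
    simpa using f.apply_smul 0 0

lemma hermDualMap_add (σ : RingInvo A) {M N : ModuleCat.{u} A} (u v : M ⟶ N) :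
    hermDualMap σ (u + v) = hermDualMap σ u + hermDualMap σ v :=
  ModuleCat.hom_ext <| LinearMap.ext fun (f : HermDual σ N) => HermDual.ext (σ := σ) fun x =>
    f.apply_add (u.hom x) (v.hom x)

lemma hermDualMap_neg (σ : RingInvo A) {M N : ModuleCat.{u} A} (u : M ⟶ N) :
    hermDualMap σ (-u) = -hermDualMap σ u := by
  rw [eq_neg_iff_add_eq_zero, ← hermDualMap_add, neg_add_cancel, hermDualMap_zero]

lemma hermDualMap_unit_smul (σ : RingInvo A) {M N : ModuleCat.{u} A} (e : ℤˣ) (u : M ⟶ N) :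
    hermDualMap σ (e • u) = e • hermDualMap σ u := by
  rcases Int.units_eq_one_or e with rfl | rfl
  · simp
  · simp [hermDualMap_neg]

lemma hermEval_naturality (σ : RingInvo A) {M N : ModuleCat.{u} A} (u : M ⟶ N) :
    hermEval σ M ≫ hermDualMap σ (hermDualMap σ u) = u ≫ hermEval σ N := rfl

end Dual

/-! ### Shifted duality on complexes

`K^b(P(A))` is the homotopy category of bounded complexes of finitely generated projective left
`A`-modules. The duality `P ↦ P^#` is the termwise `σ`-dual, `(P^#)^i = (P^{-i})^#`, with the
canonical identification `ϖ : P → P^{##}`. Its `n`-th shift is the duality `T^n ∘ #`, with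
double dual identification `(-1)^{n(n+1)/2} ϖ`. -/

section Complexes

open CategoryTheory CategoryTheory.Limits CategoryTheory.Pretriangulated

variable {A : Type u} [Ring A] (σ : RingInvo A)

/-- The `n`-shifted dual `T^n (P^#)`: its term in degree `i` is `(P^{-n-i})^#` and its
differential is `(-1)^n` times the transpose of that of `P`. -/
def dualComplex (n : ℤ) (P : CochainComplex (ModuleCat.{u} A) ℤ) :
    CochainComplex (ModuleCat.{u} A) ℤ where
  X i := ModuleCat.of A (HermDual σ (P.X (-n - i)))
  d i j := n.negOnePow • hermDualMap σ (P.d (-n - j) (-n - i))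
  shape i j h := by
    rw [P.shape _ _ (by simp only [ComplexShape.up_Rel] at h ⊢; omega), hermDualMap_zero,
      smul_zero]
  d_comp_d' i j k _ _ := by
    rw [Linear.units_smul_comp, Linear.comp_units_smul, ← hermDualMap_comp, P.d_comp_d,
      hermDualMap_zero, smul_zero, smul_zero]

/-- The duality `T^n ∘ #` on morphisms. -/
def dualMap (n : ℤ) {P Q : CochainComplex (ModuleCat.{u} A) ℤ} (g : P ⟶ Q) :
    dualComplex σ n Q ⟶ dualComplex σ n P where
  f i := hermDualMap σ (g.f (-n - i))
  comm' i j _ := by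
    simp only [dualComplex, Linear.units_smul_comp, Linear.comp_units_smul, ← hermDualMap_comp,
      g.comm]

/-- The double dual identification for the `n`-shifted duality: `(-1)^{n(n+1)/2}` times the
canonical one. -/
def doubleDual (n : ℤ) (P : CochainComplex (ModuleCat.{u} A) ℤ) :
    P ⟶ dualComplex σ n (dualComplex σ n P) where
  f i := (n * (n + 1) / 2).negOnePow •
    ((P.XIsoOfEq (show i = -n - (-n - i) by omega)).hom ≫ hermEval σ (P.X (-n - (-n - i))))
  comm' i j _ := by
    simp only [dualComplex, hermDualMap_unit_smul, Linear.units_smul_comp, Linear.comp_units_smul,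
      Category.assoc, hermEval_naturality, smul_smul, Int.units_mul_self, one_smul]
    rw [HomologicalComplex.XIsoOfEq_hom_comp_d_assoc,
      HomologicalComplex.d_comp_XIsoOfEq_hom_assoc]

/-- The canonical isomorphism `T^n (P^#) → T (T^{n-1} (P^#))`, which is the identity up to the
relabelling of degrees. -/
def dualShift (n : ℤ) (P : CochainComplex (ModuleCat.{u} A) ℤ) :
    dualComplex σ n P ⟶ (dualComplex σ (n - 1) P)⟦(1 : ℤ)⟧ where
  f i := hermDualMap σ (P.XIsoOfEq (show -(n - 1) - (i + 1) = -n - i by omega)).hom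
  comm' i j _ := by
    have h : (hermDualMap σ (P.XIsoOfEq (show -(n - 1) - (i + 1) = -n - i by omega)).hom) ≫
        ((1 : ℤ).negOnePow • ((n - 1).negOnePow •
          hermDualMap σ (P.d (-(n - 1) - (j + 1)) (-(n - 1) - (i + 1))))) =
        (n.negOnePow • hermDualMap σ (P.d (-n - j) (-n - i))) ≫
        hermDualMap σ (P.XIsoOfEq (show -(n - 1) - (j + 1) = -n - j by omega)).hom := by
      simp only [Linear.units_smul_comp, Linear.comp_units_smul, ← hermDualMap_comp,
        HomologicalComplex.XIsoOfEq_hom_comp_d, HomologicalComplex.d_comp_XIsoOfEq_hom, smul_smul,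
        ← Int.negOnePow_add]
      rw [show 1 + (n - 1) = n by omega]
    exact h

variable {σ}

lemma dualMap_comp (n : ℤ) {P Q R : CochainComplex (ModuleCat.{u} A) ℤ} (f : P ⟶ Q)
    (g : Q ⟶ R) : dualMap σ n (f ≫ g) = dualMap σ n g ≫ dualMap σ n f := rfl

lemma dualMap_id (n : ℤ) (P : CochainComplex (ModuleCat.{u} A) ℤ) :
    dualMap σ n (𝟙 P) = 𝟙 _ := rfl

lemma dualMap_add (n : ℤ) {P Q : CochainComplex (ModuleCat.{u} A) ℤ} (f g : P ⟶ Q) :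
    dualMap σ n (f + g) = dualMap σ n f + dualMap σ n g := by
  ext i : 1
  exact hermDualMap_add σ _ _

lemma dualMap_zero (n : ℤ) (P Q : CochainComplex (ModuleCat.{u} A) ℤ) :
    dualMap σ n (0 : P ⟶ Q) = 0 := by
  ext i : 1
  exact hermDualMap_zero σ _ _

lemma doubleDual_naturality (n : ℤ) {P Q : CochainComplex (ModuleCat.{u} A) ℤ} (g : P ⟶ Q) :
    doubleDual σ n P ≫ dualMap σ n (dualMap σ n g) = g ≫ doubleDual σ n Q := by
  ext i : 1
  have h : ((n * (n + 1) / 2).negOnePow •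
      ((P.XIsoOfEq (show i = -n - (-n - i) by omega)).hom ≫ hermEval σ _)) ≫
        hermDualMap σ (hermDualMap σ (g.f (-n - (-n - i)))) =
      g.f i ≫ ((n * (n + 1) / 2).negOnePow •
        ((Q.XIsoOfEq (show i = -n - (-n - i) by omega)).hom ≫ hermEval σ _)) := by
    simp only [Linear.units_smul_comp, Linear.comp_units_smul, Category.assoc,
      hermEval_naturality]
    rw [HomologicalComplex.XIsoOfEq_hom_naturality_assoc]
  exact h

variable (A) in
/-- The functor from complexes of `A`-modules to the homotopy category. -/
abbrev toK : CochainComplex (ModuleCat.{u} A) ℤ ⥤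
    HomotopyCategory (ModuleCat.{u} A) (ComplexShape.up ℤ) :=
  HomotopyCategory.quotient (ModuleCat.{u} A) (ComplexShape.up ℤ)

/-! ### Symmetric spaces and Witt groups -/

/-- `P` is a bounded complex of finitely generated projective modules. -/
structure IsPerf (P : CochainComplex (ModuleCat.{u} A) ℤ) : Prop where
  finite : ∀ i, Module.Finite A (P.X i)
  projective : ∀ i, Module.Projective A (P.X i)
  bounded : ∃ a b : ℤ, ∀ i, i < a ∨ b < i → IsZero (P.X i)

lemma IsPerf.biprod {P Q : CochainComplex (ModuleCat.{u} A) ℤ} (hP : IsPerf P) (hQ : IsPerf Q) :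
    IsPerf (P ⊞ Q) where
  finite i := by
    have := hP.finite i
    have := hQ.finite i
    exact Module.Finite.equiv
      (HomologicalComplex.biprodXIso P Q i ≪≫ ModuleCat.biprodIsoProd _ _).symm.toLinearEquiv
  projective i := by
    have := hP.projective i
    have := hQ.projective i
    exact Module.Projective.of_equiv
      (HomologicalComplex.biprodXIso P Q i ≪≫ ModuleCat.biprodIsoProd _ _).symm.toLinearEquiv
  bounded := by
    obtain ⟨a, b, h⟩ := hP.bounded
    obtain ⟨a', b', h'⟩ := hQ.bounded
    refine ⟨min a a', max b b', fun i hi => ?_⟩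
    have h1 := h i (by omega)
    have h2 := h' i (by omega)
    exact IsZero.of_iso ((biprod_isZero_iff _ _).2 ⟨h1, h2⟩) (HomologicalComplex.biprodXIso P Q i)

variable (σ) in
/-- A symmetric space for the `n`-shifted duality on `K^b(P(A))`: an object `K` together with
(the homotopy class of) a map `φ : K → T^n (K^#)` which is symmetric and an isomorphism in the
homotopy category. -/
structure SymSpace (n : ℤ) where
  K : CochainComplex (ModuleCat.{u} A) ℤ
  perf : IsPerf K
  φ : K ⟶ dualComplex σ n K
  symm : (toK A).map (doubleDual σ n K ≫ dualMap σ n φ) = (toK A).map φ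
  nondeg : IsIso ((toK A).map φ)

namespace SymSpace

variable {n : ℤ}

/-- Isometry: an isomorphism in the homotopy category that is compatible with the forms. -/
def Isometric (P Q : SymSpace σ n) : Prop :=
  ∃ g : P.K ⟶ Q.K, IsIso ((toK A).map g) ∧
    (toK A).map (g ≫ Q.φ ≫ dualMap σ n g) = (toK A).map P.φ

/-- The form `φ ⊥ ψ` on `K ⊞ L`. -/
noncomputable def orthForm {K L : CochainComplex (ModuleCat.{u} A) ℤ}
    (φ : K ⟶ dualComplex σ n K) (ψ : L ⟶ dualComplex σ n L) :
    (K ⊞ L) ⟶ dualComplex σ n (K ⊞ L) :=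
  biprod.fst ≫ φ ≫ dualMap σ n biprod.fst + biprod.snd ≫ ψ ≫ dualMap σ n biprod.snd

lemma orthForm_symm {K L : CochainComplex (ModuleCat.{u} A) ℤ}
    (φ : K ⟶ dualComplex σ n K) (ψ : L ⟶ dualComplex σ n L) :
    doubleDual σ n (K ⊞ L) ≫ dualMap σ n (orthForm φ ψ) =
      orthForm (doubleDual σ n K ≫ dualMap σ n φ) (doubleDual σ n L ≫ dualMap σ n ψ) := by
  simp only [orthForm, dualMap_add, dualMap_comp, Preadditive.comp_add, Category.assoc]
  rw [← Category.assoc (doubleDual σ n (K ⊞ L)), doubleDual_naturality,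
    ← Category.assoc (doubleDual σ n (K ⊞ L)), doubleDual_naturality]
  simp only [Category.assoc]

lemma isIso_orthForm {K L : CochainComplex (ModuleCat.{u} A) ℤ}
    (φ : K ⟶ dualComplex σ n K) (ψ : L ⟶ dualComplex σ n L)
    (hφ : IsIso ((toK A).map φ)) (hψ : IsIso ((toK A).map ψ)) :
    IsIso ((toK A).map (orthForm φ ψ)) := by
  obtain ⟨φ', hφ'⟩ := (toK A).map_surjective (inv ((toK A).map φ))
  obtain ⟨ψ', hψ'⟩ := (toK A).map_surjective (inv ((toK A).map ψ))
  have e1 : dualMap σ n (biprod.fst : K ⊞ L ⟶ K) ≫ dualMap σ n biprod.inl = 𝟙 _ := by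
    rw [← dualMap_comp, biprod.inl_fst, dualMap_id]
  have e2 : dualMap σ n (biprod.fst : K ⊞ L ⟶ K) ≫ dualMap σ n biprod.inr = 0 := by
    rw [← dualMap_comp, biprod.inr_fst, dualMap_zero]
  have e3 : dualMap σ n (biprod.snd : K ⊞ L ⟶ L) ≫ dualMap σ n biprod.inl = 0 := by
    rw [← dualMap_comp, biprod.inl_snd, dualMap_zero]
  have e4 : dualMap σ n (biprod.snd : K ⊞ L ⟶ L) ≫ dualMap σ n biprod.inr = 𝟙 _ := by
    rw [← dualMap_comp, biprod.inr_snd, dualMap_id]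
  have a1 : (toK A).map φ ≫ (toK A).map φ' = 𝟙 _ := by rw [hφ', IsIso.hom_inv_id]
  have a2 : (toK A).map φ' ≫ (toK A).map φ = 𝟙 _ := by rw [hφ', IsIso.inv_hom_id]
  have a3 : (toK A).map ψ ≫ (toK A).map ψ' = 𝟙 _ := by rw [hψ', IsIso.hom_inv_id]
  have a4 : (toK A).map ψ' ≫ (toK A).map ψ = 𝟙 _ := by rw [hψ', IsIso.inv_hom_id]
  refine ⟨(toK A).map (dualMap σ n biprod.inl ≫ φ' ≫ biprod.inl +
    dualMap σ n biprod.inr ≫ ψ' ≫ biprod.inr), ?_, ?_⟩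
  · rw [← Functor.map_comp]
    have : orthForm φ ψ ≫ (dualMap σ n biprod.inl ≫ φ' ≫ biprod.inl +
        dualMap σ n biprod.inr ≫ ψ' ≫ biprod.inr) =
        biprod.fst ≫ (φ ≫ φ') ≫ biprod.inl + biprod.snd ≫ (ψ ≫ ψ') ≫ biprod.inr := by
      simp only [orthForm, Preadditive.comp_add, Preadditive.add_comp, Category.assoc,
        reassoc_of% e1, reassoc_of% e2, reassoc_of% e3, reassoc_of% e4, zero_comp, comp_zero,
        add_zero, zero_add]
    rw [this]
    simp only [Functor.map_add, Functor.map_comp, a1, a3, Category.id_comp]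
    rw [← Functor.map_comp, ← Functor.map_comp, ← Functor.map_add, biprod.total, CategoryTheory.Functor.map_id]
  · rw [← Functor.map_comp]
    have : (dualMap σ n biprod.inl ≫ φ' ≫ biprod.inl +
        dualMap σ n biprod.inr ≫ ψ' ≫ biprod.inr) ≫ orthForm φ ψ =
        dualMap σ n biprod.inl ≫ (φ' ≫ φ) ≫ dualMap σ n biprod.fst +
        dualMap σ n biprod.inr ≫ (ψ' ≫ ψ) ≫ dualMap σ n biprod.snd := by
      simp [orthForm]
    rw [this]
    simp only [Functor.map_add, Functor.map_comp, a2, a4, Category.id_comp]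
    rw [← Functor.map_comp, ← Functor.map_comp, ← Functor.map_add, ← dualMap_comp,
      ← dualMap_comp, ← dualMap_add, biprod.total, dualMap_id, CategoryTheory.Functor.map_id]

/-- The orthogonal sum of symmetric spaces. -/
noncomputable def orthSum (P Q : SymSpace σ n) : SymSpace σ n where
  K := P.K ⊞ Q.K
  perf := P.perf.biprod Q.perf
  φ := orthForm P.φ Q.φ
  symm := by
    rw [orthForm_symm, orthForm, orthForm]
    simp only [Functor.map_add, Functor.map_comp _ biprod.fst, Functor.map_comp _ biprod.snd,
      Functor.map_comp _ _ (dualMap σ n biprod.fst), Functor.map_comp _ _ (dualMap σ n biprod.snd),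
      P.symm, Q.symm]
  nondeg := isIso_orthForm _ _ P.nondeg Q.nondeg

/-- A symmetric space `(P, φ)` is neutral (metabolic) if it has a Lagrangian: an object `L`, a
morphism `α : L → P` and a symmetric morphism `w : T^{n-1} (L^#) → L` (symmetric for the
`(n-1)`-shifted duality) such that
`T^{n-1} (L^#) --w--> L --α--> P --α^# φ--> T^n (L^#)`
is an exact triangle. -/
def Neutral (P : SymSpace σ n) : Prop :=
  ∃ (L : CochainComplex (ModuleCat.{u} A) ℤ) (_ : IsPerf L) (α : L ⟶ P.K)
    (w : dualComplex σ (n - 1) L ⟶ L),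
    (toK A).map (dualMap σ (n - 1) w) = (toK A).map (w ≫ doubleDual σ (n - 1) L) ∧
    (toK A).mapTriangle.obj
      (Triangle.mk w α (P.φ ≫ dualMap σ n α ≫ dualShift σ n L)) ∈
        distTriang (HomotopyCategory (ModuleCat.{u} A) (ComplexShape.up ℤ))

end SymSpace

variable (σ) in
/-- The relations of the `n`-th Witt group: orthogonal sums are sums, isometric spaces are equal,
neutral spaces are zero. -/
def wittRelations (n : ℤ) : AddSubgroup (FreeAbelianGroup (SymSpace σ n)) :=
  AddSubgroup.closure
    ({x | ∃ P Q : SymSpace σ n, x = .of (P.orthSum Q) - .of P - .of Q} ∪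
     {x | ∃ P Q : SymSpace σ n, P.Isometric Q ∧ x = .of P - .of Q} ∪
     {x | ∃ P : SymSpace σ n, P.Neutral ∧ x = .of P})

variable (σ) in
/-- The `n`-th (derived) Witt group `W^n(A, σ)` of a ring with involution: the group of isometry
classes of symmetric spaces for the `n`-shifted duality on `K^b(P(A))` modulo neutral ones. -/
abbrev WittGroup (n : ℤ) : Type (u + 1) :=
  FreeAbelianGroup (SymSpace σ n) ⧸ wittRelations σ n

end Complexes

/-! ### Even Clifford algebras and their involutions -/

section Clifford

/-- The real quadratic form `p⟨-1⟩ ⊥ q⟨1⟩`. -/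
noncomputable def realForm (p q : ℕ) : QuadraticForm ℝ (Fin p ⊕ Fin q → ℝ) :=
  QuadraticMap.weightedSumSquares ℝ (Sum.elim (fun _ => (-1 : ℝ)) (fun _ => (1 : ℝ)))

/-- The even Clifford algebra `C_0^{p,q}`. -/
abbrev C0 (p q : ℕ) : Type := CliffordAlgebra.even (realForm p q)

variable {p q : ℕ}

open CliffordAlgebra MulOpposite

/-- The canonical (reversing) involution `σ_0` of `C_0^{p,q}`. -/
noncomputable def sigmaZero (p q : ℕ) : RingInvo (C0 p q) :=
  RingInvo.mk'
    { toFun := fun x => op ⟨reverse (x : CliffordAlgebra (realForm p q)),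
        (reverse_mem_evenOdd_iff _).2 x.2⟩
      map_zero' := congrArg op (Subtype.ext (map_zero _))
      map_one' := congrArg op (Subtype.ext reverse.map_one)
      map_add' := fun _ _ => congrArg op (Subtype.ext (map_add _ _ _))
      map_mul' := fun _ _ => congrArg op (Subtype.ext (reverse.map_mul _ _)) }
    (fun _ => Subtype.ext (reverse_reverse _))

/-- The inverse of a vector `v` with `φ(v) ≠ 0` in the Clifford algebra. -/
noncomputable def vecInv (v : Fin p ⊕ Fin q → ℝ) : CliffordAlgebra (realForm p q) :=
  (realForm p q v)⁻¹ • ι (realForm p q) v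

lemma mul_vecInv {v : Fin p ⊕ Fin q → ℝ} (hv : realForm p q v ≠ 0) :
    ι (realForm p q) v * vecInv v = 1 := by
  rw [vecInv, mul_smul_comm, ι_sq_scalar, Algebra.algebraMap_eq_smul_one, smul_smul,
    inv_mul_cancel₀ hv, one_smul]

lemma vecInv_mul {v : Fin p ⊕ Fin q → ℝ} (hv : realForm p q v ≠ 0) :
    vecInv v * ι (realForm p q) v = 1 := by
  rw [vecInv, smul_mul_assoc, ι_sq_scalar, Algebra.algebraMap_eq_smul_one, smul_smul,
    inv_mul_cancel₀ hv, one_smul]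

lemma reverse_vecInv (v : Fin p ⊕ Fin q → ℝ) : reverse (vecInv v) = vecInv v := by
  rw [vecInv, map_smul, reverse_ι]

lemma conj_mem_even (v : Fin p ⊕ Fin q → ℝ) {x : CliffordAlgebra (realForm p q)}
    (hx : x ∈ CliffordAlgebra.even (realForm p q)) :
    ι (realForm p q) v * reverse x * vecInv v ∈ CliffordAlgebra.even (realForm p q) := by
  have h1 : ι (realForm p q) v ∈ evenOdd (realForm p q) 1 := ι_mem_evenOdd_one _ _
  have h2 : vecInv v ∈ evenOdd (realForm p q) 1 := Submodule.smul_mem _ _ h1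
  have h3 : reverse x ∈ evenOdd (realForm p q) 0 := (reverse_mem_evenOdd_iff _).2 hx
  have h4 := SetLike.mul_mem_graded (SetLike.mul_mem_graded h1 h3) h2
  have h5 : (1 + 0 + 1 : ZMod 2) = 0 := by decide
  rw [h5] at h4
  exact h4

/-- The involution `σ_1^v = int(v) σ_0`, `x ↦ v σ_0(x) v⁻¹`, of `C_0^{p,q}`. -/
noncomputable def sigmaOne (v : Fin p ⊕ Fin q → ℝ) (hv : realForm p q v ≠ 0) :
    RingInvo (C0 p q) :=
  RingInvo.mk'
    { toFun := fun x => op ⟨ι (realForm p q) v * reverse (x : CliffordAlgebra (realForm p q)) *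
        vecInv v, conj_mem_even v x.2⟩
      map_zero' := congrArg op (Subtype.ext (by simp))
      map_one' := congrArg op (Subtype.ext (by simp [mul_vecInv hv]))
      map_add' := fun x y => congrArg op (Subtype.ext (by simp [mul_add, add_mul]))
      map_mul' := fun x y => congrArg op (Subtype.ext (by
        change ι (realForm p q) v * reverse ((x : CliffordAlgebra (realForm p q)) * (y : CliffordAlgebra (realForm p q))) * vecInv v =
          (ι (realForm p q) v * reverse (y : CliffordAlgebra (realForm p q)) * vecInv v) *
          (ι (realForm p q) v * reverse (x : CliffordAlgebra (realForm p q)) * vecInv v)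
        rw [reverse.map_mul]
        simp only [mul_assoc]
        rw [← mul_assoc (vecInv v) (ι (realForm p q) v), vecInv_mul hv, one_mul])) }
    (fun x => Subtype.ext (by
      change ι (realForm p q) v * reverse (ι (realForm p q) v *
        reverse (x : CliffordAlgebra (realForm p q)) * vecInv v) * vecInv v = x
      rw [reverse.map_mul, reverse.map_mul, reverse_reverse, reverse_ι, reverse_vecInv]
      simp only [mul_assoc]
      rw [mul_vecInv hv, mul_one, ← mul_assoc, mul_vecInv hv, one_mul]))

end Clifford

/-! ### The table -/

section Table

/-- An entry `(a, b)` of the table stands for the group `ℤ^a ⊕ (ℤ/2)^b`. -/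
abbrev TableGroup (e : ℕ × ℕ) : Type := (Fin e.1 → ℤ) × (Fin e.2 → ZMod 2)

/-- The Witt groups `W^i(A, σ)` are the group of the entry `t.1` for `i ≡ 0 mod 4`, the group of
the entry `t.2` for `i ≡ 2 mod 4`, and `0` for `i` odd. -/
def HasWittGroups {A : Type u} [Ring A] (σ : RingInvo A) (t : (ℕ × ℕ) × (ℕ × ℕ)) : Prop :=
  ∀ i : ℤ,
    (i % 4 = 0 → Nonempty (WittGroup σ i ≃+ TableGroup t.1)) ∧
    (i % 4 = 2 → Nonempty (WittGroup σ i ≃+ TableGroup t.2)) ∧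
    (Odd i → Subsingleton (WittGroup σ i))

/-- The columns `W^0, W^2` for `(C_0^{0,n}, σ_0)`. -/
def tableZeroDef (n : ℕ) : (ℕ × ℕ) × (ℕ × ℕ) :=
  match n % 8 with
  | 1 => ((1, 0), (0, 0))
  | 2 => ((1, 0), (1, 0))
  | 3 => ((1, 0), (0, 1))
  | 4 => ((2, 0), (0, 2))
  | 5 => ((1, 0), (0, 1))
  | 6 => ((1, 0), (1, 0))
  | 7 => ((1, 0), (0, 0))
  | _ => ((2, 0), (0, 0))

/-- The columns `W^0, W^2` for `(C_0^{1,n-1}, σ_0)`. -/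
def tableZeroIndef (n : ℕ) : (ℕ × ℕ) × (ℕ × ℕ) :=
  match n % 8 with
  | 1 => ((1, 0), (0, 0))
  | 2 => ((0, 0), (0, 0))
  | 3 => ((0, 0), (1, 0))
  | 4 => ((0, 0), (0, 1))
  | 5 => ((1, 0), (0, 1))
  | 6 => ((0, 0), (0, 0))
  | 7 => ((0, 1), (1, 0))
  | _ => ((0, 1), (0, 0))

/-- The columns `W^0, W^2` for `(C_0^{0,n}, σ_1^v)`. -/
def tableOneDef (n : ℕ) : (ℕ × ℕ) × (ℕ × ℕ) :=
  match n % 8 with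
  | 1 => ((1, 0), (0, 0))
  | 2 => ((0, 1), (0, 0))
  | 3 => ((0, 1), (1, 0))
  | 4 => ((0, 0), (0, 0))
  | 5 => ((1, 0), (0, 1))
  | 6 => ((0, 0), (0, 1))
  | 7 => ((0, 0), (1, 0))
  | _ => ((0, 0), (0, 0))

/-- The columns `W^0, W^2` for `(C_0^{1,n-1}, σ_1^v)`. -/
def tableOneIndef (n : ℕ) : (ℕ × ℕ) × (ℕ × ℕ) :=
  match n % 8 with
  | 1 => ((1, 0), (0, 0))
  | 2 => ((2, 0), (0, 0))
  | 3 => ((1, 0), (0, 0))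
  | 4 => ((1, 0), (1, 0))
  | 5 => ((1, 0), (0, 1))
  | 6 => ((2, 0), (0, 2))
  | 7 => ((1, 0), (0, 1))
  | _ => ((1, 0), (1, 0))

end Table

/-!
The even Clifford algebra `A` of a nondegenerate real quadratic form is a semisimple real algebra,
so its Witt groups can be computed from its simple modules; the latter are understood through
dimension counts, without identifying `A` with a matrix algebra.

*Witt groups of a semisimple ring.* A bounded complex of finitely generated modules over a
semisimple ring is homotopy equivalent to a complex with zero differentials
(`IsPerf.exists_zeroDiff`). In such a symmetric space a simple
submodule in one degree is either nondegenerate, and splits off, or isotropic, and then sits in a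
neutral summand. Hence `W^n(A, σ)` is generated by the forms on simple modules `S` in one degree
`m` (`SymSpace.closure_isStalk`), and nondegeneracy forces `-n - m = m`. So the odd groups vanish
(`SymSpace.subsingleton_wittGroup_of_odd`). For even `n`, composing with an invariant trace
`A → ℝ` turns forms on `S` into real bilinear forms `β` with `β (a x) y = β x (σ a y)` that are
`ε`-symmetric, `ε = (-1)^{n(n+1)/2}`; these form the space `epsForms σ ε S`.
If it is zero, `S` contributes nothing. If it is a line, a signature on `Hom(S, -)` is an invariant
of Witt classes and `S` contributes `ℤ`. If its dimension is larger, two forms on `S` differ by a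
self-adjoint element of a real division algebra; as some of these elements are not scalar, each is
the square of a self-adjoint element of a copy of `ℂ`, so all forms on `S` are isometric, in
particular `β` and `-β`, and `S` contributes `ℤ/2`, detected by a dimension.

*Simple modules of the even Clifford algebra.* For an orthogonal basis `f, b_1, …, b_m` the
elements `g_j = f b_j` generate `A`, anticommute, and have a common square `s = ±1`. Their
`2^m` monomials behave like a finite group: averaging over them gives semisimplicity, and the
trace of the averaging projection on bilinear forms gives
`2^{m+1} dim U = ∑ (χ(e) χ(σ e⁻¹) + ε χ(σ(e⁻¹) e))`
for the space `U` of `ε`-symmetric forms on a simple module of character `χ`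
(`IsFrame.two_mul_card_mul_finrank_epsForms`). The trace of a monomial vanishes unless it is
central, and `σ` multiplies the monomials by signs (up to a conjugation, for `σ_1^v`), so this is
an explicit function of the dimension `N` of the simple module
(`IsCliffordSystem.finrank_epsForms`). One of the involutions `σ_0`, `σ_1^f` inverts the monomials;
for it the symmetric forms are the multiples of a scalar product, hence `dim U = 1`, which
gives a quadratic equation for `N` (`IsCliffordSystem.two_mul_two_pow_eq`). The sums of signs
`signSum t m` are multiplied by `16` when `m` grows by `8`, so that everything
has period `8` in `m`, and the table results from the eight values of `m` modulo `8`
(`IsCliffordSystem.hasWittGroups`).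
-/

/-! ### The shifted dualities on the homotopy category -/

section HomotopyDuality

open CategoryTheory CategoryTheory.Limits CategoryTheory.Pretriangulated

variable {A : Type u} [Ring A] {σ : RingInvo A}

/-- The transpose of a map between terms of two complexes, as a map between terms of the shifted
dual complexes. -/
def dualTerm (σ : RingInvo A) (n : ℤ) (P Q : CochainComplex (ModuleCat.{u} A) ℤ) (i j : ℤ)
    (u : P.X (-n - j) ⟶ Q.X (-n - i)) :
    (dualComplex σ n Q).X i ⟶ (dualComplex σ n P).X j :=
  hermDualMap σ u

lemma dualComplex_d (n : ℤ) (P : CochainComplex (ModuleCat.{u} A) ℤ) (i j : ℤ) :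
    (dualComplex σ n P).d i j = n.negOnePow • dualTerm σ n P P i j (P.d (-n - j) (-n - i)) := rfl

lemma dualTerm_comp (n : ℤ) (P Q R : CochainComplex (ModuleCat.{u} A) ℤ) (i j k : ℤ)
    (u : P.X (-n - k) ⟶ Q.X (-n - j)) (v : Q.X (-n - j) ⟶ R.X (-n - i)) :
    dualTerm σ n P R i k (u ≫ v) = dualTerm σ n Q R i j v ≫ dualTerm σ n P Q j k u := rfl

lemma dualTerm_add (n : ℤ) (P Q : CochainComplex (ModuleCat.{u} A) ℤ) (i j : ℤ)
    (u v : P.X (-n - j) ⟶ Q.X (-n - i)) :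
    dualTerm σ n P Q i j (u + v) = dualTerm σ n P Q i j u + dualTerm σ n P Q i j v :=
  hermDualMap_add σ u v

lemma dualTerm_zero (n : ℤ) (P Q : CochainComplex (ModuleCat.{u} A) ℤ) (i j : ℤ) :
    dualTerm σ n P Q i j 0 = 0 :=
  hermDualMap_zero σ _ _

lemma dualMap_f (n : ℤ) {P Q : CochainComplex (ModuleCat.{u} A) ℤ} (g : P ⟶ Q) (i : ℤ) :
    (dualMap σ n g).f i = dualTerm σ n P Q i i (g.f (-n - i)) := rfl

/-- The dual of a homotopy. -/
def dualHomotopy (n : ℤ) {P Q : CochainComplex (ModuleCat.{u} A) ℤ} {f g : P ⟶ Q}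
    (h : Homotopy f g) : Homotopy (dualMap σ n f) (dualMap σ n g) where
  hom i j := n.negOnePow • dualTerm σ n P Q i j (h.hom (-n - j) (-n - i))
  zero i j hij := by
    rw [h.zero _ _ (by simp only [ComplexShape.up_Rel] at hij ⊢; omega), dualTerm_zero, smul_zero]
  comm i := by
    have e := h.comm (-n - i)
    rw [dNext_eq h.hom (show (ComplexShape.up ℤ).Rel (-n - i) (-n - (i - 1)) by simp; omega),
      prevD_eq h.hom (show (ComplexShape.up ℤ).Rel (-n - (i + 1)) (-n - i) by simp; omega)] at e
    rw [dNext_eq _ (show (ComplexShape.up ℤ).Rel i (i + 1) by simp),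
      prevD_eq _ (show (ComplexShape.up ℤ).Rel (i - 1) i by simp)]
    simp only [dualMap_f, dualComplex_d, e, dualTerm_add,
      dualTerm_comp n P P Q i (i - 1) i, dualTerm_comp n P Q Q i (i + 1) i,
      Linear.units_smul_comp, Linear.comp_units_smul, smul_smul, Int.units_mul_self, one_smul]
    abel

lemma toK_dualMap_congr (n : ℤ) {P Q : CochainComplex (ModuleCat.{u} A) ℤ} {f g : P ⟶ Q}
    (h : (toK A).map f = (toK A).map g) :
    (toK A).map (dualMap σ n f) = (toK A).map (dualMap σ n g) :=
  HomotopyCategory.eq_of_homotopy _ _ (dualHomotopy n (HomotopyCategory.homotopyOfEq _ _ h))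

variable (σ) in
/-- The `n`-shifted duality on morphisms of the homotopy category. -/
noncomputable def dualK (n : ℤ) {P Q : CochainComplex (ModuleCat.{u} A) ℤ}
    (f : (toK A).obj P ⟶ (toK A).obj Q) :
    (toK A).obj (dualComplex σ n Q) ⟶ (toK A).obj (dualComplex σ n P) :=
  (toK A).map (dualMap σ n ((toK A).map_surjective f).choose)

lemma dualK_map (n : ℤ) {P Q : CochainComplex (ModuleCat.{u} A) ℤ} (f : P ⟶ Q) :
    dualK σ n ((toK A).map f) = (toK A).map (dualMap σ n f) :=
  toK_dualMap_congr n ((toK A).map_surjective ((toK A).map f)).choose_spec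

lemma dualK_comp (n : ℤ) {P Q R : CochainComplex (ModuleCat.{u} A) ℤ}
    (f : (toK A).obj P ⟶ (toK A).obj Q) (g : (toK A).obj Q ⟶ (toK A).obj R) :
    dualK σ n (f ≫ g) = dualK σ n g ≫ dualK σ n f := by
  obtain ⟨f, rfl⟩ := (toK A).map_surjective f
  obtain ⟨g, rfl⟩ := (toK A).map_surjective g
  rw [← Functor.map_comp, dualK_map, dualK_map, dualK_map, dualMap_comp, Functor.map_comp]

lemma dualK_id (n : ℤ) (P : CochainComplex (ModuleCat.{u} A) ℤ) :
    dualK σ n (𝟙 ((toK A).obj P)) = 𝟙 _ := by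
  rw [← CategoryTheory.Functor.map_id, dualK_map, dualMap_id, CategoryTheory.Functor.map_id]

lemma dualK_add (n : ℤ) {P Q : CochainComplex (ModuleCat.{u} A) ℤ}
    (f g : (toK A).obj P ⟶ (toK A).obj Q) :
    dualK σ n (f + g) = dualK σ n f + dualK σ n g := by
  obtain ⟨f, rfl⟩ := (toK A).map_surjective f
  obtain ⟨g, rfl⟩ := (toK A).map_surjective g
  rw [← Functor.map_add, dualK_map, dualK_map, dualK_map, dualMap_add, Functor.map_add]

lemma dualK_zero (n : ℤ) (P Q : CochainComplex (ModuleCat.{u} A) ℤ) :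
    dualK σ n (0 : (toK A).obj P ⟶ (toK A).obj Q) = 0 := by
  rw [← Functor.map_zero, dualK_map, dualMap_zero, Functor.map_zero]

lemma dualMap_neg (n : ℤ) {P Q : CochainComplex (ModuleCat.{u} A) ℤ} (f : P ⟶ Q) :
    dualMap σ n (-f) = -dualMap σ n f := by
  rw [eq_neg_iff_add_eq_zero, ← dualMap_add, neg_add_cancel, dualMap_zero]

lemma isIso_dualK (n : ℤ) {P Q : CochainComplex (ModuleCat.{u} A) ℤ}
    (f : (toK A).obj P ⟶ (toK A).obj Q) [IsIso f] : IsIso (dualK σ n f) :=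
  ⟨dualK σ n (inv f), by rw [← dualK_comp, IsIso.inv_hom_id, dualK_id],
    by rw [← dualK_comp, IsIso.hom_inv_id, dualK_id]⟩

lemma doubleDual_naturalityK (n : ℤ) {P Q : CochainComplex (ModuleCat.{u} A) ℤ}
    (g : (toK A).obj P ⟶ (toK A).obj Q) :
    (toK A).map (doubleDual σ n P) ≫ dualK σ n (dualK σ n g) =
      g ≫ (toK A).map (doubleDual σ n Q) := by
  obtain ⟨g, rfl⟩ := (toK A).map_surjective g
  rw [dualK_map, dualK_map, ← Functor.map_comp, doubleDual_naturality, Functor.map_comp]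

lemma doubleDual_dual (n : ℤ) (P : CochainComplex (ModuleCat.{u} A) ℤ) :
    doubleDual σ n (dualComplex σ n P) ≫ dualMap σ n (doubleDual σ n P) = 𝟙 _ := by
  have key : ∀ (i l : ℤ) (hl : i = l) (hk : -n - i = -n - l),
      (show ModuleCat.of A (HermDual σ (P.X (-n - i))) ⟶ ModuleCat.of A (HermDual σ (P.X (-n - l)))
        from ((dualComplex σ n P).XIsoOfEq hl).hom) ≫
        hermEval σ (ModuleCat.of A (HermDual σ (P.X (-n - l)))) ≫
        hermDualMap σ ((P.XIsoOfEq hk).hom ≫ hermEval σ (P.X (-n - l))) = 𝟙 _ := by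
    rintro i _ rfl _
    refine ModuleCat.hom_ext <| LinearMap.ext fun (f : HermDual σ (P.X (-n - i))) =>
      HermDual.ext (σ := σ) fun x => ?_
    exact RingInvo.involution σ (f x)
  ext i : 1
  have h := key i (-n - (-n - i)) (by omega) (by omega)
  change ((n * (n + 1) / 2).negOnePow • (((dualComplex σ n P).XIsoOfEq _).hom ≫
    hermEval σ (ModuleCat.of A (HermDual σ (P.X (-n - (-n - (-n - i)))))))) ≫
    hermDualMap σ ((n * (n + 1) / 2).negOnePow • ((P.XIsoOfEq _).hom ≫
      hermEval σ (P.X (-n - (-n - (-n - i)))))) = _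
  rw [hermDualMap_unit_smul, Linear.units_smul_comp, Linear.comp_units_smul, smul_smul,
    Int.units_mul_self, one_smul]
  exact (Category.assoc _ _ _).trans h

/-- The transpose `L → X^#` of a map `X → L^#` in the homotopy category. -/
noncomputable def transposeK (σ : RingInvo A) (n : ℤ) {X L : CochainComplex (ModuleCat.{u} A) ℤ}
    (u : (toK A).obj X ⟶ (toK A).obj (dualComplex σ n L)) :
    (toK A).obj L ⟶ (toK A).obj (dualComplex σ n X) :=
  (toK A).map (doubleDual σ n L) ≫ dualK σ n u

lemma transposeK_transposeK (n : ℤ) {X L : CochainComplex (ModuleCat.{u} A) ℤ}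
    (u : (toK A).obj X ⟶ (toK A).obj (dualComplex σ n L)) :
    transposeK σ n (transposeK σ n u) = u := by
  rw [transposeK, transposeK, dualK_comp, ← Category.assoc, doubleDual_naturalityK, dualK_map,
    Category.assoc, ← Functor.map_comp, doubleDual_dual, CategoryTheory.Functor.map_id,
    Category.comp_id]

lemma transposeK_comp_dualK (n : ℤ) {X Y L : CochainComplex (ModuleCat.{u} A) ℤ}
    (u : (toK A).obj X ⟶ (toK A).obj (dualComplex σ n L))
    (g : (toK A).obj Y ⟶ (toK A).obj L) :
    transposeK σ n (u ≫ dualK σ n g) = g ≫ transposeK σ n u := by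
  rw [transposeK, transposeK, dualK_comp, ← Category.assoc, doubleDual_naturalityK, Category.assoc]

lemma transposeK_comp (n : ℤ) {X Y L : CochainComplex (ModuleCat.{u} A) ℤ}
    (f : (toK A).obj Y ⟶ (toK A).obj X)
    (u : (toK A).obj X ⟶ (toK A).obj (dualComplex σ n L)) :
    transposeK σ n (f ≫ u) = transposeK σ n u ≫ dualK σ n f := by
  rw [transposeK, transposeK, dualK_comp, Category.assoc]

lemma transposeK_zero (n : ℤ) (X L : CochainComplex (ModuleCat.{u} A) ℤ) :
    transposeK σ n (0 : (toK A).obj X ⟶ (toK A).obj (dualComplex σ n L)) = 0 := by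
  rw [transposeK, dualK_zero, comp_zero]

lemma transposeK_add (n : ℤ) {X L : CochainComplex (ModuleCat.{u} A) ℤ}
    (u v : (toK A).obj X ⟶ (toK A).obj (dualComplex σ n L)) :
    transposeK σ n (u + v) = transposeK σ n u + transposeK σ n v := by
  rw [transposeK, dualK_add, Preadditive.comp_add, transposeK, transposeK]

lemma transposeK_eq_zero_iff (n : ℤ) {X L : CochainComplex (ModuleCat.{u} A) ℤ}
    {u : (toK A).obj X ⟶ (toK A).obj (dualComplex σ n L)} : transposeK σ n u = 0 ↔ u = 0 :=
  ⟨fun h => by rw [← transposeK_transposeK n u, h, transposeK_zero],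
    fun h => by rw [h, transposeK_zero]⟩

lemma isIso_dualShift (n : ℤ) (P : CochainComplex (ModuleCat.{u} A) ℤ) :
    IsIso (dualShift σ n P) := by
  have : ∀ i, IsIso ((dualShift σ n P).f i) := fun i =>
    ⟨hermDualMap σ (P.XIsoOfEq (show -(n - 1) - (i + 1) = -n - i by omega)).inv, by
      change hermDualMap σ _ ≫ hermDualMap σ _ = _
      rw [← hermDualMap_comp, Iso.inv_hom_id]; rfl, by
      change hermDualMap σ _ ≫ hermDualMap σ _ = _
      rw [← hermDualMap_comp, Iso.hom_inv_id]; rfl⟩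
  exact HomologicalComplex.Hom.isIso_of_components _

end HomotopyDuality

/-! ### Witt classes -/

section WittClass

open CategoryTheory CategoryTheory.Limits CategoryTheory.Pretriangulated

variable {A : Type u} [Ring A] {σ : RingInvo A} {n : ℤ}

lemma distinguished_of_split {C : Type*} [Category C] [HasZeroObject C] [HasShift C ℤ]
    [Preadditive C] [∀ n : ℤ, (shiftFunctor C n).Additive] [Pretriangulated C] {X Y Z : C}
    (α : Y ⟶ Z) (γ : Z ⟶ X⟦(1 : ℤ)⟧) (ρ : Z ⟶ Y) (θ : X⟦(1 : ℤ)⟧ ⟶ Z)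
    (hρ : α ≫ ρ = 𝟙 _) (h23 : α ≫ γ = 0) (hθ : θ ≫ γ = 𝟙 _)
    (htot : ρ ≫ α + γ ≫ θ = 𝟙 _) : Triangle.mk (0 : X ⟶ Y) α γ ∈ distTriang C := by
  have hθρ : θ ≫ ρ = 0 := by
    have h : θ ≫ ρ ≫ α = 0 := by
      have := congrArg (θ ≫ ·) htot
      simpa [reassoc_of% hθ] using this
    rw [← Category.comp_id (θ ≫ ρ), ← hρ]
    simp only [Category.assoc]
    rw [← Category.assoc ρ, ← Category.assoc θ, h, zero_comp]
  let e : Z ≅ Y ⊞ X⟦(1 : ℤ)⟧ :=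
    { hom := biprod.lift ρ γ
      inv := biprod.desc α θ
      hom_inv_id := by rw [biprod.lift_desc, htot]
      inv_hom_id := by ext <;> simp [hρ, h23, hθ, hθρ] }
  rw [rotate_distinguished_triangle]
  refine isomorphic_distinguished _ (binaryBiproductTriangle_distinguished
    Y (X⟦(1 : ℤ)⟧)) _ (Triangle.isoMk _ _ (Iso.refl _) e (Iso.refl _) ?_ ?_ ?_)
  · change α ≫ biprod.lift ρ γ = 𝟙 _ ≫ biprod.inl
    ext <;> simp [hρ, h23]
  · change γ ≫ 𝟙 _ = biprod.lift ρ γ ≫ biprod.snd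
    simp
  · change (-(0 : X ⟶ Y)⟦(1 : ℤ)⟧') ≫ _ = 𝟙 _ ≫ (0 : _ ⟶ _)
    rw [Functor.map_zero, neg_zero]
    exact zero_comp.trans comp_zero.symm

namespace SymSpace

/-- The form of a symmetric space, as a morphism of the homotopy category. -/
noncomputable abbrev formK (P : SymSpace σ n) :
    (toK A).obj P.K ⟶ (toK A).obj (dualComplex σ n P.K) :=
  (toK A).map P.φ

lemma transposeK_formK (P : SymSpace σ n) : transposeK σ n P.formK = P.formK := by
  rw [transposeK, formK, dualK_map, ← Functor.map_comp, P.symm]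

/-- The symmetric space with a given form in the homotopy category. -/
noncomputable def ofK (K : CochainComplex (ModuleCat.{u} A) ℤ) (perf : IsPerf K)
    (e : (toK A).obj K ⟶ (toK A).obj (dualComplex σ n K)) (he : transposeK σ n e = e)
    (hiso : IsIso e) : SymSpace σ n where
  K := K
  perf := perf
  φ := ((toK A).map_surjective e).choose
  symm := by
    have h := ((toK A).map_surjective e).choose_spec
    rw [Functor.map_comp, ← dualK_map, h]
    exact he
  nondeg := by rwa [((toK A).map_surjective e).choose_spec]

@[simp] lemma ofK_formK (K : CochainComplex (ModuleCat.{u} A) ℤ) (perf : IsPerf K)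
    (e : (toK A).obj K ⟶ (toK A).obj (dualComplex σ n K)) (he : transposeK σ n e = e)
    (hiso : IsIso e) : (ofK K perf e he hiso).formK = e :=
  ((toK A).map_surjective e).choose_spec

lemma Isometric.ofK {P Q : SymSpace σ n} (g : (toK A).obj P.K ⟶ (toK A).obj Q.K) (hg : IsIso g)
    (h : g ≫ Q.formK ≫ dualK σ n g = P.formK) : P.Isometric Q := by
  obtain ⟨g, rfl⟩ := (toK A).map_surjective g
  exact ⟨g, hg, by rw [Functor.map_comp, Functor.map_comp, ← dualK_map]; exact h⟩

lemma Isometric.exists_iso {P Q : SymSpace σ n} (h : P.Isometric Q) :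
    ∃ g : (toK A).obj P.K ⟶ (toK A).obj Q.K, IsIso g ∧
      g ≫ Q.formK ≫ dualK σ n g = P.formK := by
  obtain ⟨g, hg, h⟩ := h
  exact ⟨(toK A).map g, hg, by rw [dualK_map, ← Functor.map_comp, ← Functor.map_comp, h]⟩

/-- The restriction of a form along a map. -/
def pullback (P : SymSpace σ n) (K : CochainComplex (ModuleCat.{u} A) ℤ) (perf : IsPerf K)
    (g : K ⟶ P.K) (hiso : IsIso ((toK A).map (g ≫ P.φ ≫ dualMap σ n g))) : SymSpace σ n where
  K := K
  perf := perf
  φ := g ≫ P.φ ≫ dualMap σ n g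
  symm := by
    simp only [dualMap_comp, ← Category.assoc, doubleDual_naturality]
    simp only [Category.assoc, Functor.map_comp _ g]
    rw [← Category.assoc (doubleDual σ n P.K), Functor.map_comp, P.symm, ← Functor.map_comp]
  nondeg := hiso

/-- The space with the opposite form. -/
def neg (P : SymSpace σ n) : SymSpace σ n where
  K := P.K
  perf := P.perf
  φ := -P.φ
  symm := by
    rw [dualMap_neg, Preadditive.comp_neg, Functor.map_neg, Functor.map_neg, P.symm]
  nondeg := by
    have := P.nondeg
    rw [Functor.map_neg]
    exact ⟨-inv ((toK A).map P.φ), by simp, by simp⟩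

/-- A symmetric space is neutral as soon as it is, as a complex up to homotopy, the sum of `L` and
of its dual, where `L` is isotropic: the extension of `L^#` by `L` is then split, and the form `w`
is zero. -/
lemma neutral_of_split (P : SymSpace σ n) (L : CochainComplex (ModuleCat.{u} A) ℤ) (perf : IsPerf L)
    (α : L ⟶ P.K) (ρ : P.K ⟶ L) (θ : dualComplex σ n L ⟶ P.K) (hα : α ≫ ρ = 𝟙 L)
    (h0 : α ≫ P.φ ≫ dualMap σ n α = 0)
    (hθ : (toK A).map (θ ≫ P.φ ≫ dualMap σ n α) = 𝟙 _)
    (htot : (toK A).map (ρ ≫ α + (P.φ ≫ dualMap σ n α) ≫ θ) = 𝟙 _) : P.Neutral := by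
  refine ⟨L, perf, α, 0, by simp [dualMap_zero], ?_⟩
  have := isIso_dualShift (σ := σ) n L
  let e : (toK A).obj (dualComplex σ n L) ≅ ((toK A).obj (dualComplex σ (n - 1) L))⟦(1 : ℤ)⟧ :=
    asIso ((toK A).map (dualShift σ n L)) ≪≫ ((toK A).commShiftIso (1 : ℤ)).app _
  have key := distinguished_of_split (X := (toK A).obj (dualComplex σ (n - 1) L))
    ((toK A).map α) ((toK A).map (P.φ ≫ dualMap σ n α) ≫ e.hom) ((toK A).map ρ)
    (e.inv ≫ (toK A).map θ) (by rw [← Functor.map_comp, hα, CategoryTheory.Functor.map_id])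
    (by rw [← Category.assoc, ← Functor.map_comp, h0, Functor.map_zero, zero_comp])
    (by rw [Category.assoc, ← Category.assoc _ _ e.hom, ← Functor.map_comp, hθ, Category.id_comp,
      Iso.inv_hom_id])
    (by rw [Category.assoc, Iso.hom_inv_id_assoc, ← Functor.map_comp, ← Functor.map_comp,
      ← Functor.map_add, htot])
  rw [← Functor.map_zero (toK A)] at key
  have h3 : (toK A).map (P.φ ≫ dualMap σ n α) ≫ e.hom =
      (toK A).map (P.φ ≫ dualMap σ n α ≫ dualShift σ n L) ≫
        ((toK A).commShiftIso (1 : ℤ)).hom.app (dualComplex σ (n - 1) L) := by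
    simp [e]
  rw [h3] at key
  exact key

/-- The class of a symmetric space in the Witt group. -/
def wittClass (P : SymSpace σ n) : WittGroup σ n := QuotientAddGroup.mk (.of P)

lemma wittClass_orthSum (P Q : SymSpace σ n) :
    (P.orthSum Q).wittClass = P.wittClass + Q.wittClass := by
  have : FreeAbelianGroup.of (P.orthSum Q) - .of P - .of Q ∈ wittRelations σ n :=
    AddSubgroup.subset_closure (Or.inl (Or.inl ⟨P, Q, rfl⟩))
  rw [← QuotientAddGroup.eq_zero_iff, QuotientAddGroup.mk_sub, QuotientAddGroup.mk_sub,
    sub_sub, sub_eq_zero] at this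
  exact this

lemma Isometric.wittClass_eq {P Q : SymSpace σ n} (h : P.Isometric Q) :
    P.wittClass = Q.wittClass := by
  have : FreeAbelianGroup.of P - .of Q ∈ wittRelations σ n :=
    AddSubgroup.subset_closure (Or.inl (Or.inr ⟨P, Q, h, rfl⟩))
  rw [← QuotientAddGroup.eq_zero_iff, QuotientAddGroup.mk_sub, sub_eq_zero] at this
  exact this

lemma Neutral.wittClass_eq {P : SymSpace σ n} (h : P.Neutral) : P.wittClass = 0 :=
  (QuotientAddGroup.eq_zero_iff _).2 (AddSubgroup.subset_closure (Or.inr ⟨P, h, rfl⟩))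

/-- The diagonal is a Lagrangian of the sum of a space and its opposite. -/
lemma wittClass_neg (P : SymSpace σ n) : P.neg.wittClass = -P.wittClass := by
  rw [eq_neg_iff_add_eq_zero, add_comm, ← wittClass_orthSum]
  refine Neutral.wittClass_eq ?_
  have := P.nondeg
  obtain ⟨ψ, hψ⟩ := (toK A).map_surjective (inv P.formK)
  have h1 : (toK A).map (P.φ ≫ ψ) = (toK A).map (𝟙 _) := by
    rw [Functor.map_comp, hψ, IsIso.hom_inv_id, CategoryTheory.Functor.map_id]
  have h2 : (toK A).map (ψ ≫ P.φ) = 𝟙 _ := by rw [Functor.map_comp, hψ, IsIso.inv_hom_id]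
  let α : P.K ⟶ P.K ⊞ P.K := biprod.lift (𝟙 _) (𝟙 _)
  have hφ : orthForm P.φ (-P.φ) ≫ dualMap σ n α = (biprod.fst - biprod.snd) ≫ P.φ := by
    rw [orthForm, Preadditive.add_comp, Category.assoc, Category.assoc, Category.assoc,
      Category.assoc, ← dualMap_comp, ← dualMap_comp, biprod.lift_fst, biprod.lift_snd, dualMap_id,
      Category.comp_id, Category.comp_id, Preadditive.comp_neg, Preadditive.sub_comp,
      sub_eq_add_neg]
  let θ : dualComplex σ n P.K ⟶ P.K ⊞ P.K := -(ψ ≫ biprod.inr)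
  have htot : (toK A).map (biprod.fst ≫ α +
      (orthForm P.φ (-P.φ) ≫ dualMap σ n α) ≫ θ) =
      𝟙 ((toK A).obj (P.K ⊞ P.K)) := by
    have e1 : biprod.fst ≫ α + ((biprod.fst - biprod.snd) ≫ P.φ) ≫ (-(ψ ≫ biprod.inr)) =
        biprod.fst ≫ α - (biprod.fst - biprod.snd) ≫ (P.φ ≫ ψ) ≫ biprod.inr := by
      simp [sub_eq_add_neg]
    have e2 : 𝟙 (P.K ⊞ P.K) = biprod.fst ≫ α - (biprod.fst - biprod.snd) ≫ 𝟙 _ ≫ biprod.inr := by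
      apply biprod.hom_ext <;> simp [α]
    rw [hφ, show θ = -(ψ ≫ biprod.inr) from rfl, e1, ← CategoryTheory.Functor.map_id, e2,
      Functor.map_sub, Functor.map_sub,
      Functor.map_comp _ (biprod.fst - biprod.snd), Functor.map_comp _ _ biprod.inr, h1]
    simp only [Functor.map_comp]
  have hθ : (toK A).map (θ ≫ orthForm P.φ (-P.φ) ≫ dualMap σ n α) = 𝟙 _ := by
    rw [hφ, ← h2]
    congr 1
    simp [θ, Preadditive.comp_sub, Preadditive.sub_comp]
  refine neutral_of_split (P.orthSum P.neg) P.K P.perf α biprod.fst θ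
    (biprod.lift_fst _ _) ?_ hθ htot
  change α ≫ orthForm P.φ (-P.φ) ≫ dualMap σ n α = 0
  rw [hφ, ← Category.assoc, Preadditive.comp_sub, biprod.lift_fst, biprod.lift_snd, sub_self,
    zero_comp]

variable (σ n) in
lemma closure_range_wittClass :
    AddSubgroup.closure (Set.range (wittClass : SymSpace σ n → WittGroup σ n)) = ⊤ := by
  rw [eq_top_iff]
  rintro ⟨x⟩ -
  change QuotientAddGroup.mk x ∈ _
  induction x using FreeAbelianGroup.induction_on with
  | zero => exact zero_mem _
  | of P => exact AddSubgroup.subset_closure ⟨P, rfl⟩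
  | neg P h => exact neg_mem h
  | add x y hx hy => exact add_mem hx hy

/-- An invariant of symmetric spaces that is additive, invariant under isometries and zero on
neutral spaces is a homomorphism on the Witt group. -/
def wittLift {G : Type*} [AddCommGroup G] (Φ : SymSpace σ n → G)
    (hadd : ∀ P Q : SymSpace σ n, Φ (P.orthSum Q) = Φ P + Φ Q)
    (hiso : ∀ P Q : SymSpace σ n, P.Isometric Q → Φ P = Φ Q)
    (hneutral : ∀ P : SymSpace σ n, P.Neutral → Φ P = 0) : WittGroup σ n →+ G :=
  QuotientAddGroup.lift _ (FreeAbelianGroup.lift Φ) (by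
    rw [wittRelations, AddSubgroup.closure_le]
    rintro x ((⟨P, Q, rfl⟩ | ⟨P, Q, h, rfl⟩) | ⟨P, h, rfl⟩)
    · simp [hadd]
    · simp [hiso P Q h]
    · simp [hneutral P h])

lemma wittLift_wittClass {G : Type*} [AddCommGroup G] (Φ : SymSpace σ n → G)
    (hadd : ∀ P Q : SymSpace σ n, Φ (P.orthSum Q) = Φ P + Φ Q)
    (hiso : ∀ P Q : SymSpace σ n, P.Isometric Q → Φ P = Φ Q)
    (hneutral : ∀ P : SymSpace σ n, P.Neutral → Φ P = 0) (P : SymSpace σ n) :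
    wittLift Φ hadd hiso hneutral P.wittClass = Φ P :=
  FreeAbelianGroup.lift_apply_of _ _

end SymSpace

end WittClass

/-! ### Formality of complexes over semisimple rings -/

section ZeroDifferential

open CategoryTheory CategoryTheory.Limits CategoryTheory.Pretriangulated

variable {A : Type u} [Ring A] {σ : RingInvo A}

/-- The differentials of the complex vanish. -/
def ZeroDiff (K : CochainComplex (ModuleCat.{u} A) ℤ) : Prop := ∀ i j, K.d i j = 0

namespace ZeroDiff

variable {K L : CochainComplex (ModuleCat.{u} A) ℤ}

lemma map_injective (hK : ZeroDiff K) (hL : ZeroDiff L) {f g : K ⟶ L}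
    (h : (toK A).map f = (toK A).map g) : f = g := by
  ext i : 1
  have e := (HomotopyCategory.homotopyOfEq _ _ h).comm i
  rwa [dNext_eq _ (show (ComplexShape.up ℤ).Rel i (i + 1) by simp),
    prevD_eq _ (show (ComplexShape.up ℤ).Rel (i - 1) i by simp), hK, hL, zero_comp, comp_zero,
    zero_add, zero_add] at e

lemma isIso (hK : ZeroDiff K) (hL : ZeroDiff L) {f : K ⟶ L} (h : IsIso ((toK A).map f)) :
    IsIso f := by
  obtain ⟨g, hg⟩ := (toK A).map_surjective (inv ((toK A).map f))
  exact ⟨g, map_injective hK hK (by rw [Functor.map_comp, hg, IsIso.hom_inv_id,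
      CategoryTheory.Functor.map_id]),
    map_injective hL hL (by rw [Functor.map_comp, hg, IsIso.inv_hom_id,
      CategoryTheory.Functor.map_id])⟩

lemma dual (hK : ZeroDiff K) (n : ℤ) : ZeroDiff (dualComplex σ n K) := fun i j => by
  rw [dualComplex_d, hK, dualTerm_zero, smul_zero]

end ZeroDiff

/-- The complex with zero differentials formed by submodules of the terms of a complex. -/
def subComplex (K : CochainComplex (ModuleCat.{u} A) ℤ) (N : ∀ i, Submodule A (K.X i)) :
    CochainComplex (ModuleCat.{u} A) ℤ where
  X i := ModuleCat.of A (N i)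
  d _ _ := 0

lemma zeroDiff_subComplex (K : CochainComplex (ModuleCat.{u} A) ℤ)
    (N : ∀ i, Submodule A (K.X i)) : ZeroDiff (subComplex K N) := fun _ _ => rfl

/-- The inclusion of a family of submodules consisting of cycles. -/
def subIncl (K : CochainComplex (ModuleCat.{u} A) ℤ) (N : ∀ i, Submodule A (K.X i))
    (hN : ∀ i j, ∀ x ∈ N i, (K.d i j).hom x = 0) : subComplex K N ⟶ K where
  f i := ModuleCat.ofHom (N i).subtype
  comm' i j _ := by
    refine (ModuleCat.hom_ext <| LinearMap.ext fun (x : N i) => ?_ :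
      ModuleCat.ofHom (N i).subtype ≫ K.d i j = 0).trans zero_comp.symm
    exact hN i j x x.2

lemma IsPerf.subComplex [IsSemisimpleRing A] {K : CochainComplex (ModuleCat.{u} A) ℤ}
    (hK : IsPerf K) (N : ∀ i, Submodule A (K.X i)) : IsPerf (subComplex K N) where
  finite i := by
    have := hK.finite i
    exact inferInstanceAs (Module.Finite A (N i))
  projective i := Module.projective_of_isSemisimpleRing A (N i)
  bounded := by
    obtain ⟨a, b, h⟩ := hK.bounded
    refine ⟨a, b, fun i hi => ?_⟩
    have := ModuleCat.subsingleton_of_isZero (h i hi)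
    exact ModuleCat.isZero_of_iff_subsingleton.2 (inferInstanceAs (Subsingleton (N i)))

lemma LinearMap.exists_comp_comp_eq_self [IsSemisimpleRing A] {M N : Type*} [AddCommGroup M]
    [AddCommGroup N] [Module A M] [Module A N] (f : M →ₗ[A] N) :
    ∃ g : N →ₗ[A] M, f ∘ₗ g ∘ₗ f = f := by
  have := Module.projective_of_isSemisimpleRing A (LinearMap.range f)
  obtain ⟨s, hs⟩ := Module.projective_lifting_property f.rangeRestrict LinearMap.id
    f.surjective_rangeRestrict
  obtain ⟨q, hq⟩ := exists_isCompl (LinearMap.range f)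
  refine ⟨s ∘ₗ Submodule.projectionOnto _ q hq, LinearMap.ext fun x => ?_⟩
  have h1 : Submodule.projectionOnto _ q hq (f x) = f.rangeRestrict x :=
    Submodule.projectionOnto_apply_left hq (f.rangeRestrict x)
  have h2 := LinearMap.congr_fun hs (f.rangeRestrict x)
  simpa [h1] using congrArg Subtype.val h2

/-- A complex over a semisimple ring admits a family `s` of maps of degree `-1` which splits the
differential and satisfies the side conditions `s d s = s` and `s s d = 0`. -/
lemma exists_splitting [IsSemisimpleRing A] (K : CochainComplex (ModuleCat.{u} A) ℤ) :
    ∃ s : ∀ i j, K.X i ⟶ K.X j, (∀ i j, ¬ (ComplexShape.up ℤ).Rel j i → s i j = 0) ∧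
      (∀ i j, K.d j i ≫ s i j ≫ K.d j i = K.d j i) ∧
      (∀ i j, s i j ≫ K.d j i ≫ s i j = s i j) ∧
      (∀ i j k, j + 1 = i → K.d j i ≫ s i j ≫ s j k = 0) := by
  have h0 : ∀ i j, ∃ s : K.X i ⟶ K.X j, (¬ (ComplexShape.up ℤ).Rel j i → s = 0) ∧
      K.d j i ≫ s ≫ K.d j i = K.d j i := fun i j => by
    by_cases h : (ComplexShape.up ℤ).Rel j i
    · obtain ⟨g, hg⟩ := LinearMap.exists_comp_comp_eq_self (K.d j i).hom
      exact ⟨ModuleCat.ofHom g, fun h' => absurd h h', ModuleCat.hom_ext hg⟩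
    · exact ⟨0, fun _ => rfl, by rw [K.shape _ _ h]; simp⟩
  choose s₀ hz hs₀ using h0
  set s₁ : ∀ i j, K.X i ⟶ K.X j := fun i j => s₀ i j ≫ K.d j i ≫ s₀ i j with hs₁
  have hz₁ : ∀ i j, ¬ (ComplexShape.up ℤ).Rel j i → s₁ i j = 0 := fun i j h => by
    simp [hs₁, hz i j h]
  have h1 : ∀ i j, K.d j i ≫ s₁ i j ≫ K.d j i = K.d j i := fun i j => by
    simp only [hs₁, Category.assoc]
    rw [← Category.assoc (s₀ i j), ← Category.assoc (K.d j i), hs₀, hs₀]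
  have h2 : ∀ i j, s₁ i j ≫ K.d j i ≫ s₁ i j = s₁ i j := fun i j => by
    change (s₀ i j ≫ K.d j i ≫ s₀ i j) ≫ K.d j i ≫ s₁ i j = s₁ i j
    have : (K.d j i ≫ s₀ i j ≫ K.d j i) ≫ s₁ i j = K.d j i ≫ s₀ i j := by
      rw [hs₀]
      simp only [hs₁]
      rw [reassoc_of% hs₀]
    simp only [Category.assoc] at this ⊢
    rw [this]
  refine ⟨fun i j => s₁ i j - K.d i (i + 1) ≫ s₁ (i + 1) i ≫ s₁ i j, fun i j h => ?_,
    fun i j => ?_, fun i j => ?_, fun i j k h => ?_⟩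
  · simp [hz₁ i j h]
  · simp [Preadditive.sub_comp, Preadditive.comp_sub, h1]
  · simp [Preadditive.sub_comp, Preadditive.comp_sub, h2]
  · subst h
    simp [Preadditive.sub_comp, Preadditive.comp_sub, reassoc_of% h1]

/-- A bounded complex of finitely generated modules over a semisimple ring is homotopy equivalent
to a complex with zero differentials, namely to its harmonic part `ker d ∩ ker s`. -/
theorem IsPerf.exists_zeroDiff [IsSemisimpleRing A] {K : CochainComplex (ModuleCat.{u} A) ℤ}
    (hK : IsPerf K) : ∃ (H : CochainComplex (ModuleCat.{u} A) ℤ) (ι : H ⟶ K),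
      IsPerf H ∧ ZeroDiff H ∧ IsIso ((toK A).map ι) := by
  obtain ⟨s, hz, h1, h2, h3⟩ := exists_splitting K
  let N : ∀ i, Submodule A (K.X i) := fun i =>
    LinearMap.ker (K.d i (i + 1)).hom ⊓ LinearMap.ker (s i (i - 1)).hom
  have hN : ∀ i j, ∀ x ∈ N i, (K.d i j).hom x = 0 := fun i j x hx => by
    by_cases h : i + 1 = j
    · subst h; exact hx.1
    · rw [K.shape i j (by simpa using h)]; rfl
  let r₀ : ∀ i, K.X i ⟶ K.X i := fun i =>
    𝟙 _ - s i (i - 1) ≫ K.d (i - 1) i - K.d i (i + 1) ≫ s (i + 1) i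
  have hr₀d : ∀ i, r₀ i ≫ K.d i (i + 1) = 0 := fun i => by
    simp [r₀, Preadditive.sub_comp, h1]
  have hr₀s : ∀ i, r₀ i ≫ s i (i - 1) = 0 := fun i => by
    simp [r₀, Preadditive.sub_comp, h2, h3 (i + 1) i (i - 1) rfl]
  have hdr₀ : ∀ i, K.d i (i + 1) ≫ r₀ (i + 1) = 0 := fun i => by
    have h := h1 (i + 1) (i + 1 - 1)
    have e : i + 1 - 1 = i := by omega
    have : K.d i (i + 1) ≫ s (i + 1) (i + 1 - 1) ≫ K.d (i + 1 - 1) (i + 1) = K.d i (i + 1) := by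
      rw [e]; exact h1 (i + 1) i
    simp [r₀, Preadditive.comp_sub, this]
  let r : K ⟶ _root_.subComplex K N :=
    { f := fun i => ModuleCat.ofHom (LinearMap.codRestrict (N i) (r₀ i).hom fun x =>
        ⟨congrArg (fun f : K.X i ⟶ K.X (i + 1) => f.hom x) (hr₀d i),
          congrArg (fun f : K.X i ⟶ K.X (i - 1) => f.hom x) (hr₀s i)⟩)
      comm' := fun i j hij => by
        obtain rfl : i + 1 = j := hij
        refine comp_zero.trans (Eq.symm ?_)
        refine ModuleCat.hom_ext <| LinearMap.ext fun x => Subtype.ext ?_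
        exact congrArg (fun f : K.X i ⟶ K.X (i + 1) => f.hom x) (hdr₀ i) }
  let ι := subIncl K N hN
  have hιr : ι ≫ r = 𝟙 _ := by
    ext i : 1
    refine ModuleCat.hom_ext <| LinearMap.ext fun (x : N i) => Subtype.ext ?_
    change (x : K.X i) - (K.d (i - 1) i).hom ((s i (i - 1)).hom x) -
      (s (i + 1) i).hom ((K.d i (i + 1)).hom x) = x
    rw [show (s i (i - 1)).hom (x : K.X i) = 0 from x.2.2,
      show (K.d i (i + 1)).hom (x : K.X i) = 0 from x.2.1]
    simp
  have hrι : Homotopy (𝟙 K) (r ≫ ι) :=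
    { hom := s
      zero := hz
      comm := fun i => by
        rw [dNext_eq _ (show (ComplexShape.up ℤ).Rel i (i + 1) by simp),
          prevD_eq _ (show (ComplexShape.up ℤ).Rel (i - 1) i by simp)]
        have : (r ≫ ι).f i = r₀ i := rfl
        rw [this]
        simp only [r₀, HomologicalComplex.id_f]
        abel }
  refine ⟨_, ι, hK.subComplex N, zeroDiff_subComplex K N, (toK A).map r, ?_, ?_⟩
  · rw [← Functor.map_comp, hιr, CategoryTheory.Functor.map_id]
  · rw [← Functor.map_comp, ← HomotopyCategory.eq_of_homotopy _ _ hrι,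
      CategoryTheory.Functor.map_id]

lemma SymSpace.exists_isometric_zeroDiff [IsSemisimpleRing A] {n : ℤ} (P : SymSpace σ n) :
    ∃ Q : SymSpace σ n, ZeroDiff Q.K ∧ Q.Isometric P := by
  obtain ⟨H, ι, hH, h0, hι⟩ := P.perf.exists_zeroDiff
  have := P.nondeg
  have := isIso_dualK (σ := σ) n ((toK A).map ι)
  have hiso : IsIso ((toK A).map (ι ≫ P.φ ≫ dualMap σ n ι)) := by
    rw [Functor.map_comp, Functor.map_comp, ← dualK_map]
    infer_instance
  exact ⟨P.pullback H hH ι hiso, h0, ι, hι, rfl⟩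

end ZeroDifferential

/-! ### Orthogonality in symmetric spaces with zero differentials -/

section Orthogonality

open CategoryTheory CategoryTheory.Limits CategoryTheory.Pretriangulated

variable {A : Type u} [Ring A] {σ : RingInvo A} {n : ℤ}

lemma ModuleCat.isIso_of_bijective {M N : ModuleCat.{u} A} (f : M ⟶ N)
    (hf : Function.Bijective f.hom) : IsIso f :=
  inferInstanceAs (IsIso (LinearEquiv.ofBijective f.hom hf).toModuleIso.hom)

lemma ModuleCat.bijective_of_isIso {M N : ModuleCat.{u} A} (f : M ⟶ N) [IsIso f] :
    Function.Bijective f.hom :=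
  (asIso f).toLinearEquiv.bijective

lemma XIsoOfEq_hom_mem_iff {K : CochainComplex (ModuleCat.{u} A) ℤ}
    (N : ∀ i, Submodule A (K.X i)) {i j : ℤ} (h : i = j) (x : K.X i) :
    (K.XIsoOfEq h).hom.hom x ∈ N j ↔ x ∈ N i := by
  subst h
  rfl

lemma XIsoOfEq_hom_surjective (K : CochainComplex (ModuleCat.{u} A) ℤ) {i j : ℤ} (h : i = j) :
    Function.Surjective (K.XIsoOfEq h).hom.hom := by
  subst h
  exact fun x => ⟨x, rfl⟩

lemma unop_apply_eq_zero_iff (σ : RingInvo A) {a : A} : (σ a).unop = 0 ↔ a = 0 := by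
  rw [MulOpposite.unop_eq_zero_iff]
  exact map_eq_zero_iff σ.toRingEquiv σ.toRingEquiv.injective

lemma LinearMap.exists_extend_of_isCompl {M N : Type*} [AddCommGroup M] [AddCommGroup N]
    [Module A M] [Module A N] {S T : Submodule A M} (h : IsCompl S T) (f : S →ₗ[A] N) :
    ∃ g : M →ₗ[A] N, (∀ x : S, g x = f x) ∧ ∀ x ∈ T, g x = 0 := by
  refine ⟨f ∘ₗ Submodule.projectionOnto S T h, fun x => ?_, fun x hx => ?_⟩
  · rw [LinearMap.comp_apply, Submodule.projectionOnto_apply_left]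
  · rw [LinearMap.comp_apply, (Submodule.projectionOnto_apply_eq_zero_iff h).2 hx, map_zero]

lemma Submodule.exists_functional_ne_zero [IsSemisimpleRing A] {M : Type*} [AddCommGroup M]
    [Module A M] (S : Submodule A M) {x : M} (hx : x ∉ S) :
    ∃ f : M →ₗ[A] A, (∀ y ∈ S, f y = 0) ∧ f x ≠ 0 := by
  obtain ⟨s, hs⟩ := (Module.projective_def'.1 (Module.projective_of_isSemisimpleRing A (M ⧸ S)))
  have hx' : s (S.mkQ x) ≠ 0 := fun h => hx <| by
    have := LinearMap.congr_fun hs (S.mkQ x)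
    rw [LinearMap.comp_apply, h, map_zero] at this
    exact (Submodule.Quotient.mk_eq_zero S).1 this.symm
  obtain ⟨m, hm⟩ := Finsupp.ne_iff.1 hx'
  refine ⟨Finsupp.lapply m ∘ₗ s ∘ₗ S.mkQ, fun y hy => ?_, hm⟩
  have : S.mkQ y = 0 := (Submodule.Quotient.mk_eq_zero S).2 hy
  simp [-Submodule.mkQ_apply, this]

lemma Pi.isCompl_apply {M : ℤ → Type*} [∀ i, AddCommGroup (M i)] [∀ i, Module A (M i)]
    {N N' : ∀ i, Submodule A (M i)} (h : IsCompl N N') (i : ℤ) : IsCompl (N i) (N' i) :=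
  Pi.isCompl_iff.1 h i

/-- A family of linear maps is a map of complexes with zero differentials. -/
def ZeroDiff.mkHom {K L : CochainComplex (ModuleCat.{u} A) ℤ} (hK : ZeroDiff K) (hL : ZeroDiff L)
    (f : ∀ i, K.X i →ₗ[A] L.X i) : K ⟶ L where
  f i := ModuleCat.ofHom (f i)
  comm' i j _ := by rw [hK, hL, zero_comp, comp_zero]

/-- The projection of a complex with zero differentials onto a graded submodule along a
complement. -/
noncomputable def subProj {K : CochainComplex (ModuleCat.{u} A) ℤ} (h0 : ZeroDiff K)
    {N N' : ∀ i, Submodule A (K.X i)} (h : IsCompl N N') : K ⟶ subComplex K N :=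
  h0.mkHom (zeroDiff_subComplex K N) fun i =>
    Submodule.projectionOnto (N i) (N' i) (Pi.isCompl_apply h i)

lemma subIncl_subProj {K : CochainComplex (ModuleCat.{u} A) ℤ} (h0 : ZeroDiff K)
    {N N' : ∀ i, Submodule A (K.X i)} (h : IsCompl N N') :
    subIncl K N (fun i j x _ => by rw [h0]; rfl) ≫ subProj h0 h = 𝟙 _ := by
  ext i : 1
  exact ModuleCat.hom_ext <| LinearMap.ext fun (x : N i) =>
    Submodule.projectionOnto_apply_left (Pi.isCompl_apply h i) x

lemma subIncl_subProj_of_isCompl {K : CochainComplex (ModuleCat.{u} A) ℤ} (h0 : ZeroDiff K)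
    {N N' : ∀ i, Submodule A (K.X i)} (h : IsCompl N N') :
    subIncl K N' (fun i j x _ => by rw [h0]; rfl) ≫ subProj h0 h = 0 := by
  ext i : 1
  exact ModuleCat.hom_ext <| LinearMap.ext fun (x : N' i) =>
    Submodule.projectionOnto_apply_right (Pi.isCompl_apply h i) x

lemma subProj_add_subProj {K : CochainComplex (ModuleCat.{u} A) ℤ} (h0 : ZeroDiff K)
    {N N' : ∀ i, Submodule A (K.X i)} (h : IsCompl N N') (h' : IsCompl N' N) :
    subProj h0 h ≫ subIncl K N (fun i j x _ => by rw [h0]; rfl) +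
      subProj h0 h' ≫ subIncl K N' (fun i j x _ => by rw [h0]; rfl) = 𝟙 K := by
  ext i : 1
  exact ModuleCat.hom_ext <| LinearMap.ext fun x =>
    Submodule.projection_add_projection_eq_self (Pi.isCompl_apply h i) x

lemma orthForm_eq_of_orthogonal {K K₁ K₂ : CochainComplex (ModuleCat.{u} A) ℤ}
    (φ : K ⟶ dualComplex σ n K) (ι₁ : K₁ ⟶ K) (ι₂ : K₂ ⟶ K)
    (h12 : ι₁ ≫ φ ≫ dualMap σ n ι₂ = 0) (h21 : ι₂ ≫ φ ≫ dualMap σ n ι₁ = 0) :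
    (biprod.fst ≫ ι₁ + biprod.snd ≫ ι₂) ≫ φ ≫ dualMap σ n (biprod.fst ≫ ι₁ + biprod.snd ≫ ι₂) =
      SymSpace.orthForm (ι₁ ≫ φ ≫ dualMap σ n ι₁) (ι₂ ≫ φ ≫ dualMap σ n ι₂) := by
  have h12' : ∀ {Z} (g : _ ⟶ Z), ι₁ ≫ φ ≫ dualMap σ n ι₂ ≫ g = 0 := fun g => by
    have := congrArg (· ≫ g) h12
    simpa using this
  have h21' : ∀ {Z} (g : _ ⟶ Z), ι₂ ≫ φ ≫ dualMap σ n ι₁ ≫ g = 0 := fun g => by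
    have := congrArg (· ≫ g) h21
    simpa using this
  simp [dualMap_add, dualMap_comp, SymSpace.orthForm, h12', h21']

namespace SymSpace

/-- The pairing between the terms of degrees `i` and `-n - i` given by the form. -/
def pair (P : SymSpace σ n) (i : ℤ) : P.K.X i →ₗ[A] HermDual σ (P.K.X (-n - i)) :=
  (P.φ.f i).hom

lemma pair_symm (P : SymSpace σ n) (h0 : ZeroDiff P.K) (i : ℤ) (x : P.K.X i)
    (y : P.K.X (-n - i)) :
    P.pair i x y = (n * (n + 1) / 2).negOnePow • (σ (P.pair (-n - i) y
      ((P.K.XIsoOfEq (show i = -n - (-n - i) by omega)).hom.hom x))).unop := by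
  have h := (h0.map_injective (h0.dual n) P.symm)
  have h1 := congrArg (fun f => (show HermDual σ (P.K.X (-n - i)) from (f.f i).hom x) y) h
  refine h1.symm.trans ?_
  change (((n * (n + 1) / 2).negOnePow • ((P.K.XIsoOfEq (show i = -n - (-n - i) by omega)).hom ≫
    hermEval σ (P.K.X (-n - (-n - i))))).hom x : HermDual σ (HermDual σ (P.K.X (-n - (-n - i)))))
    (P.pair (-n - i) y) = _
  rcases Int.units_eq_one_or (n * (n + 1) / 2).negOnePow with h | h
  · rw [h, one_smul, one_smul]; rfl
  · rw [h, Units.neg_smul, one_smul, Units.neg_smul, one_smul]; rfl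

lemma pair_eq_zero_iff (P : SymSpace σ n) (h0 : ZeroDiff P.K) (i : ℤ) (x : P.K.X i)
    (y : P.K.X (-n - i)) : P.pair i x y = 0 ↔ P.pair (-n - i) y
      ((P.K.XIsoOfEq (show i = -n - (-n - i) by omega)).hom.hom x) = 0 := by
  rw [P.pair_symm h0, smul_eq_zero_iff_eq, unop_apply_eq_zero_iff]

lemma pair_bijective (P : SymSpace σ n) (h0 : ZeroDiff P.K) (i : ℤ) :
    Function.Bijective (P.pair i) := by
  have := h0.isIso (h0.dual n) P.nondeg
  have : IsIso (P.φ.f i) := inferInstance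
  exact ModuleCat.bijective_of_isIso (P.φ.f i)

/-- The orthogonal of a graded submodule. -/
def perp (P : SymSpace σ n) (N : ∀ i, Submodule A (P.K.X i)) (i : ℤ) :
    Submodule A (P.K.X i) where
  carrier := {x | ∀ y ∈ N (-n - i), P.pair i x y = 0}
  add_mem' {x x'} hx hx' y hy := by
    rw [map_add, HermDual.add_apply, hx y hy, hx' y hy, add_zero]
  zero_mem' y _ := by rw [map_zero, HermDual.zero_apply]
  smul_mem' a x hx y hy := by rw [map_smul, HermDual.smul_apply, hx y hy, zero_mul]

lemma le_perp_symm {P : SymSpace σ n} (h0 : ZeroDiff P.K) {M N : ∀ i, Submodule A (P.K.X i)}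
    (h : M ≤ P.perp N) : N ≤ P.perp M := by
  intro j y hy x hx
  rw [P.pair_eq_zero_iff h0]
  exact h _ hx _ ((XIsoOfEq_hom_mem_iff N _ y).2 hy)

lemma le_perp_iff {P : SymSpace σ n} (h0 : ZeroDiff P.K) {M N : ∀ i, Submodule A (P.K.X i)} :
    M ≤ P.perp N ↔ N ≤ P.perp M := ⟨le_perp_symm h0, le_perp_symm h0⟩

lemma perp_perp [IsSemisimpleRing A] {P : SymSpace σ n} (h0 : ZeroDiff P.K)
    (N : ∀ i, Submodule A (P.K.X i)) : P.perp (P.perp N) = N := by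
  refine le_antisymm (fun i x hx => ?_) (le_perp_symm h0 le_rfl)
  by_contra hxN
  rw [← XIsoOfEq_hom_mem_iff N (show i = -n - (-n - i) by omega)] at hxN
  obtain ⟨f, hf, hfx⟩ := Submodule.exists_functional_ne_zero _ hxN
  obtain ⟨y, hy⟩ := (P.pair_bijective h0 (-n - i)).2 f
  refine hfx ?_
  have hy' : y ∈ P.perp N (-n - i) := fun z hz => by rw [hy]; exact hf z hz
  have := (P.pair_eq_zero_iff h0 i x y).1 (hx y hy')
  rw [hy] at this
  exact this

lemma perp_sup {P : SymSpace σ n} (h0 : ZeroDiff P.K) (M N : ∀ i, Submodule A (P.K.X i)) :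
    P.perp (M ⊔ N) = P.perp M ⊓ P.perp N := by
  refine eq_of_forall_le_iff fun L => ?_
  rw [le_perp_iff h0, sup_le_iff, le_inf_iff, le_perp_iff h0 (N := M), le_perp_iff h0 (N := N)]

lemma perp_bot (P : SymSpace σ n) : P.perp ⊥ = ⊤ := by
  refine top_le_iff.1 fun i x _ y hy => ?_
  rw [(Submodule.mem_bot A).1 hy]
  simpa using (P.pair i x).apply_smul 0 (0 : P.K.X (-n - i))

lemma perp_top [IsSemisimpleRing A] {P : SymSpace σ n} (h0 : ZeroDiff P.K) : P.perp ⊤ = ⊥ := by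
  rw [← P.perp_bot, perp_perp h0]

lemma isCompl_perp [IsSemisimpleRing A] {P : SymSpace σ n} (h0 : ZeroDiff P.K)
    {N : ∀ i, Submodule A (P.K.X i)} (h : N ⊓ P.perp N = ⊥) : IsCompl N (P.perp N) := by
  refine ⟨disjoint_iff.2 h, codisjoint_iff.2 ?_⟩
  rw [← perp_perp h0 (N ⊔ P.perp N), perp_sup h0, perp_perp h0, inf_comm, h, perp_bot]

/-- The restriction of a space to a graded submodule which is nondegenerate, that is, which is a
complement of its orthogonal. -/
def restrict [IsSemisimpleRing A] (P : SymSpace σ n) (h0 : ZeroDiff P.K)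
    (N : ∀ i, Submodule A (P.K.X i)) (hN : IsCompl N (P.perp N)) : SymSpace σ n :=
  P.pullback (subComplex P.K N) (P.perf.subComplex N)
    (subIncl P.K N fun i j x _ => by rw [h0]; rfl) (by
      have : ∀ i, IsIso ((subIncl P.K N (fun i j x _ => by rw [h0]; rfl) ≫ P.φ ≫
          dualMap σ n (subIncl P.K N (fun i j x _ => by rw [h0]; rfl))).f i) := fun i => by
        refine ModuleCat.isIso_of_bijective _ ⟨?_, ?_⟩
        · refine (injective_iff_map_eq_zero _).2 fun (x : N i) hx => ?_
          have hx' : (x : P.K.X i) ∈ P.perp N i := fun y hy =>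
            congrArg (fun f : HermDual σ (N (-n - i)) => f ⟨y, hy⟩) hx
          have := (disjoint_iff.1 hN.1).le i ⟨x.2, hx'⟩
          exact Subtype.ext ((Submodule.mem_bot A).1 this)
        · intro (f : N (-n - i) →ₗ[A] A)
          obtain ⟨g, hg, hg'⟩ := LinearMap.exists_extend_of_isCompl
            (Pi.isCompl_apply hN (-n - i)) f
          obtain ⟨x, hx⟩ := (P.pair_bijective h0 i).2 g
          have hxN : x ∈ N i := by
            rw [← perp_perp h0 N]
            intro y hy
            rw [hx]
            exact hg' y hy
          refine ⟨(⟨x, hxN⟩ : N i), HermDual.ext (σ := σ) fun (y : N (-n - i)) => ?_⟩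
          change P.pair i x y = f y
          rw [hx]
          exact hg y
      have := HomologicalComplex.Hom.isIso_of_components (subIncl P.K N
        (fun i j x _ => by rw [h0]; rfl) ≫ P.φ ≫
          dualMap σ n (subIncl P.K N (fun i j x _ => by rw [h0]; rfl)))
      infer_instance)

lemma zeroDiff_restrict [IsSemisimpleRing A] (P : SymSpace σ n) (h0 : ZeroDiff P.K)
    (N : ∀ i, Submodule A (P.K.X i)) (hN : IsCompl N (P.perp N)) :
    ZeroDiff (P.restrict h0 N hN).K := fun _ _ => rfl

lemma isometric_restrict_orthSum [IsSemisimpleRing A] (P : SymSpace σ n) (h0 : ZeroDiff P.K)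
    (N : ∀ i, Submodule A (P.K.X i)) (hN : IsCompl N (P.perp N))
    (hN' : IsCompl (P.perp N) (P.perp (P.perp N))) :
    ((P.restrict h0 N hN).orthSum (P.restrict h0 (P.perp N) hN')).Isometric P := by
  let ι₁ := subIncl P.K N (fun i j x _ => by rw [h0]; rfl)
  let ι₂ := subIncl P.K (P.perp N) (fun i j x _ => by rw [h0]; rfl)
  have h12 : ι₁ ≫ P.φ ≫ dualMap σ n ι₂ = 0 := by
    ext i : 1
    refine ModuleCat.hom_ext <| LinearMap.ext fun (x : N i) =>
      HermDual.ext (σ := σ) fun (y : P.perp N (-n - i)) => ?_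
    exact le_perp_symm h0 (le_refl (P.perp N)) i x.2 y y.2
  have h21 : ι₂ ≫ P.φ ≫ dualMap σ n ι₁ = 0 := by
    ext i : 1
    refine ModuleCat.hom_ext <| LinearMap.ext fun (x : P.perp N i) =>
      HermDual.ext (σ := σ) fun (y : N (-n - i)) => ?_
    exact x.2 y y.2
  have hN'' : IsCompl (P.perp N) N := hN.symm
  let e : subComplex P.K N ⊞ subComplex P.K (P.perp N) ≅ P.K :=
    { hom := biprod.fst ≫ ι₁ + biprod.snd ≫ ι₂
      inv := biprod.lift (subProj h0 hN) (subProj h0 hN'')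
      hom_inv_id := by
        have h1 : ι₁ ≫ subProj h0 hN = 𝟙 _ := subIncl_subProj h0 hN
        have h2 : ι₂ ≫ subProj h0 hN'' = 𝟙 _ := subIncl_subProj h0 hN''
        have h3 : ι₂ ≫ subProj h0 hN = 0 := subIncl_subProj_of_isCompl h0 hN
        have h4 : ι₁ ≫ subProj h0 hN'' = 0 := subIncl_subProj_of_isCompl h0 hN''
        apply biprod.hom_ext <;> apply biprod.hom_ext' <;> simp [h1, h2, h3, h4]
      inv_hom_id := by
        rw [Preadditive.comp_add, biprod.lift_fst_assoc, biprod.lift_snd_assoc]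
        exact subProj_add_subProj h0 hN hN'' }
  refine ⟨e.hom, ((toK A).mapIso e).isIso_hom, ?_⟩
  congr 1
  exact orthForm_eq_of_orthogonal P.φ ι₁ ι₂ h12 h21

/-- A space with zero differentials that has a graded submodule equal to its own orthogonal is
neutral. -/
lemma neutral_of_perp_eq_self [IsSemisimpleRing A] (P : SymSpace σ n) (h0 : ZeroDiff P.K)
    (N : ∀ i, Submodule A (P.K.X i)) (hN : P.perp N = N) : P.Neutral := by
  obtain ⟨C, hC⟩ : ∃ C, IsCompl N C := by
    choose C hC using fun i => exists_isCompl (N i)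
    exact ⟨C, Pi.isCompl_iff.2 hC⟩
  let α := subIncl P.K N (fun i j x _ => by rw [h0]; rfl)
  let ρ := subProj h0 hC
  let β : P.K ⟶ dualComplex σ n (subComplex P.K N) := P.φ ≫ dualMap σ n α
  have hαρ : α ≫ ρ = 𝟙 _ := subIncl_subProj h0 hC
  have hαβ : α ≫ β = 0 := by
    ext i : 1
    refine ModuleCat.hom_ext <| LinearMap.ext fun (x : N i) =>
      HermDual.ext (σ := σ) fun (y : N (-n - i)) => ?_
    exact hN.ge i x.2 y y.2
  -- the projection to `N` and the pairing with `N` identify the space with `N ⊕ N^#`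
  let ρ' : ∀ i, P.K.X i →ₗ[A] N i := fun i => (ρ.f i).hom
  let β' : ∀ i, P.K.X i →ₗ[A] HermDual σ (N (-n - i)) := fun i => (β.f i).hom
  let e : ∀ i, P.K.X i →ₗ[A] N i × HermDual σ (N (-n - i)) := fun i => (ρ' i).prod (β' i)
  have hβ : ∀ i (x : P.K.X i) (y : N (-n - i)), β' i x y = P.pair i x y := fun _ _ _ => rfl
  have h1 : ∀ i (a : N i), ρ' i a = a := fun i a =>
    Submodule.projectionOnto_apply_left (Pi.isCompl_apply hC i) a
  have h2 : ∀ i (a : N i), β' i a = 0 := fun i a => HermDual.ext fun y => by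
    rw [hβ]
    exact hN.ge i a.2 y y.2
  have he : ∀ i, Function.Bijective (e i) := fun i => by
    constructor
    · refine (injective_iff_map_eq_zero _).2 fun x hx => ?_
      have hx1 : ρ' i x = 0 := congrArg Prod.fst hx
      have hx2 : β' i x = 0 := congrArg Prod.snd hx
      have hxN : x ∈ N i := hN.le i fun y hy => by
        rw [← hβ i x ⟨y, hy⟩, hx2, HermDual.zero_apply]
      exact congrArg Subtype.val ((h1 i ⟨x, hxN⟩).symm.trans hx1)
    · rintro ⟨a, f⟩
      obtain ⟨g, hg, -⟩ := LinearMap.exists_extend_of_isCompl (Pi.isCompl_apply hC (-n - i))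
        (show N (-n - i) →ₗ[A] A from f)
      obtain ⟨x, hx⟩ := (P.pair_bijective h0 i).2 g
      have hβx : β' i x = f := HermDual.ext (σ := σ) fun y => by
        rw [hβ, hx]; exact hg y
      refine ⟨x + ((a - ρ' i x : N i) : P.K.X i), Prod.ext ?_ ?_⟩
      · change ρ' i _ = a
        rw [map_add, h1, add_sub_cancel]
      · change β' i _ = f
        rw [map_add, h2, add_zero, hβx]
  let θ' : ∀ i, HermDual σ (N (-n - i)) →ₗ[A] P.K.X i := fun i =>
    (LinearEquiv.ofBijective (e i) (he i)).symm.toLinearMap ∘ₗ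
      LinearMap.inr A (N i) (HermDual σ (N (-n - i)))
  have heθ : ∀ i (f : HermDual σ (N (-n - i))), e i (θ' i f) = (0, f) := fun i f =>
    LinearEquiv.apply_symm_apply (LinearEquiv.ofBijective (e i) (he i)) _
  let θ : dualComplex σ n (subComplex P.K N) ⟶ P.K :=
    ((zeroDiff_subComplex P.K N).dual n).mkHom h0 θ'
  refine P.neutral_of_split _ (P.perf.subComplex N) α ρ θ hαρ hαβ ?_ ?_
  · rw [← CategoryTheory.Functor.map_id]
    congr 1
    ext i : 1
    exact ModuleCat.hom_ext <| LinearMap.ext fun f => congrArg Prod.snd (heθ i f)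
  · rw [← CategoryTheory.Functor.map_id]
    congr 1
    ext i : 1
    refine ModuleCat.hom_ext <| LinearMap.ext fun x => (he i).1 ?_
    change e i ((ρ' i x : N i) + θ' i (β' i x)) = e i x
    rw [map_add, heθ]
    exact Prod.ext (((add_zero _).trans (h1 i _))) ((congrArg (· + _) (h2 i _)).trans (zero_add _))

end SymSpace
end Orthogonality

/-! ### Generation of the Witt groups by simple spaces -/

section Generation

open CategoryTheory CategoryTheory.Limits CategoryTheory.Pretriangulated

variable {A : Type u} [Ring A] {σ : RingInvo A} {n : ℤ}

/-- A complex with zero differentials consisting of a simple module in degree `m`. -/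
structure IsStalk (K : CochainComplex (ModuleCat.{u} A) ℤ) (m : ℤ) : Prop where
  zeroDiff : ZeroDiff K
  simple : IsSimpleModule A (K.X m)
  isZero : ∀ i, i ≠ m → IsZero (K.X i)

namespace SymSpace

/-- The total length of the terms in a range of degrees. -/
noncomputable def size (P : SymSpace σ n) (a b : ℤ) : ℕ∞ :=
  ∑ i ∈ Finset.Icc a b, Module.length A (P.K.X i)

lemma size_restrict [IsSemisimpleRing A] (P : SymSpace σ n) (h0 : ZeroDiff P.K)
    (N : ∀ i, Submodule A (P.K.X i)) (hN : IsCompl N (P.perp N))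
    (hN' : IsCompl (P.perp N) (P.perp (P.perp N))) (a b : ℤ) :
    P.size a b = (P.restrict h0 N hN).size a b + (P.restrict h0 (P.perp N) hN').size a b := by
  rw [size, size, size, ← Finset.sum_add_distrib]
  refine Finset.sum_congr rfl fun i _ => ?_
  exact (((N i).prodEquivOfIsCompl (P.perp N i) (Pi.isCompl_apply hN i)).length_eq).symm.trans
    (Module.length_prod A (N i) (P.perp N i))

/-- If a graded submodule is an isotropic direct factor of a nondegenerate one with a complement
that pairs perfectly with it, the restricted space is neutral. -/
lemma neutral_restrict [IsSemisimpleRing A] (P : SymSpace σ n) (h0 : ZeroDiff P.K)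
    (N W : ∀ i, Submodule A (P.K.X i)) (hW : IsCompl W (P.perp W)) (hNW : N ≤ W)
    (h : W ⊓ P.perp N = N) : (P.restrict h0 W hW).Neutral := by
  refine neutral_of_perp_eq_self _ (P.zeroDiff_restrict h0 W hW)
    (fun i => (N i).comap (W i).subtype) (funext fun i => Submodule.ext fun (x : W i) => ?_)
  have : x.1 ∈ N i ↔ x.1 ∈ P.perp N i :=
    ⟨fun hx => (h.ge i hx).2, fun hx => h.le i ⟨x.2, hx⟩⟩
  refine Iff.trans ?_ this.symm
  exact ⟨fun hx y hy => hx (⟨y, hNW _ hy⟩ : W (-n - i)) hy, fun hx y hy => hx y.1 hy⟩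

lemma wittClass_eq_zero_of_forall_isZero [IsSemisimpleRing A] (P : SymSpace σ n)
    (h0 : ZeroDiff P.K) (h : ∀ i, IsZero (P.K.X i)) : P.wittClass = 0 :=
  Neutral.wittClass_eq <| P.neutral_of_perp_eq_self h0 ⊤ <| funext fun i => by
    have := ModuleCat.subsingleton_of_isZero (h i)
    exact Subsingleton.elim _ _

/-- Induction on the total length: a simple submodule in one degree is either nondegenerate, and
then splits off, or isotropic, and then lies in a neutral summand. -/
theorem wittClass_mem_closure_isStalk [IsSemisimpleRing A] (a b : ℤ) (k : ℕ) (P : SymSpace σ n)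
    (h0 : ZeroDiff P.K) (hab : ∀ i, i < a ∨ b < i → IsZero (P.K.X i)) (hk : P.size a b ≤ k) :
    P.wittClass ∈ AddSubgroup.closure
      {x | ∃ (Q : SymSpace σ n) (m : ℤ), IsStalk Q.K m ∧ x = Q.wittClass} := by
  induction k generalizing P with
  | zero =>
    rw [P.wittClass_eq_zero_of_forall_isZero h0 fun i => ?_]
    · exact zero_mem _
    · by_cases hi : i ∈ Finset.Icc a b
      · have : Module.length A (P.K.X i) = 0 :=
          (Finset.sum_eq_zero_iff.1 (nonpos_iff_eq_zero.1 hk)) i hi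
        rw [Module.length_eq_zero_iff] at this
        exact ModuleCat.isZero_of_iff_subsingleton.2 this
      · exact hab i (by rw [Finset.mem_Icc] at hi; omega)
  | succ k ih =>
    by_cases hz : ∀ i, IsZero (P.K.X i)
    · rw [P.wittClass_eq_zero_of_forall_isZero h0 hz]
      exact zero_mem _
    push Not at hz
    obtain ⟨i, hi⟩ := hz
    have : Nontrivial (P.K.X i) := by
      rw [← not_subsingleton_iff_nontrivial]
      exact fun h => hi (ModuleCat.isZero_of_iff_subsingleton.2 h)
    obtain ⟨S, hS⟩ := IsSemisimpleModule.exists_simple_submodule A (P.K.X i)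
    rw [isSimpleModule_iff_isAtom] at hS
    set N : ∀ j, Submodule A (P.K.X j) := Function.update ⊥ i S with hNdef
    have hN : IsAtom N := Pi.isAtom_single hS
    have hNi : N i = S := by rw [hNdef]; exact Function.update_self ..
    have hNj : ∀ j, j ≠ i → N j = ⊥ := fun j hj => by
      rw [hNdef]; exact Function.update_of_ne hj ..
    have key : ∀ (W : ∀ j, Submodule A (P.K.X j)) (hW : IsCompl W (P.perp W)), N ≤ W →
        (P.restrict h0 W hW).wittClass ∈ AddSubgroup.closure
          {x | ∃ (Q : SymSpace σ n) (m : ℤ), IsStalk Q.K m ∧ x = Q.wittClass} →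
        P.wittClass ∈ AddSubgroup.closure
          {x | ∃ (Q : SymSpace σ n) (m : ℤ), IsStalk Q.K m ∧ x = Q.wittClass} := by
      intro W hW hNW hmem
      have hW' : IsCompl (P.perp W) (P.perp (P.perp W)) := by
        rw [perp_perp h0]; exact hW.symm
      rw [← (P.isometric_restrict_orthSum h0 W hW hW').wittClass_eq, wittClass_orthSum]
      refine add_mem hmem (ih _ (P.zeroDiff_restrict h0 _ hW') (fun j hj => ?_) ?_)
      · have := ModuleCat.subsingleton_of_isZero (hab j hj)
        exact ModuleCat.isZero_of_iff_subsingleton.2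
          (inferInstanceAs (Subsingleton (P.perp W j)))
      · have h1 := P.size_restrict h0 W hW hW' a b
        have hiab : i ∈ Finset.Icc a b := by
          rw [Finset.mem_Icc]
          by_contra hi'
          exact hi (hab i (by omega))
        have h2 : 1 ≤ (P.restrict h0 W hW).size a b := by
          refine le_trans ?_ (Finset.single_le_sum (fun _ _ => bot_le) hiab)
          rw [Order.one_le_iff_ne_zero, Ne, Module.length_eq_zero_iff]
          intro (hsub : Subsingleton (W i))
          refine hS.1 (le_bot_iff.1 fun x hx => ?_)
          have := Subsingleton.elim (⟨x, hNW i (hNi.ge hx)⟩ : W i) 0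
          exact (Submodule.mem_bot A).2 (congrArg Subtype.val this)
        rw [h1] at hk
        have h3 : 1 + (P.restrict h0 (P.perp W) hW').size a b ≤ 1 + k := by
          refine (add_le_add_left h2 _).trans (hk.trans ?_)
          rw [add_comm]; push_cast; exact le_rfl
        exact (ENat.add_le_add_iff_left ENat.one_ne_top).1 h3
    by_cases hNN : N ≤ P.perp N
    · -- an isotropic simple submodule and a complement of its orthogonal span a neutral space
      obtain ⟨T, hT⟩ : ∃ T, IsCompl (P.perp N) T := by
        choose T hT using fun j => exists_isCompl (P.perp N j)
        exact ⟨T, Pi.isCompl_iff.2 hT⟩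
      have h1 : (N ⊔ T) ⊓ P.perp N = N := by
        refine funext fun j => ?_
        change (N j ⊔ T j) ⊓ P.perp N j = N j
        rw [sup_inf_assoc_of_le (T j) (hNN j), inf_comm, (Pi.isCompl_apply hT j).inf_eq_bot,
          sup_bot_eq]
      have h2 : (N ⊔ T) ⊓ P.perp (N ⊔ T) = ⊥ := by
        rw [perp_sup h0, ← inf_assoc, h1]
        have := perp_sup h0 (P.perp N) T
        rw [hT.sup_eq_top, perp_top h0, perp_perp h0] at this
        exact this.symm
      refine key _ (isCompl_perp h0 h2) le_sup_left ?_
      rw [(P.neutral_restrict h0 N _ (isCompl_perp h0 h2) le_sup_left h1).wittClass_eq]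
      exact zero_mem _
    · have h2 : N ⊓ P.perp N = ⊥ :=
        (hN.le_iff.1 inf_le_left).resolve_right fun h => hNN (inf_eq_left.1 h)
      refine key _ (isCompl_perp h0 h2) le_rfl (AddSubgroup.subset_closure ⟨_, i, ?_, rfl⟩)
      refine ⟨P.zeroDiff_restrict h0 _ _, ?_, fun j hj => ?_⟩
      · change IsSimpleModule A (N i)
        rw [hNi]
        exact isSimpleModule_iff_isAtom.2 hS
      · refine ModuleCat.isZero_of_iff_subsingleton.2 ?_
        change Subsingleton (N j)
        rw [hNj j hj]
        infer_instance

variable (σ n) in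
/-- Over a semisimple ring, the Witt group is generated by the forms on simple modules placed in
one degree. -/
theorem closure_isStalk [IsSemisimpleRing A] : AddSubgroup.closure
    {x | ∃ (Q : SymSpace σ n) (m : ℤ), IsStalk Q.K m ∧ x = Q.wittClass} = ⊤ := by
  rw [eq_top_iff, ← closure_range_wittClass, AddSubgroup.closure_le]
  rintro _ ⟨P, rfl⟩
  obtain ⟨Q, h0, hQ⟩ := P.exists_isometric_zeroDiff
  obtain ⟨a, b, hab⟩ := Q.perf.bounded
  have hfin : Q.size a b ≠ ⊤ := by
    refine WithTop.sum_ne_top.2 fun i _ => ?_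
    have := Q.perf.finite i
    exact Module.length_ne_top
  obtain ⟨k, hk⟩ := ENat.ne_top_iff_exists.1 hfin
  rw [← hQ.wittClass_eq]
  exact wittClass_mem_closure_isStalk a b k Q h0 hab hk.ge

lemma degree_eq_of_isStalk {P : SymSpace σ n} {m : ℤ} (h : IsStalk P.K m) : -n - m = m := by
  by_contra hne
  have hz := ModuleCat.subsingleton_of_isZero (h.isZero _ hne)
  have := h.simple.nontrivial
  obtain ⟨x, hx⟩ := exists_ne (0 : P.K.X m)
  refine hx ((P.pair_bijective h.zeroDiff m).1 ?_)
  rw [map_zero]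
  refine HermDual.ext fun y => ?_
  rw [Subsingleton.elim y 0, HermDual.zero_apply]
  simpa using (P.pair m x).apply_smul 0 0

/-- The odd Witt groups of a semisimple ring vanish. -/
theorem subsingleton_wittGroup_of_odd [IsSemisimpleRing A] (hn : Odd n) :
    Subsingleton (WittGroup σ n) := by
  have h : {x | ∃ (Q : SymSpace σ n) (m : ℤ), IsStalk Q.K m ∧ x = Q.wittClass} = ∅ :=
    Set.eq_empty_of_forall_notMem fun x ⟨Q, m, hQ, _⟩ => by
      have := degree_eq_of_isStalk hQ
      obtain ⟨c, rfl⟩ := hn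
      omega
  have := closure_isStalk σ n
  rw [h, AddSubgroup.closure_empty] at this
  exact AddSubgroup.subsingleton_iff.1 (subsingleton_of_bot_eq_top this)

end SymSpace
end Generation

/-! ### Simple modules as complexes in one degree -/

section Stalk

open CategoryTheory CategoryTheory.Limits CategoryTheory.Pretriangulated

variable {A : Type u} [Ring A] {σ : RingInvo A} {n m : ℤ}

namespace IsStalk

variable {X Y L : CochainComplex (ModuleCat.{u} A) ℤ}

lemma of_iso (hX : IsStalk X m) (hY : ZeroDiff Y) (e : X ≅ Y) : IsStalk Y m where
  zeroDiff := hY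
  simple := by
    have := hX.simple
    exact IsSimpleModule.congr (HomologicalComplex.Hom.isoApp e m).symm.toLinearEquiv
  isZero i hi := (hX.isZero i hi).of_iso (HomologicalComplex.Hom.isoApp e i).symm

/-- A cycle-valued map out of the degree `m` term, as a map of complexes. -/
def mkHomFrom (hX : IsStalk X m) (f : X.X m ⟶ L.X m) (hf : f ≫ L.d m (m + 1) = 0) : X ⟶ L where
  f := Function.update (fun _ => 0) m f
  comm' i j hij := by
    by_cases hi : i = m
    · subst hi
      obtain rfl : i + 1 = j := hij
      rw [Function.update_self, hf, hX.zeroDiff, zero_comp]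
    · exact (hX.isZero i hi).eq_of_src _ _

lemma mkHomFrom_f (hX : IsStalk X m) (f : X.X m ⟶ L.X m) (hf : f ≫ L.d m (m + 1) = 0) :
    (hX.mkHomFrom f hf).f m = f :=
  Function.update_self (β := fun i => X.X i ⟶ L.X i) m f (fun _ => 0)

lemma hom_ext_from (hX : IsStalk X m) {f g : X ⟶ L} (h : f.f m = g.f m) : f = g := by
  ext i : 1
  by_cases hi : i = m
  · subst hi; exact h
  · exact (hX.isZero i hi).eq_of_src _ _

lemma hom_ext_to (hX : IsStalk X m) {f g : L ⟶ X} (h : f.f m = g.f m) : f = g := by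
  ext i : 1
  by_cases hi : i = m
  · subst hi; exact h
  · exact (hX.isZero i hi).eq_of_tgt _ _

lemma isPerf [IsSemisimpleRing A] (hX : IsStalk X m) : IsPerf X where
  finite i := by
    by_cases hi : i = m
    · subst hi
      have := hX.simple
      infer_instance
    · have := ModuleCat.subsingleton_of_isZero (hX.isZero i hi)
      infer_instance
  projective i := Module.projective_of_isSemisimpleRing A _
  bounded := ⟨m, m, fun i hi => hX.isZero i (by omega)⟩

/-- A map to a simple module in one degree which is nonzero in the homotopy category has a
section. -/
lemma exists_section [IsSemisimpleRing A] (hY : IsStalk Y m) {u : (toK A).obj L ⟶ (toK A).obj Y}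
    (hu : u ≠ 0) : ∃ g : (toK A).obj Y ⟶ (toK A).obj L, g ≫ u = 𝟙 _ := by
  obtain ⟨u, rfl⟩ := (toK A).map_surjective u
  have := hY.simple
  by_cases h : ∀ x ∈ LinearMap.ker (L.d m (m + 1)).hom, (u.f m).hom x = 0
  · -- if the map vanishes on cycles, it extends over the next term, so it is null-homotopic
    obtain ⟨g, hg⟩ := LinearMap.exists_comp_comp_eq_self (L.d m (m + 1)).hom
    let s : L.X (m + 1) ⟶ Y.X m := ModuleCat.ofHom ((u.f m).hom ∘ₗ g)
    have hs : L.d m (m + 1) ≫ s = u.f m := by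
      refine ModuleCat.hom_ext <| LinearMap.ext fun x => ?_
      change (u.f m).hom (g ((L.d m (m + 1)).hom x)) = (u.f m).hom x
      rw [← sub_eq_zero, ← map_sub]
      refine h _ ?_
      rw [LinearMap.mem_ker, map_sub, sub_eq_zero]
      exact LinearMap.congr_fun hg x
    let H : Homotopy u 0 :=
      { hom := Function.update (fun _ _ => 0) (m + 1) (Function.update (fun _ => 0) m s)
        zero := fun i j hij => by
          by_cases hi : i = m + 1
          · subst hi
            rw [Function.update_self]
            by_cases hj : j = m
            · subst hj
              exact absurd rfl hij
            · rw [Function.update_of_ne hj]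
          · rw [Function.update_of_ne hi]
        comm := fun i => by
          by_cases hi : i = m
          · subst hi
            rw [dNext_eq _ (show (ComplexShape.up ℤ).Rel i (i + 1) by simp),
              prevD_eq _ (show (ComplexShape.up ℤ).Rel (i - 1) i by simp), hY.zeroDiff, comp_zero,
              Function.update_self, Function.update_self, hs]
            simp
          · exact (hY.isZero i hi).eq_of_tgt _ _ }
    refine absurd ?_ hu
    rw [HomotopyCategory.eq_of_homotopy _ _ H, Functor.map_zero]
  · -- otherwise it is onto on cycles, and the simple module is projective
    push Not at h
    obtain ⟨x, hx, hux⟩ := h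
    let v : LinearMap.ker (L.d m (m + 1)).hom →ₗ[A] Y.X m := (u.f m).hom ∘ₗ Submodule.subtype _
    have hv : Function.Surjective v := LinearMap.surjective_of_ne_zero fun h0 =>
      hux (LinearMap.congr_fun h0 ⟨x, hx⟩)
    have := Module.projective_of_isSemisimpleRing A (Y.X m)
    obtain ⟨s, hs⟩ := Module.projective_lifting_property v LinearMap.id hv
    let g := hY.mkHomFrom (L := L) (ModuleCat.ofHom (Submodule.subtype _ ∘ₗ s))
      (ModuleCat.hom_ext <| LinearMap.ext fun y => (s y).2)
    refine ⟨(toK A).map g, ?_⟩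
    rw [← Functor.map_comp, ← CategoryTheory.Functor.map_id]
    congr 1
    refine hY.hom_ext_to ?_
    rw [HomologicalComplex.comp_f, hY.mkHomFrom_f]
    exact ModuleCat.hom_ext hs

lemma id_ne_zero (hX : IsStalk X m) : 𝟙 ((toK A).obj X) ≠ 0 := by
  intro h
  rw [← CategoryTheory.Functor.map_id, ← Functor.map_zero (toK A)] at h
  have := hX.simple.nontrivial
  obtain ⟨x, hx⟩ := exists_ne (0 : X.X m)
  exact hx (congrArg (fun f : X ⟶ X => (f.f m).hom x) (hX.zeroDiff.map_injective hX.zeroDiff h))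

lemma isIso_of_ne_zero [IsSemisimpleRing A] (hX : IsStalk X m) (hY : IsStalk Y m)
    {f : (toK A).obj X ⟶ (toK A).obj Y} (hf : f ≠ 0) : IsIso f := by
  obtain ⟨g, hg⟩ := hY.exists_section hf
  have hg0 : g ≠ 0 := fun h => hY.id_ne_zero (by rw [← hg, h, zero_comp])
  obtain ⟨g', hg'⟩ := hX.exists_section hg0
  have : g' = f := by rw [← Category.comp_id g', ← hg, ← Category.assoc, hg', Category.id_comp]
  exact ⟨g, this ▸ hg', hg⟩

lemma ne_zero_of_isIso (hX : IsStalk X m) (f : (toK A).obj X ⟶ (toK A).obj Y) [IsIso f] :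
    f ≠ 0 := fun h => hX.id_ne_zero <|
  (IsIso.hom_inv_id f).symm.trans ((congrArg (· ≫ inv f) h).trans zero_comp)

/-- Complexes in degree `m` with isomorphic simple modules are isomorphic. -/
lemma exists_iso (hX : IsStalk X m) (hY : IsStalk Y m) (e : X.X m ≃ₗ[A] Y.X m) :
    ∃ f : (toK A).obj X ⟶ (toK A).obj Y, IsIso f := by
  let f := hX.mkHomFrom (L := Y) (ModuleCat.ofHom e.toLinearMap)
    (by rw [hY.zeroDiff, comp_zero])
  let g := hY.mkHomFrom (L := X) (ModuleCat.ofHom e.symm.toLinearMap)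
    (by rw [hX.zeroDiff, comp_zero])
  refine ⟨(toK A).map f, (toK A).map g, ?_, ?_⟩
  · rw [← Functor.map_comp, ← CategoryTheory.Functor.map_id]
    congr 1
    refine hX.hom_ext_to ?_
    rw [HomologicalComplex.comp_f, hX.mkHomFrom_f, hY.mkHomFrom_f]
    exact ModuleCat.hom_ext (LinearMap.ext fun x => e.symm_apply_apply x)
  · rw [← Functor.map_comp, ← CategoryTheory.Functor.map_id]
    congr 1
    refine hY.hom_ext_to ?_
    rw [HomologicalComplex.comp_f, hX.mkHomFrom_f, hY.mkHomFrom_f]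
    exact ModuleCat.hom_ext (LinearMap.ext fun x => e.apply_symm_apply x)

lemma nonempty_linearEquiv (hX : IsStalk X m) (hY : IsStalk Y m)
    (f : (toK A).obj X ⟶ (toK A).obj Y) (hf : IsIso f) : Nonempty (X.X m ≃ₗ[A] Y.X m) := by
  obtain ⟨f, rfl⟩ := (toK A).map_surjective f
  have := hX.zeroDiff.isIso hY.zeroDiff hf
  exact ⟨(asIso (f.f m)).toLinearEquiv⟩

lemma dual (hX : IsStalk X m) {e : (toK A).obj X ⟶ (toK A).obj (dualComplex σ n X)}
    (he : IsIso e) : IsStalk (dualComplex σ n X) m := by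
  obtain ⟨e, rfl⟩ := (toK A).map_surjective e
  have := hX.zeroDiff.isIso (hX.zeroDiff.dual n) he
  exact hX.of_iso (hX.zeroDiff.dual n) (asIso e)

/-- The pairing `Hom(X, L^#) × Hom(X, L) → Hom(X, X^#)` has no left kernel. -/
lemma exists_comp_dualK_ne_zero [IsSemisimpleRing A] (hX : IsStalk X m)
    {e : (toK A).obj X ⟶ (toK A).obj (dualComplex σ n X)} (he : IsIso e)
    {u : (toK A).obj X ⟶ (toK A).obj (dualComplex σ n L)} (hu : u ≠ 0) :
    ∃ g : (toK A).obj X ⟶ (toK A).obj L, u ≫ dualK σ n g ≠ 0 := by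
  obtain ⟨g, hg⟩ := (hX.dual he).exists_section (mt (transposeK_eq_zero_iff n).1 hu)
  refine ⟨e ≫ g, fun h => hX.ne_zero_of_isIso e ?_⟩
  have := (transposeK_eq_zero_iff n).2 h
  rwa [transposeK_comp_dualK, Category.assoc, hg, Category.comp_id] at this

end IsStalk

lemma isStalk_single (m : ℤ) (S : ModuleCat.{u} A) [IsSimpleModule A S] :
    IsStalk ((HomologicalComplex.single _ (ComplexShape.up ℤ) m).obj S) m where
  zeroDiff _ _ := rfl
  simple := IsSimpleModule.congr
    (HomologicalComplex.singleObjXSelf (ComplexShape.up ℤ) m S).toLinearEquiv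
  isZero i hi := HomologicalComplex.isZero_single_obj_X _ m S i hi

end Stalk

/-! ### Real structures on the homotopy category -/

section RealStructure

open CategoryTheory CategoryTheory.Limits CategoryTheory.Pretriangulated

variable {A : Type u} [Ring A] [Algebra ℝ A] {σ : RingInvo A} {n m : ℤ}

/-- An involution of a real algebra that is `ℝ`-linear. -/
class RingInvo.IsReal (σ : RingInvo A) : Prop where
  apply_algebraMap : ∀ r : ℝ, (σ (algebraMap ℝ A r)).unop = algebraMap ℝ A r

variable [σ.IsReal]

lemma hermDualMap_smul {M N : ModuleCat.{u} A} (r : ℝ) (u : M ⟶ N) :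
    hermDualMap σ (r • u) = r • hermDualMap σ u :=
  ModuleCat.hom_ext <| LinearMap.ext fun (f : HermDual σ N) => HermDual.ext (σ := σ) fun x => by
    change f (algebraMap ℝ A r • u.hom x) = (algebraMap ℝ A r • (hermDualMap σ u).hom f :
      HermDual σ M) x
    rw [HermDual.apply_smul, HermDual.smul_apply, RingInvo.IsReal.apply_algebraMap,
      Algebra.commutes]
    rfl

lemma dualMap_smul {P Q : CochainComplex (ModuleCat.{u} A) ℤ} (r : ℝ) (f : P ⟶ Q) :
    dualMap σ n (r • f) = r • dualMap σ n f := by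
  ext i : 1
  exact hermDualMap_smul r _

lemma dualK_smul {P Q : CochainComplex (ModuleCat.{u} A) ℤ} (r : ℝ)
    (f : (toK A).obj P ⟶ (toK A).obj Q) : dualK σ n (r • f) = r • dualK σ n f := by
  obtain ⟨f, rfl⟩ := (toK A).map_surjective f
  rw [← (toK A).map_smul r f, dualK_map, dualMap_smul, (toK A).map_smul, dualK_map]

lemma transposeK_smul {X L : CochainComplex (ModuleCat.{u} A) ℤ} (r : ℝ)
    (u : (toK A).obj X ⟶ (toK A).obj (dualComplex σ n L)) :
    transposeK σ n (r • u) = r • transposeK σ n u := by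
  rw [transposeK, dualK_smul, Linear.comp_smul, transposeK]

variable (σ n) in
/-- The transpose of forms `X → X^#`, as a real linear map. -/
noncomputable def transposeLin (X : CochainComplex (ModuleCat.{u} A) ℤ) :
    ((toK A).obj X ⟶ (toK A).obj (dualComplex σ n X)) →ₗ[ℝ]
      ((toK A).obj X ⟶ (toK A).obj (dualComplex σ n X)) where
  toFun := transposeK σ n
  map_add' := transposeK_add n
  map_smul' := transposeK_smul

lemma IsStalk.finite_hom [Module.Finite ℝ A] [IsSemisimpleRing A]
    {X L : CochainComplex (ModuleCat.{u} A) ℤ} (hX : IsStalk X m) (hL : IsPerf L) :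
    Module.Finite ℝ ((toK A).obj X ⟶ (toK A).obj L) := by
  have := hX.isPerf.finite m
  have := hL.finite m
  let : Module ℝ (X.X m) := Module.compHom _ (algebraMap ℝ A)
  let : Module ℝ (L.X m) := Module.compHom _ (algebraMap ℝ A)
  have : IsScalarTower ℝ A (X.X m) := ⟨fun r a x => by
    rw [Algebra.smul_def, mul_smul]; rfl⟩
  have : IsScalarTower ℝ A (L.X m) := ⟨fun r a x => by
    rw [Algebra.smul_def, mul_smul]; rfl⟩
  have : Module.Finite ℝ (X.X m) := Module.Finite.trans A _
  have : Module.Finite ℝ (L.X m) := Module.Finite.trans A _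
  let F : (X ⟶ L) →ₗ[ℝ] (X.X m →ₗ[ℝ] L.X m) :=
    { toFun := fun f => (f.f m).hom.restrictScalars ℝ
      map_add' := fun _ _ => rfl
      map_smul' := fun _ _ => rfl }
  have : Module.Finite ℝ (X ⟶ L) := Module.Finite.of_injective F fun f g h =>
    hX.hom_ext_from (ModuleCat.hom_ext (LinearMap.ext fun x =>
      (LinearMap.congr_fun h x : (f.f m).hom x = (g.f m).hom x)))
  exact Module.Finite.of_surjective ((toK A).mapLinearMap ℝ) (toK A).map_surjective

end RealStructure

/-! ### The real form attached to a simple form -/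

section RealForm

open CategoryTheory CategoryTheory.Limits CategoryTheory.Pretriangulated

variable {A : Type u} [Ring A] [Algebra ℝ A] {σ : RingInvo A} {n m : ℤ} [σ.IsReal]

variable {X : CochainComplex (ModuleCat.{u} A) ℤ}

/-- A symmetric functional on the space of forms on `X` that takes the value `1` on a given
symmetric form. -/
lemma exists_symmetric_functional
    {e : (toK A).obj X ⟶ (toK A).obj (dualComplex σ n X)} (he0 : e ≠ 0)
    (he : transposeK σ n e = e) :
    ∃ μ : ((toK A).obj X ⟶ (toK A).obj (dualComplex σ n X)) →ₗ[ℝ] ℝ,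
      μ e = 1 ∧ ∀ u, μ (transposeK σ n u) = μ u := by
  obtain ⟨μ, hμ⟩ := Module.Projective.exists_dual_ne_zero ℝ he0
  refine ⟨(2 * μ e)⁻¹ • (μ + μ ∘ₗ transposeLin σ n X), ?_, fun u => ?_⟩
  · change (2 * μ e)⁻¹ * (μ e + μ (transposeK σ n e)) = 1
    rw [he]
    field_simp
    norm_num
  · change (2 * μ e)⁻¹ * (μ (transposeK σ n u) + μ (transposeK σ n (transposeK σ n u))) =
      (2 * μ e)⁻¹ * (μ u + μ (transposeK σ n u))
    rw [transposeK_transposeK, add_comm]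

namespace SymSpace

/-- For a functional `μ` on the forms on `X`, the real bilinear form
`(f, g) ↦ μ (g^# φ f)` on the space of maps from `X` to a symmetric space. -/
noncomputable def realBilin (μ : ((toK A).obj X ⟶ (toK A).obj (dualComplex σ n X)) →ₗ[ℝ] ℝ)
    (P : SymSpace σ n) : LinearMap.BilinForm ℝ ((toK A).obj X ⟶ (toK A).obj P.K) :=
  LinearMap.mk₂ ℝ (fun f g => μ (f ≫ P.formK ≫ dualK σ n g))
    (fun f f' g => by rw [Preadditive.add_comp, map_add])
    (fun r f g => by rw [Linear.smul_comp, map_smul])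
    (fun f g g' => by rw [dualK_add, Preadditive.comp_add, Preadditive.comp_add, map_add])
    (fun r f g => by rw [dualK_smul, Linear.comp_smul, Linear.comp_smul, map_smul])

variable {μ : ((toK A).obj X ⟶ (toK A).obj (dualComplex σ n X)) →ₗ[ℝ] ℝ}

lemma realBilin_apply (P : SymSpace σ n) (f g : (toK A).obj X ⟶ (toK A).obj P.K) :
    realBilin μ P f g = μ (f ≫ P.formK ≫ dualK σ n g) := rfl

lemma realBilin_isSymm (hμ : ∀ u, μ (transposeK σ n u) = μ u) (P : SymSpace σ n) :
    (realBilin μ P).IsSymm := ⟨fun f g => by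
  rw [realBilin_apply, realBilin_apply, ← hμ, ← Category.assoc,
    transposeK_comp_dualK, transposeK_comp, transposeK_formK]⟩

omit [σ.IsReal] in
/-- Every nonzero `X → L^#` is detected by the functional. -/
lemma exists_functional_comp_dualK_ne_zero [IsSemisimpleRing A] (hX : IsStalk X m)
    {e : (toK A).obj X ⟶ (toK A).obj (dualComplex σ n X)} (he : IsIso e)
    (hes : transposeK σ n e = e) (hμe : μ e = 1) {L : CochainComplex (ModuleCat.{u} A) ℤ}
    {u : (toK A).obj X ⟶ (toK A).obj (dualComplex σ n L)} (hu : u ≠ 0) :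
    ∃ g : (toK A).obj X ⟶ (toK A).obj L, μ (u ≫ dualK σ n g) ≠ 0 := by
  obtain ⟨g, hg⟩ := hX.exists_comp_dualK_ne_zero he hu
  have := hX.isIso_of_ne_zero (hX.dual he) (mt (transposeK_eq_zero_iff n).1 hg)
  -- rescale `g` by an endomorphism of `X` so that the value becomes `e`
  refine ⟨(e ≫ inv (transposeK σ n (u ≫ dualK σ n g))) ≫ g, ?_⟩
  have key : u ≫ dualK σ n ((e ≫ inv (transposeK σ n (u ≫ dualK σ n g))) ≫ g) = e := by
    rw [← transposeK_transposeK n (u ≫ _), transposeK_comp_dualK, Category.assoc,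
      ← transposeK_comp_dualK, Category.assoc, IsIso.inv_hom_id, Category.comp_id, hes]
  rw [key, hμe]
  exact one_ne_zero

lemma realBilin_nondegenerate [IsSemisimpleRing A] (hX : IsStalk X m)
    {e : (toK A).obj X ⟶ (toK A).obj (dualComplex σ n X)} (he : IsIso e)
    (hes : transposeK σ n e = e) (hμe : μ e = 1) (hμ : ∀ u, μ (transposeK σ n u) = μ u)
    (P : SymSpace σ n) : (realBilin μ P).Nondegenerate := by
  have hr : (realBilin μ P).IsRefl := (realBilin_isSymm hμ P).isRefl
  refine hr.nondegenerate_iff_separatingLeft.2 ?_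
  intro f hf
  by_contra hf0
  have := P.nondeg
  obtain ⟨g, hg⟩ := exists_functional_comp_dualK_ne_zero (u := f ≫ P.formK) hX he hes hμe
    fun h => hf0 (by rw [← Category.comp_id f, ← IsIso.hom_inv_id P.formK, ← Category.assoc, h,
      zero_comp])
  exact hg (by rw [Category.assoc]; exact hf g)

/-- The maps from `X` to a Lagrangian of a neutral space form a subspace that is its own
orthogonal. -/
lemma Neutral.exists_orthogonal_eq [IsSemisimpleRing A] (hX : IsStalk X m)
    {e : (toK A).obj X ⟶ (toK A).obj (dualComplex σ n X)} (he : IsIso e)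
    (hes : transposeK σ n e = e) (hμe : μ e = 1) (hμ : ∀ u, μ (transposeK σ n u) = μ u)
    {P : SymSpace σ n} (hP : P.Neutral) :
    ∃ (L : CochainComplex (ModuleCat.{u} A) ℤ) (α : (toK A).obj L ⟶ (toK A).obj P.K),
      (realBilin μ P).orthogonal (LinearMap.range (Linear.rightComp ℝ ((toK A).obj X) α)) =
        LinearMap.range (Linear.rightComp ℝ ((toK A).obj X) α) := by
  obtain ⟨L, hL, α, w, -, htri⟩ := hP
  refine ⟨L, (toK A).map α, ?_⟩
  have := isIso_dualShift (σ := σ) n L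
  let c := ((toK A).commShiftIso (1 : ℤ)).hom.app (dualComplex σ (n - 1) L)
  let c' := (toK A).map (dualShift σ n L) ≫ c
  have hc : (toK A).map (P.φ ≫ dualMap σ n α ≫ dualShift σ n L) ≫ c =
      (toK A).map (P.φ ≫ dualMap σ n α) ≫ c' := by
    rw [← Category.assoc P.φ, Functor.map_comp _ _ (dualShift σ n L), Category.assoc]
  have h0 : (toK A).map α ≫ (toK A).map (P.φ ≫ dualMap σ n α) = 0 := by
    have h : (toK A).map α ≫ (toK A).map (P.φ ≫ dualMap σ n α ≫ dualShift σ n L) ≫ c = 0 :=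
      comp_distTriang_mor_zero₂₃ _ htri
    rw [hc, ← Category.assoc] at h
    have := congrArg (· ≫ inv c') h
    simpa only [Category.assoc, IsIso.hom_inv_id, Category.comp_id, zero_comp] using this
  have h1 : ∀ f : (toK A).obj X ⟶ (toK A).obj P.K,
      f ≫ (toK A).map (P.φ ≫ dualMap σ n α) = 0 → ∃ a, f = a ≫ (toK A).map α := by
    intro f hf
    have h : f ≫ (toK A).map (P.φ ≫ dualMap σ n α ≫ dualShift σ n L) ≫ c = 0 := by
      rw [hc, ← Category.assoc, hf, zero_comp]
    exact Triangle.coyoneda_exact₂ _ (rot_of_distTriang _ htri) f h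
  have h2 : P.formK ≫ dualK σ n ((toK A).map α) = (toK A).map (P.φ ≫ dualMap σ n α) := by
    rw [dualK_map, Functor.map_comp]
  ext f
  constructor
  · intro hf
    by_contra hf'
    obtain ⟨g, hg⟩ := exists_functional_comp_dualK_ne_zero
      (u := f ≫ (toK A).map (P.φ ≫ dualMap σ n α)) hX he hes hμe fun h => by
        obtain ⟨a, rfl⟩ := h1 f h
        exact hf' ⟨a, rfl⟩
    refine hg ?_
    have := hf (g ≫ (toK A).map α) ⟨g, rfl⟩
    rw [(realBilin_isSymm hμ P).isRefl.eq_iff, realBilin_apply, dualK_comp] at this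
    rw [← h2, Category.assoc, Category.assoc]
    exact this
  · rintro ⟨a, rfl⟩ _ ⟨b, rfl⟩
    change realBilin μ P (b ≫ (toK A).map α) (a ≫ (toK A).map α) = 0
    rw [realBilin_apply, dualK_comp, Category.assoc, ← Category.assoc P.formK, h2,
      ← Category.assoc ((toK A).map α), h0, zero_comp, comp_zero, map_zero]

end SymSpace

end RealForm

/-! ### Signatures of real bilinear forms -/

section Signature

open QuadraticMap QuadraticForm

variable {V W : Type*} [AddCommGroup V] [Module ℝ V] [AddCommGroup W] [Module ℝ W]

/-- The signature of a real symmetric bilinear form. -/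
noncomputable def LinearMap.BilinForm.sig (B : LinearMap.BilinForm ℝ V) : ℤ :=
  sigPos (LinearMap.BilinMap.toQuadraticMap B) - sigNeg (LinearMap.BilinMap.toQuadraticMap B)

namespace LinearMap.BilinForm

lemma sig_eq_of_equiv {B : LinearMap.BilinForm ℝ V} {B' : LinearMap.BilinForm ℝ W} (e : V ≃ₗ[ℝ] W)
    (h : ∀ x, B' (e x) (e x) = B x x) : B.sig = B'.sig := by
  have : (LinearMap.BilinMap.toQuadraticMap B).Equivalent (LinearMap.BilinMap.toQuadraticMap B') :=
    ⟨⟨e, h⟩⟩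
  rw [sig, sig, this.sigPos_eq, this.sigNeg_eq]

/-- An anisotropic symmetric form that takes a positive value is positive definite. -/
lemma pos_of_anisotropic {B : LinearMap.BilinForm ℝ V} (hB : B.IsSymm) (ha : ∀ x, x ≠ 0 → B x x ≠ 0)
    {v : V} (hv : 0 < B v v) {x : V} (hx : x ≠ 0) : 0 < B x x := by
  by_contra hneg
  have hneg : B x x < 0 := lt_of_le_of_ne (not_lt.1 hneg) (ha x hx)
  -- a root of the quadratic polynomial `t ↦ B (v + t x) (v + t x)`
  have hd : 0 ≤ (B v x) ^ 2 - B x x * B v v := by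
    nlinarith [sq_nonneg (B v x), mul_pos_of_neg_of_neg hneg (neg_neg_of_pos hv)]
  obtain ⟨t, ht⟩ : ∃ t : ℝ, B v v + 2 * t * B v x + t ^ 2 * B x x = 0 := by
    refine ⟨(-(B v x) + Real.sqrt ((B v x) ^ 2 - B x x * B v v)) / B x x, ?_⟩
    have := Real.sq_sqrt hd
    have hq := hneg.ne
    set s := √((B v x) ^ 2 - B x x * B v v)
    field_simp
    linear_combination this
  have h1 : B (v + t • x) (v + t • x) = 0 := by
    have := hB.eq x v
    simp only [map_add, map_smul, LinearMap.add_apply, LinearMap.smul_apply, smul_eq_mul]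
    rw [← ht]
    linear_combination t * this
  have h2 : v = -(t • x) := by
    by_contra h
    exact ha _ (fun h' => h (eq_neg_of_add_eq_zero_left h')) h1
  have h3 : B v v = t ^ 2 * B x x := by
    rw [h2]
    simp only [map_neg, map_smul, LinearMap.neg_apply, LinearMap.smul_apply, smul_eq_mul]
    ring
  nlinarith [sq_nonneg t]

variable [Module.Finite ℝ V]

lemma sigPos_add_sigNeg_eq_finrank {B : LinearMap.BilinForm ℝ V} (hB : B.IsSymm)
    (hn : B.Nondegenerate) :
    sigPos (LinearMap.BilinMap.toQuadraticMap B) + sigNeg (LinearMap.BilinMap.toQuadraticMap B) =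
      Module.finrank ℝ V := by
  have h : (LinearMap.BilinMap.toQuadraticMap B).radical = ⊥ := by
    rw [eq_bot_iff]
    intro x hx
    obtain ⟨h0, h1⟩ := mem_radical_iff'.1 hx
    refine hn.1 x fun y => ?_
    have h2 := h1 y
    have h3 := hB.eq y x
    simp only [LinearMap.BilinMap.toQuadraticMap_apply, map_add, LinearMap.add_apply] at h0 h2
    linarith
  have := sigPos_add_sigNeg_add_radical (Q := LinearMap.BilinMap.toQuadraticMap B)
  rwa [h, finrank_bot, add_zero] at this

lemma add_sigPos_le [Module.Finite ℝ W] {U : Type*} [AddCommGroup U] [Module ℝ U]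
    [Module.Finite ℝ U] {Q : QuadraticForm ℝ U} {Q₁ : QuadraticForm ℝ V} {Q₂ : QuadraticForm ℝ W}
    (e : (V × W) ≃ₗ[ℝ] U) (h : ∀ x, Q (e x) = Q₁ x.1 + Q₂ x.2) :
    sigPos Q₁ + sigPos Q₂ ≤ sigPos Q := by
  obtain ⟨P₁, h₁, hP₁⟩ := exists_finrank_eq_sigPos_and_posDef Q₁
  obtain ⟨P₂, h₂, hP₂⟩ := exists_finrank_eq_sigPos_and_posDef Q₂
  have hr : Module.finrank ℝ ((P₁.prod P₂).map e.toLinearMap) = sigPos Q₁ + sigPos Q₂ := by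
    rw [LinearEquiv.finrank_map_eq, ← h₁, ← h₂, ← Module.finrank_prod]
    have : P₁.prod P₂ = LinearMap.range (P₁.subtype.prodMap P₂.subtype) := by
      rw [LinearMap.range_prodMap, Submodule.range_subtype, Submodule.range_subtype]
    rw [this]
    exact LinearMap.finrank_range_of_inj
      (Subtype.val_injective.prodMap Subtype.val_injective)
  rw [← hr]
  refine le_sigPos_of_posDef Q ?_
  rintro ⟨_, ⟨x, y⟩, ⟨hx, hy⟩, rfl⟩ hne
  change 0 < Q (e (x, y))
  rw [h]
  have a1 : x ≠ 0 → 0 < Q₁ x := fun h0 => hP₁ ⟨x, hx⟩ (by simpa using h0)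
  have a2 : y ≠ 0 → 0 < Q₂ y := fun h0 => hP₂ ⟨y, hy⟩ (by simpa using h0)
  by_cases hx0 : x = 0
  · by_cases hy0 : y = 0
    · subst hx0 hy0
      exact absurd (Subtype.ext (map_zero e)) hne
    · simpa [hx0] using a2 hy0
  · by_cases hy0 : y = 0
    · simpa [hy0] using a1 hx0
    · exact add_pos (a1 hx0) (a2 hy0)

lemma sig_add [Module.Finite ℝ W] {U : Type*} [AddCommGroup U] [Module ℝ U]
    [Module.Finite ℝ U] {B : LinearMap.BilinForm ℝ U} {B₁ : LinearMap.BilinForm ℝ V}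
    {B₂ : LinearMap.BilinForm ℝ W}
    (hB : B.IsSymm) (hn : B.Nondegenerate) (hB₁ : B₁.IsSymm) (hn₁ : B₁.Nondegenerate)
    (hB₂ : B₂.IsSymm) (hn₂ : B₂.Nondegenerate)
    (e : (V × W) ≃ₗ[ℝ] U) (h : ∀ x, B (e x) (e x) = B₁ x.1 x.1 + B₂ x.2 x.2) :
    B.sig = B₁.sig + B₂.sig := by
  have h1 := sigPos_add_sigNeg_eq_finrank hB hn
  have h2 := sigPos_add_sigNeg_eq_finrank hB₁ hn₁
  have h3 := sigPos_add_sigNeg_eq_finrank hB₂ hn₂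
  have h4 := e.finrank_eq
  rw [Module.finrank_prod] at h4
  have h5 := add_sigPos_le (Q := LinearMap.BilinMap.toQuadraticMap B)
    (Q₁ := LinearMap.BilinMap.toQuadraticMap B₁) (Q₂ := LinearMap.BilinMap.toQuadraticMap B₂) e h
  have h6 := add_sigPos_le (Q := -LinearMap.BilinMap.toQuadraticMap B)
    (Q₁ := -LinearMap.BilinMap.toQuadraticMap B₁) (Q₂ := -LinearMap.BilinMap.toQuadraticMap B₂) e
    (fun x => by
      change -(B (e x) (e x)) = -(B₁ x.1 x.1) + -(B₂ x.2 x.2)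
      rw [h, neg_add])
  simp only [sigPos_neg] at h6
  rw [sig, sig, sig]
  omega

lemma two_mul_finrank_of_orthogonal_eq {B : LinearMap.BilinForm ℝ V} (hn : B.Nondegenerate)
    {N : Submodule ℝ V} (hN : B.orthogonal N = N) :
    2 * Module.finrank ℝ N = Module.finrank ℝ V := by
  have h1 := finrank_orthogonal hn N
  rw [hN] at h1
  have := N.finrank_le
  omega

/-- A form with a subspace that is its own orthogonal has signature `0`. -/
lemma sig_eq_zero_of_orthogonal_eq {B : LinearMap.BilinForm ℝ V} (hB : B.IsSymm)
    (hn : B.Nondegenerate)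
    {N : Submodule ℝ V} (hN : B.orthogonal N = N) : B.sig = 0 := by
  have h1 := two_mul_finrank_of_orthogonal_eq hn hN
  have h0 : ∀ x ∈ N, B x x = 0 := fun x hx => (hN.ge hx) x hx
  have h2 := sigPos_add_finrank_le_of_nonpos (Q := LinearMap.BilinMap.toQuadraticMap B) (V := N)
    fun x hx => (h0 x hx).le
  have h3 := sigPos_add_finrank_le_of_nonpos (Q := -LinearMap.BilinMap.toQuadraticMap B) (V := N)
    fun x hx => by
      change -(B x x) ≤ 0
      rw [h0 x hx, neg_zero]
  have h4 := sigPos_add_sigNeg_eq_finrank hB hn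
  rw [sigPos_neg] at h3
  rw [sig]
  omega

lemma sig_eq_finrank {B : LinearMap.BilinForm ℝ V} (hB : B.IsSymm) (hn : B.Nondegenerate)
    (h : ∀ x, x ≠ 0 → 0 < B x x) : B.sig = Module.finrank ℝ V := by
  have h1 := sigPos_add_sigNeg_eq_finrank hB hn
  have h2 := le_sigPos_of_posDef (LinearMap.BilinMap.toQuadraticMap B) (V := ⊤)
    fun x hx => h x.1 (by simpa using hx)
  rw [finrank_top] at h2
  rw [sig]
  omega

end LinearMap.BilinForm

end Signature

/-! ### Groups generated by independent elements -/

section Groups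

/-- An abelian group generated by elements `x j` which are separated by homomorphisms to `ℤ`
is free on these elements. -/
lemma nonempty_addEquiv_of_separated_int {G : Type*} [AddCommGroup G] {r : ℕ} (x : Fin r → G)
    (hx : AddSubgroup.closure (Set.range x) = ⊤) (Φ : Fin r → G →+ ℤ)
    (h0 : ∀ i j, i ≠ j → Φ i (x j) = 0) (h1 : ∀ i, Φ i (x i) ≠ 0) :
    Nonempty (G ≃+ (Fin r → ℤ)) := by
  let F : (Fin r → ℤ) →+ G :=
    { toFun := fun a => ∑ j, a j • x j
      map_zero' := by simp
      map_add' := fun a b => by simp [add_smul, Finset.sum_add_distrib] }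
  have hF : ∀ i a, Φ i (F a) = a i * Φ i (x i) := fun i a => by
    change Φ i (∑ j, a j • x j) = _
    rw [map_sum, Finset.sum_eq_single i (fun j _ hj => by rw [map_zsmul, h0 i j hj.symm, smul_zero])
      (by simp), map_zsmul, smul_eq_mul]
  refine ⟨(AddEquiv.ofBijective F ⟨(injective_iff_map_eq_zero F).2 fun a ha => ?_, ?_⟩).symm⟩
  · funext i
    have := hF i a
    rw [ha, map_zero] at this
    exact (mul_eq_zero.1 this.symm).resolve_right (h1 i)
  · rw [← AddMonoidHom.range_eq_top, eq_top_iff, ← hx, AddSubgroup.closure_le]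
    rintro _ ⟨j, rfl⟩
    refine ⟨Pi.single j 1, ?_⟩
    change ∑ i, (Pi.single j 1 : Fin r → ℤ) i • x i = x j
    rw [Finset.sum_eq_single j (fun i _ hi => by rw [Pi.single_eq_of_ne hi, zero_smul]) (by simp),
      Pi.single_eq_same, one_smul]

/-- An abelian group generated by elements `x j` of order two which are separated by homomorphisms
is elementary abelian on these elements. -/
lemma nonempty_addEquiv_of_separated_two {G : Type*} [AddCommGroup G] {r : ℕ} (x : Fin r → G)
    (hx : AddSubgroup.closure (Set.range x) = ⊤) (h2 : ∀ j, x j + x j = 0)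
    {H : Fin r → Type*} [∀ i, AddCommGroup (H i)] (Φ : ∀ i, G →+ H i)
    (h0 : ∀ i j, i ≠ j → Φ i (x j) = 0) (h1 : ∀ i, Φ i (x i) ≠ 0) :
    Nonempty (G ≃+ (Fin r → ZMod 2)) := by
  let F : (Fin r → ZMod 2) →+ G :=
    ∑ j, (ZMod.lift 2 ⟨zmultiplesHom G (x j), by
      simpa [two_smul] using h2 j⟩).comp (Pi.evalAddMonoidHom (fun _ => ZMod 2) j)
  have hF1 : ∀ j, F (Pi.single j 1) = x j := fun j => by
    rw [AddMonoidHom.finsetSum_apply, Finset.sum_eq_single j (fun i _ hi => by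
      simp [Pi.single_eq_of_ne hi]) (by simp)]
    simp only [AddMonoidHom.comp_apply, Pi.evalAddMonoidHom_apply, Pi.single_eq_same]
    have := ZMod.lift_coe 2 ⟨zmultiplesHom G (x j), by simpa [two_smul] using h2 j⟩ 1
    simpa using this
  refine ⟨(AddEquiv.ofBijective F ⟨(injective_iff_map_eq_zero F).2 fun a ha => ?_, ?_⟩).symm⟩
  · have hsum : F a = ∑ j, F (Pi.single j (a j)) := by
      rw [← map_sum, Finset.univ_sum_single]
    funext i
    by_contra hi
    have hai : a i = 1 := by
      have : ∀ z : ZMod 2, z ≠ 0 → z = 1 := by decide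
      exact this _ hi
    have : Φ i (F a) = Φ i (x i) := by
      rw [hsum, map_sum, Finset.sum_eq_single i (fun j _ hj => ?_) (by simp), hai, hF1]
      have : a j = 0 ∨ a j = 1 := by
        have : ∀ z : ZMod 2, z = 0 ∨ z = 1 := by decide
        exact this _
      rcases this with h | h
      · rw [h, Pi.single_zero, map_zero, map_zero]
      · rw [h, hF1, h0 i j hj.symm]
    rw [ha, map_zero] at this
    exact h1 i this.symm
  · rw [← AddMonoidHom.range_eq_top, eq_top_iff, ← hx, AddSubgroup.closure_le]
    rintro _ ⟨j, rfl⟩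
    exact ⟨Pi.single j 1, hF1 j⟩

end Groups

/-! ### Square roots in real division algebras -/

section DivisionAlgebra

/-- In a finite-dimensional real division algebra, a non-scalar element generates a copy of the
complex numbers, in which every element is a square. -/
lemma exists_mul_self_eq_of_notMem_range {D : Type*} [Ring D] [IsDomain D] [Algebra ℝ D]
    [Module.Finite ℝ D] {w : D} (hw : w ∉ Set.range (algebraMap ℝ D)) {z : D}
    (hz : z ∈ Submodule.span ℝ {1, w}) : ∃ c ∈ Submodule.span ℝ {1, w}, c * c = z := by
  have hint : IsIntegral ℝ w := Algebra.IsIntegral.isIntegral w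
  have hmon := minpoly.monic hint
  have hdeg : (minpoly ℝ w).natDegree = 2 := by
    have h1 : (minpoly ℝ w).natDegree ≤ 2 := Polynomial.natDegree_le_of_degree_le
      (minpoly.irreducible hint).degree_le_two
    have h2 : (minpoly ℝ w).natDegree ≠ 0 := (minpoly.natDegree_pos hint).ne'
    have h3 : (minpoly ℝ w).natDegree ≠ 1 := fun h => hw (minpoly.mem_range_of_degree_eq_one ℝ w
      ((Polynomial.degree_eq_iff_natDegree_eq hmon.ne_zero).2 h))
    omega
  obtain ⟨p, q, hpq⟩ : ∃ p q : ℝ, w * w = algebraMap ℝ D q + p • w := by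
    refine ⟨-(minpoly ℝ w).coeff 1, -(minpoly ℝ w).coeff 0, ?_⟩
    have h := minpoly.aeval ℝ w
    rw [Polynomial.aeval_eq_sum_range, hdeg, Finset.sum_range_succ, Finset.sum_range_succ,
      Finset.sum_range_one] at h
    have h2 : (minpoly ℝ w).coeff 2 = 1 := by rw [← hdeg]; exact hmon
    rw [h2, pow_zero, pow_one, one_smul, pow_two, ← Algebra.algebraMap_eq_smul_one] at h
    rw [map_neg, neg_smul, ← neg_add]
    exact eq_neg_of_add_eq_zero_right h
  let u : D := w - algebraMap ℝ D (p / 2)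
  have hu : u * u = algebraMap ℝ D (q + p ^ 2 / 4) := by
    simp only [u, Algebra.algebraMap_eq_smul_one, sub_mul, mul_sub, hpq, smul_mul_assoc,
      mul_smul_comm, one_mul, mul_one]
    module
  have hneg : q + p ^ 2 / 4 < 0 := by
    by_contra h
    have h := not_lt.1 h
    have h1 : (u - algebraMap ℝ D (√(q + p ^ 2 / 4))) * (u + algebraMap ℝ D (√(q + p ^ 2 / 4))) =
        0 := by
      rw [sub_mul, mul_add, mul_add, hu, ← map_mul, Real.mul_self_sqrt h, ← Algebra.commutes]
      abel
    rcases mul_eq_zero.1 h1 with h2 | h2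
    · exact hw ⟨√(q + p ^ 2 / 4) + p / 2, by
        rw [map_add, ← sub_eq_zero.1 h2]; simp [u]⟩
    · exact hw ⟨-√(q + p ^ 2 / 4) + p / 2, by
        rw [map_add, map_neg, ← eq_neg_of_add_eq_zero_left h2]; simp [u]⟩
  obtain ⟨t, ht0, ht⟩ : ∃ t : ℝ, t ≠ 0 ∧ t * t = -(q + p ^ 2 / 4) :=
    ⟨√(-(q + p ^ 2 / 4)), (Real.sqrt_pos.2 (by linarith)).ne',
      Real.mul_self_sqrt (by linarith)⟩
  have hi : (t⁻¹ • u) * (t⁻¹ • u) = -1 := by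
    rw [smul_mul_smul_comm, hu, Algebra.algebraMap_eq_smul_one, smul_smul, ← mul_inv, ht,
      inv_neg, neg_mul, inv_mul_cancel₀ hneg.ne, neg_smul, one_smul]
  have hmem : ∀ a : ℂ, Complex.liftAux (t⁻¹ • u) hi a ∈ Submodule.span ℝ {1, w} := fun a => by
    rw [Complex.liftAux_apply, Algebra.algebraMap_eq_smul_one]
    have h1 : (1 : D) ∈ Submodule.span ℝ {1, w} := Submodule.subset_span (by simp)
    have hw' : w ∈ Submodule.span ℝ {1, w} := Submodule.subset_span (by simp)
    refine Submodule.add_mem _ (Submodule.smul_mem _ _ h1)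
      (Submodule.smul_mem _ _ (Submodule.smul_mem _ _ (Submodule.sub_mem _ hw' ?_)))
    rw [Algebra.algebraMap_eq_smul_one]
    exact Submodule.smul_mem _ _ h1
  obtain ⟨a, b, rfl⟩ := Submodule.mem_span_pair.1 hz
  obtain ⟨ζ, hζ⟩ := IsAlgClosed.exists_pow_nat_eq (⟨a + b * (p / 2), b * t⟩ : ℂ) two_pos
  refine ⟨Complex.liftAux (t⁻¹ • u) hi ζ, hmem ζ, ?_⟩
  rw [← map_mul, ← pow_two, hζ, Complex.liftAux_apply, smul_smul, mul_assoc, mul_inv_cancel₀ ht0,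
    mul_one]
  simp only [u, Algebra.algebraMap_eq_smul_one]
  module

end DivisionAlgebra

/-! ### Invariants of Witt classes attached to a simple form -/

section Invariants

open CategoryTheory CategoryTheory.Limits CategoryTheory.Pretriangulated

variable {A : Type u} [Ring A] [Algebra ℝ A] {σ : RingInvo A} {n m : ℤ}
variable {X : CochainComplex (ModuleCat.{u} A) ℤ}

/-- Maps from `X` to a sum of complexes. -/
noncomputable def homSumEquiv (X K L : CochainComplex (ModuleCat.{u} A) ℤ) :
    (((toK A).obj X ⟶ (toK A).obj K) × ((toK A).obj X ⟶ (toK A).obj L)) ≃ₗ[ℝ]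
      ((toK A).obj X ⟶ (toK A).obj (K ⊞ L)) where
  toFun f := f.1 ≫ (toK A).map biprod.inl + f.2 ≫ (toK A).map biprod.inr
  invFun h := (h ≫ (toK A).map biprod.fst, h ≫ (toK A).map biprod.snd)
  map_add' f g := by
    simp only [Prod.fst_add, Prod.snd_add, Preadditive.add_comp]
    abel
  map_smul' r f := by
    simp only [Prod.smul_fst, Prod.smul_snd, Linear.smul_comp, smul_add, RingHom.id_apply]
  left_inv f := by
    simp only [Preadditive.add_comp, Category.assoc, ← Functor.map_comp, biprod.inl_fst,
      biprod.inl_snd, biprod.inr_fst, biprod.inr_snd, CategoryTheory.Functor.map_id,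
      Functor.map_zero, Category.comp_id, comp_zero, add_zero, zero_add]
  right_inv h := by
    simp only [Category.assoc, ← Functor.map_comp, ← Preadditive.comp_add, ← Functor.map_add,
      biprod.total, CategoryTheory.Functor.map_id, Category.comp_id]

/-- Composition with an isomorphism, as a real linear equivalence. -/
noncomputable def homIsoEquiv (X : CochainComplex (ModuleCat.{u} A) ℤ)
    {K L : CochainComplex (ModuleCat.{u} A) ℤ} (g : (toK A).obj K ⟶ (toK A).obj L) [IsIso g] :
    ((toK A).obj X ⟶ (toK A).obj K) ≃ₗ[ℝ] ((toK A).obj X ⟶ (toK A).obj L) where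
  toFun f := f ≫ g
  invFun f := f ≫ inv g
  map_add' _ _ := Preadditive.add_comp ..
  map_smul' _ _ := Linear.smul_comp ..
  left_inv f := by simp only [Category.assoc, IsIso.hom_inv_id, Category.comp_id]
  right_inv f := by simp only [Category.assoc, IsIso.inv_hom_id, Category.comp_id]

/-- Subspaces of `Hom(X, Y)` stable under the endomorphisms of `X` are vector spaces over the
division algebra of these endomorphisms. -/
lemma IsStalk.finrank_end_dvd [IsSemisimpleRing A] (hX : IsStalk X m)
    {Y : HomotopyCategory (ModuleCat.{u} A) (ComplexShape.up ℤ)}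
    (N : Submodule ℝ ((toK A).obj X ⟶ Y))
    (hN : ∀ (a : (toK A).obj X ⟶ (toK A).obj X), ∀ f ∈ N, a ≫ f ∈ N) :
    Module.finrank ℝ (End ((toK A).obj X)) ∣ Module.finrank ℝ N := by
  have : Nontrivial (End ((toK A).obj X)) := ⟨⟨𝟙 _, 0, hX.id_ne_zero⟩⟩
  let : DivisionRing (End ((toK A).obj X))ᵐᵒᵖ := DivisionRing.ofIsUnitOrEqZero fun a => by
    by_cases ha : a = 0
    · exact Or.inr ha
    · have := hX.isIso_of_ne_zero hX (f := a.unop) (fun h => ha (MulOpposite.unop_injective h))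
      refine Or.inl ⟨⟨a, MulOpposite.op (inv a.unop), ?_, ?_⟩, rfl⟩
      · exact MulOpposite.unop_injective (IsIso.hom_inv_id a.unop)
      · exact MulOpposite.unop_injective (IsIso.inv_hom_id a.unop)
  have : IsScalarTower ℝ (End ((toK A).obj X))ᵐᵒᵖ ((toK A).obj X ⟶ Y) :=
    ⟨fun r a f => Linear.smul_comp _ _ _ r a.unop f⟩
  let N' : Submodule (End ((toK A).obj X))ᵐᵒᵖ ((toK A).obj X ⟶ Y) :=
    { N with smul_mem' := fun a f hf => hN a.unop f hf }
  have e : Module.finrank ℝ N = Module.finrank ℝ N' := rfl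
  rw [e, ← Module.finrank_mul_finrank ℝ (End ((toK A).obj X))ᵐᵒᵖ N',
    (MulOpposite.opLinearEquiv ℝ : End ((toK A).obj X) ≃ₗ[ℝ] _).finrank_eq]
  exact dvd_mul_right _ _

namespace SymSpace

variable [σ.IsReal] {μ : ((toK A).obj X ⟶ (toK A).obj (dualComplex σ n X)) →ₗ[ℝ] ℝ}

lemma realBilin_orthSum (P Q : SymSpace σ n)
    (x : ((toK A).obj X ⟶ (toK A).obj P.K) × ((toK A).obj X ⟶ (toK A).obj Q.K)) :
    realBilin μ (P.orthSum Q) (homSumEquiv X P.K Q.K x) (homSumEquiv X P.K Q.K x) =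
      realBilin μ P x.1 x.1 + realBilin μ Q x.2 x.2 := by
  obtain ⟨h, rfl⟩ := (homSumEquiv X P.K Q.K).symm.surjective x
  rw [LinearEquiv.apply_symm_apply, realBilin_apply, realBilin_apply, ← map_add]
  refine congrArg μ ?_
  change h ≫ (toK A).map (orthForm P.φ Q.φ) ≫ dualK σ n h = (h ≫ (toK A).map biprod.fst) ≫
    P.formK ≫ dualK σ n (h ≫ (toK A).map biprod.fst) + (h ≫ (toK A).map biprod.snd) ≫
    Q.formK ≫ dualK σ n (h ≫ (toK A).map biprod.snd)
  simp only [orthForm, Functor.map_add, Functor.map_comp, dualK_comp, dualK_map, Category.assoc,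
    Preadditive.add_comp, Preadditive.comp_add]

variable [IsSemisimpleRing A] [Module.Finite ℝ A]

/-- The signature of the forms on `Hom(X, -)`, as a homomorphism on the Witt group. -/
noncomputable def sigHom (hX : IsStalk X m)
    {e : (toK A).obj X ⟶ (toK A).obj (dualComplex σ n X)} (he : IsIso e)
    (hes : transposeK σ n e = e) (hμe : μ e = 1) (hμ : ∀ u, μ (transposeK σ n u) = μ u) :
    WittGroup σ n →+ ℤ :=
  wittLift (fun P => (realBilin μ P).sig)
    (fun P Q => by
      have := hX.finite_hom P.perf
      have := hX.finite_hom Q.perf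
      have := hX.finite_hom (P.orthSum Q).perf
      exact LinearMap.BilinForm.sig_add (realBilin_isSymm hμ _)
        (realBilin_nondegenerate hX he hes hμe hμ _) (realBilin_isSymm hμ _)
        (realBilin_nondegenerate hX he hes hμe hμ _) (realBilin_isSymm hμ _)
        (realBilin_nondegenerate hX he hes hμe hμ _) (homSumEquiv X P.K Q.K)
        (realBilin_orthSum P Q))
    (fun P Q h => by
      obtain ⟨g, hg, h⟩ := h.exists_iso
      refine LinearMap.BilinForm.sig_eq_of_equiv (homIsoEquiv X g) fun f => ?_
      rw [realBilin_apply, realBilin_apply, ← h]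
      change μ ((f ≫ g) ≫ Q.formK ≫ dualK σ n (f ≫ g)) = _
      rw [dualK_comp]
      simp only [Category.assoc])
    (fun P hP => by
      have := hX.finite_hom P.perf
      obtain ⟨L, α, h⟩ := hP.exists_orthogonal_eq hX he hes hμe hμ
      exact LinearMap.BilinForm.sig_eq_zero_of_orthogonal_eq (realBilin_isSymm hμ _)
        (realBilin_nondegenerate hX he hes hμe hμ _) h)

lemma sigHom_wittClass (hX : IsStalk X m)
    {e : (toK A).obj X ⟶ (toK A).obj (dualComplex σ n X)} (he : IsIso e)
    (hes : transposeK σ n e = e) (hμe : μ e = 1) (hμ : ∀ u, μ (transposeK σ n u) = μ u)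
    (P : SymSpace σ n) : sigHom hX he hes hμe hμ P.wittClass = (realBilin μ P).sig :=
  wittLift_wittClass _ _ _ _ P

/-- The dimension of `Hom(X, -)`, modulo twice the dimension of the endomorphisms of `X`, as a
homomorphism on the Witt group. -/
noncomputable def dimHom (hX : IsStalk X m)
    {e : (toK A).obj X ⟶ (toK A).obj (dualComplex σ n X)} (he : IsIso e)
    (hes : transposeK σ n e = e) (hμe : μ e = 1) (hμ : ∀ u, μ (transposeK σ n u) = μ u) :
    WittGroup σ n →+ ZMod (2 * Module.finrank ℝ (End ((toK A).obj X))) :=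
  wittLift (fun P => (Module.finrank ℝ ((toK A).obj X ⟶ (toK A).obj P.K) : ZMod _))
    (fun P Q => by
      have := hX.finite_hom P.perf
      have := hX.finite_hom Q.perf
      rw [← Nat.cast_add, ← Module.finrank_prod]
      exact congrArg _ (homSumEquiv X P.K Q.K).finrank_eq.symm)
    (fun P Q h => by
      obtain ⟨g, hg, h⟩ := h.exists_iso
      rw [(homIsoEquiv X g).finrank_eq])
    (fun P hP => by
      have := hX.finite_hom P.perf
      obtain ⟨L, α, h⟩ := hP.exists_orthogonal_eq hX he hes hμe hμ
      rw [ZMod.natCast_eq_zero_iff, ← LinearMap.BilinForm.two_mul_finrank_of_orthogonal_eq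
        (realBilin_nondegenerate hX he hes hμe hμ _) h]
      refine mul_dvd_mul_left 2 (hX.finrank_end_dvd _ ?_)
      rintro a _ ⟨f, rfl⟩
      exact ⟨a ≫ f, Category.assoc a f α⟩)

lemma dimHom_wittClass (hX : IsStalk X m)
    {e : (toK A).obj X ⟶ (toK A).obj (dualComplex σ n X)} (he : IsIso e)
    (hes : transposeK σ n e = e) (hμe : μ e = 1) (hμ : ∀ u, μ (transposeK σ n u) = μ u)
    (P : SymSpace σ n) : dimHom hX he hes hμe hμ P.wittClass =
      (Module.finrank ℝ ((toK A).obj X ⟶ (toK A).obj P.K) : ZMod _) :=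
  wittLift_wittClass _ _ _ _ P

end SymSpace

end Invariants

/-! ### Witt groups from the forms on the simple objects -/

section Classification

open CategoryTheory CategoryTheory.Limits CategoryTheory.Pretriangulated

variable {A : Type u} [Ring A] {σ : RingInvo A} {n m : ℤ}

namespace SymSpace

variable {X : CochainComplex (ModuleCat.{u} A) ℤ}

lemma exists_wittClass_eq_ofK [IsSemisimpleRing A] (hX : IsStalk X m) (Q : SymSpace σ n)
    (f : (toK A).obj X ⟶ (toK A).obj Q.K) (hf : IsIso f) :
    ∃ (e : (toK A).obj X ⟶ (toK A).obj (dualComplex σ n X)) (he : transposeK σ n e = e)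
      (hi : IsIso e), Q.wittClass = (ofK X hX.isPerf e he hi).wittClass := by
  have := Q.nondeg
  have := isIso_dualK (σ := σ) n f
  refine ⟨f ≫ Q.formK ≫ dualK σ n f, ?_, inferInstance, ?_⟩
  · rw [← Category.assoc, transposeK_comp_dualK, transposeK_comp, transposeK_formK, Category.assoc]
  · exact (Isometric.ofK f hf (ofK_formK ..).symm : Isometric (ofK _ _ _ _ _) Q).wittClass_eq.symm

/-- The Witt group is generated by classes `x j` as soon as these generate the classes of the
spaces on representatives of the simple objects. -/
lemma closure_range_eq_top [IsSemisimpleRing A] (hnm : -n - m = m) {r : ℕ}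
    {X : Fin r → CochainComplex (ModuleCat.{u} A) ℤ} (hX : ∀ j, IsStalk (X j) m)
    (hex : ∀ K, IsStalk K m → ∃ j, ∃ f : (toK A).obj (X j) ⟶ (toK A).obj K, IsIso f)
    (x : Fin r → WittGroup σ n)
    (h : ∀ j (e : (toK A).obj (X j) ⟶ (toK A).obj (dualComplex σ n (X j)))
      (he : transposeK σ n e = e) (hi : IsIso e),
      (ofK (X j) (hX j).isPerf e he hi).wittClass ∈ AddSubgroup.closure (Set.range x)) :
    AddSubgroup.closure (Set.range x) = ⊤ := by
  rw [eq_top_iff, ← closure_isStalk σ n, AddSubgroup.closure_le]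
  rintro _ ⟨Q, m', hQ, rfl⟩
  obtain rfl : m' = m := by
    have := degree_eq_of_isStalk hQ
    omega
  obtain ⟨j, f, hf⟩ := hex _ hQ
  obtain ⟨e, he, hi, h'⟩ := exists_wittClass_eq_ofK (hX j) Q f hf
  rw [SetLike.mem_coe, h']
  exact h j e he hi

lemma subsingleton_wittGroup_of_forall_eq_zero [IsSemisimpleRing A] (hnm : -n - m = m)
    (h : ∀ K, IsStalk K m → ∀ e : (toK A).obj K ⟶ (toK A).obj (dualComplex σ n K),
      transposeK σ n e = e → e = 0) : Subsingleton (WittGroup σ n) := by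
  have h : {x | ∃ (Q : SymSpace σ n) (m : ℤ), IsStalk Q.K m ∧ x = Q.wittClass} = ∅ :=
    Set.eq_empty_of_forall_notMem fun x ⟨Q, m', hQ, _⟩ => by
      obtain rfl : m' = m := by
        have := degree_eq_of_isStalk hQ
        omega
      have := Q.nondeg
      exact hQ.ne_zero_of_isIso Q.formK (h _ hQ _ Q.transposeK_formK)
  have := closure_isStalk σ n
  rw [h, AddSubgroup.closure_empty] at this
  exact AddSubgroup.subsingleton_iff.1 (subsingleton_of_bot_eq_top this)

/-- Forms `c e c^#` are isometric to `e`. -/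
lemma wittClass_ofK_eq {perf : IsPerf X}
    {e e' : (toK A).obj X ⟶ (toK A).obj (dualComplex σ n X)} {he : transposeK σ n e = e}
    {hi : IsIso e} {he' : transposeK σ n e' = e'} {hi' : IsIso e'}
    (c : (toK A).obj X ⟶ (toK A).obj X) (hc : IsIso c) (h : c ≫ e ≫ dualK σ n c = e') :
    (ofK X perf e' he' hi').wittClass = (ofK X perf e he hi).wittClass :=
  Isometric.wittClass_eq (Isometric.ofK c hc (by rw [ofK_formK, ofK_formK]; exact h))

lemma wittClass_ofK_neg {perf : IsPerf X}
    {e e' : (toK A).obj X ⟶ (toK A).obj (dualComplex σ n X)} {he : transposeK σ n e = e}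
    {hi : IsIso e} {he' : transposeK σ n e' = e'} {hi' : IsIso e'} (h : e' = -e) :
    (ofK X perf e' he' hi').wittClass = -(ofK X perf e he hi).wittClass := by
  rw [← wittClass_neg]
  refine Isometric.wittClass_eq (Isometric.ofK (𝟙 ((toK A).obj X)) (IsIso.id _) ?_)
  rw [ofK_formK]
  change 𝟙 ((toK A).obj X) ≫ (toK A).map (-(ofK X perf e he hi).φ) ≫ dualK σ n (𝟙 _) = e'
  rw [dualK_id, Category.comp_id, Category.id_comp, h]
  exact (Functor.map_neg (toK A)).trans (congrArg (-·) (ofK_formK X perf e he hi))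

variable [Algebra ℝ A] [σ.IsReal]

lemma isIso_smul_id {r : ℝ} (hr : r ≠ 0) : IsIso (r • 𝟙 ((toK A).obj X)) :=
  ⟨r⁻¹ • 𝟙 _, by rw [Linear.smul_comp, Linear.comp_smul, smul_smul, mul_inv_cancel₀ hr, one_smul,
    Category.comp_id], by rw [Linear.smul_comp, Linear.comp_smul, smul_smul, inv_mul_cancel₀ hr,
    one_smul, Category.comp_id]⟩

variable [IsSemisimpleRing A]

/-- If the form on a simple object is unique up to real scalars, it is definite. -/
lemma realBilin_pos (hX : IsStalk X m)
    {e : (toK A).obj X ⟶ (toK A).obj (dualComplex σ n X)} (hi : IsIso e)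
    (he : transposeK σ n e = e)
    (huniq : ∀ e' : (toK A).obj X ⟶ (toK A).obj (dualComplex σ n X),
      transposeK σ n e' = e' → ∃ c : ℝ, e' = c • e)
    {μ : ((toK A).obj X ⟶ (toK A).obj (dualComplex σ n X)) →ₗ[ℝ] ℝ}
    (hμe : μ e = 1) (hμ : ∀ u, μ (transposeK σ n u) = μ u)
    (f : (toK A).obj X ⟶ (toK A).obj (ofK X hX.isPerf e he hi).K) (hf : f ≠ 0) :
    0 < realBilin μ (ofK X hX.isPerf e he hi) f f := by
  have key : ∀ g : (toK A).obj X ⟶ (toK A).obj X,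
      realBilin μ (ofK X hX.isPerf e he hi) g g = μ (g ≫ e ≫ dualK σ n g) := fun g =>
    congrArg (fun z => μ (g ≫ z ≫ dualK σ n g)) (ofK_formK X hX.isPerf e he hi)
  refine LinearMap.BilinForm.pos_of_anisotropic (realBilin_isSymm hμ _) ?_ (v := 𝟙 _) ?_ hf
  · intro (g : (toK A).obj X ⟶ (toK A).obj X) (hg : g ≠ 0)
    rw [key]
    have := hX.isIso_of_ne_zero hX hg
    have := isIso_dualK (σ := σ) n g
    obtain ⟨c, hc⟩ := huniq (g ≫ e ≫ dualK σ n g) (by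
      rw [← Category.assoc, transposeK_comp_dualK, transposeK_comp, he,
        Category.assoc])
    rw [hc, map_smul, hμe, smul_eq_mul, mul_one]
    rintro rfl
    rw [zero_smul] at hc
    exact hX.ne_zero_of_isIso (g ≫ e ≫ dualK σ n g) hc
  · refine lt_of_lt_of_eq one_pos ((key (𝟙 _)).trans ?_).symm
    rw [dualK_id, Category.comp_id, Category.id_comp, hμe]

variable [Module.Finite ℝ A]

/-- If each simple object carries a form that is unique up to real scalars, the Witt group is free
on the classes of these forms. -/
theorem nonempty_addEquiv_int (hnm : -n - m = m) {r : ℕ}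
    {X : Fin r → CochainComplex (ModuleCat.{u} A) ℤ} (hX : ∀ j, IsStalk (X j) m)
    (hex : ∀ K, IsStalk K m → ∃ j, ∃ f : (toK A).obj (X j) ⟶ (toK A).obj K, IsIso f)
    (hne : ∀ i j, i ≠ j → ∀ f : (toK A).obj (X i) ⟶ (toK A).obj (X j), f = 0)
    (h : ∀ K, IsStalk K m → ∃ e : (toK A).obj K ⟶ (toK A).obj (dualComplex σ n K),
      IsIso e ∧ transposeK σ n e = e ∧
      ∀ e' : (toK A).obj K ⟶ (toK A).obj (dualComplex σ n K),
        transposeK σ n e' = e' → ∃ c : ℝ, e' = c • e) :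
    Nonempty (WittGroup σ n ≃+ (Fin r → ℤ)) := by
  choose e hi he huniq using fun j => h _ (hX j)
  choose μ hμe hμ using fun j =>
    exists_symmetric_functional ((hX j).ne_zero_of_isIso (e j)) (he j)
  refine nonempty_addEquiv_of_separated_int
    (fun j => (ofK (X j) (hX j).isPerf (e j) (he j) (hi j)).wittClass) ?_
    (fun j => sigHom (hX j) (hi j) (he j) (hμe j) (hμ j)) ?_ ?_
  · refine closure_range_eq_top hnm hX hex _ fun j e' he' hi' => ?_
    have hmem : (ofK (X j) (hX j).isPerf (e j) (he j) (hi j)).wittClass ∈ AddSubgroup.closure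
        (Set.range fun j => (ofK (X j) (hX j).isPerf (e j) (he j) (hi j)).wittClass) :=
      AddSubgroup.subset_closure ⟨j, rfl⟩
    obtain ⟨c, rfl⟩ := huniq j e' he'
    have hc : c ≠ 0 := fun h => (hX j).ne_zero_of_isIso (c • e j) (by rw [h, zero_smul])
    have hs : ∀ s : ℝ, (s • 𝟙 ((toK A).obj (X j))) ≫ e j ≫
        dualK σ n (s • 𝟙 ((toK A).obj (X j))) = (s * s) • e j := fun s => by
      rw [dualK_smul, dualK_id, Linear.smul_comp, Linear.comp_smul, Linear.comp_smul,
        Category.comp_id, Category.id_comp, smul_smul]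
    rcases lt_or_gt_of_ne hc with hc0 | hc0
    · -- a negative multiple has the opposite class
      have hneg : c • e j = -((√(-c) * √(-c)) • e j) := by
        rw [Real.mul_self_sqrt (by linarith), neg_smul, neg_neg]
      have he2 : transposeK σ n ((√(-c) * √(-c)) • e j) = (√(-c) * √(-c)) • e j := by
        rw [transposeK_smul, he]
      have hi2 : IsIso ((√(-c) * √(-c)) • e j) := by
        rw [← neg_neg ((√(-c) * √(-c)) • e j), ← hneg]
        exact ⟨-inv (c • e j),
          by rw [Preadditive.neg_comp_neg, IsIso.hom_inv_id],
          by rw [Preadditive.neg_comp_neg, IsIso.inv_hom_id]⟩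
      rw [wittClass_ofK_neg (he := he2) (hi := hi2) hneg]
      refine neg_mem ?_
      rw [wittClass_ofK_eq (he := he j) (hi := hi j) (√(-c) • 𝟙 _)
        (isIso_smul_id (Real.sqrt_pos.2 (by linarith)).ne') (hs _)]
      exact hmem
    · rw [wittClass_ofK_eq (he := he j) (hi := hi j) (√c • 𝟙 _)
        (isIso_smul_id (Real.sqrt_pos.2 hc0).ne') ((hs _).trans (by
          rw [Real.mul_self_sqrt hc0.le]))]
      exact hmem
  · intro i j hij
    rw [sigHom_wittClass]
    have : Subsingleton ((toK A).obj (X i) ⟶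
        (toK A).obj (ofK (X j) (hX j).isPerf (e j) (he j) (hi j)).K) :=
      ⟨fun f g => (hne i j hij f).trans (hne i j hij g).symm⟩
    have := LinearMap.BilinForm.sig_eq_finrank (realBilin_isSymm (hμ i) _)
      (realBilin_nondegenerate (hX i) (hi i) (he i) (hμe i) (hμ i)
        (ofK (X j) (hX j).isPerf (e j) (he j) (hi j)))
      (fun x hx => absurd (Subsingleton.elim x 0) hx)
    rw [this, Module.finrank_zero_of_subsingleton, Nat.cast_zero]
  · intro i
    rw [sigHom_wittClass]
    have := (hX i).finite_hom (ofK (X i) (hX i).isPerf (e i) (he i) (hi i)).perf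
    rw [LinearMap.BilinForm.sig_eq_finrank (realBilin_isSymm (hμ i) _)
      (realBilin_nondegenerate (hX i) (hi i) (he i) (hμe i) (hμ i) _)
      (realBilin_pos (hX i) (hi i) (he i) (huniq i) (hμe i) (hμ i))]
    have : Nontrivial ((toK A).obj (X i) ⟶
      (toK A).obj (ofK (X i) (hX i).isPerf (e i) (he i) (hi i)).K) :=
      ⟨𝟙 ((toK A).obj (X i)), 0, (hX i).id_ne_zero⟩
    exact_mod_cast Module.finrank_pos.ne'

/-- If a simple object carries two independent forms, all forms on it are isometric. -/
lemma exists_comp_dualK_eq (hX : IsStalk X m)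
    {e : (toK A).obj X ⟶ (toK A).obj (dualComplex σ n X)} (hi : IsIso e)
    (he : transposeK σ n e = e)
    {e₁ : (toK A).obj X ⟶ (toK A).obj (dualComplex σ n X)} (he₁ : transposeK σ n e₁ = e₁)
    (hind : ∀ c : ℝ, e₁ ≠ c • e)
    {e' : (toK A).obj X ⟶ (toK A).obj (dualComplex σ n X)} (he' : transposeK σ n e' = e')
    (h0 : e' ≠ 0) :
    ∃ c : (toK A).obj X ⟶ (toK A).obj X, IsIso c ∧ c ≫ e ≫ dualK σ n c = e' := by
  have : Module.Finite ℝ (End ((toK A).obj X)) := hX.finite_hom hX.isPerf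
  have : Nontrivial (End ((toK A).obj X)) := ⟨⟨𝟙 _, 0, hX.id_ne_zero⟩⟩
  have : NoZeroDivisors (End ((toK A).obj X)) := ⟨fun {a b} hab => by
    by_contra! h
    have h1 := hX.isIso_of_ne_zero hX h.1
    have h2 := hX.isIso_of_ne_zero hX h.2
    have h3 : IsIso ((b : (toK A).obj X ⟶ (toK A).obj X) ≫ a) := inferInstance
    exact hX.ne_zero_of_isIso (b ≫ a) hab⟩
  have : IsDomain (End ((toK A).obj X)) := NoZeroDivisors.to_isDomain _
  -- the endomorphisms which are self-adjoint for `e`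
  let H : Submodule ℝ (End ((toK A).obj X)) :=
    { carrier := {c | c ≫ e = e ≫ dualK σ n c}
      zero_mem' := by
        change (0 : (toK A).obj X ⟶ (toK A).obj X) ≫ e = e ≫ dualK σ n 0
        rw [dualK_zero, zero_comp, comp_zero]
      add_mem' := fun {a b} ha hb => by
        change (a + b : (toK A).obj X ⟶ (toK A).obj X) ≫ e = e ≫ dualK σ n (a + b)
        rw [dualK_add, Preadditive.add_comp, Preadditive.comp_add, ha, hb]
      smul_mem' := fun r a ha => by
        change (r • a : (toK A).obj X ⟶ (toK A).obj X) ≫ e = e ≫ dualK σ n (r • a)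
        rw [dualK_smul, Linear.smul_comp, Linear.comp_smul, ha] }
  have hH1 : (1 : End ((toK A).obj X)) ∈ H := by
    change 𝟙 ((toK A).obj X) ≫ e = e ≫ dualK σ n (𝟙 _)
    rw [dualK_id, Category.id_comp, Category.comp_id]
  have hHw : ∀ u : (toK A).obj X ⟶ (toK A).obj (dualComplex σ n X), transposeK σ n u = u →
      (u ≫ inv e : End ((toK A).obj X)) ∈ H := fun u hu => by
    change (u ≫ inv e) ≫ e = e ≫ dualK σ n (u ≫ inv e)
    rw [Category.assoc, IsIso.inv_hom_id, Category.comp_id]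
    have h1 : transposeK σ n ((u ≫ inv e) ≫ e) = e ≫ dualK σ n (u ≫ inv e) := by
      rw [transposeK_comp, he]
    rw [← h1, Category.assoc, IsIso.inv_hom_id, Category.comp_id, hu]
  have hscal : ∀ u : (toK A).obj X ⟶ (toK A).obj (dualComplex σ n X), ∀ r : ℝ,
      algebraMap ℝ (End ((toK A).obj X)) r = u ≫ inv e → u = r • e := fun u r hr => by
    rw [Algebra.algebraMap_eq_smul_one] at hr
    have h : (r • 𝟙 ((toK A).obj X)) ≫ e = (u ≫ inv e) ≫ e := congrArg (· ≫ e) hr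
    rw [Linear.smul_comp, Category.id_comp, Category.assoc, IsIso.inv_hom_id,
      Category.comp_id] at h
    exact h.symm
  have hspan : ∀ w ∈ H, Submodule.span ℝ {1, w} ≤ H := fun w hw => by
    rw [Submodule.span_le]
    rintro x (rfl | rfl)
    · exact hH1
    · exact hw
  let w : End ((toK A).obj X) := e' ≫ inv e
  let w₁ : End ((toK A).obj X) := e₁ ≫ inv e
  obtain ⟨c, hcH, hc⟩ : ∃ c ∈ H, c * c = w := by
    by_cases hw : w ∈ Set.range (algebraMap ℝ (End ((toK A).obj X)))
    · obtain ⟨r, hr⟩ := hw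
      obtain ⟨c, hc, h⟩ := exists_mul_self_eq_of_notMem_range (w := w₁)
        (z := algebraMap ℝ (End ((toK A).obj X)) r)
        (fun ⟨s, hs⟩ => hind s (hscal _ _ hs)) (by
          rw [Algebra.algebraMap_eq_smul_one]
          exact Submodule.smul_mem _ _ (Submodule.subset_span (by simp)))
      exact ⟨c, hspan _ (hHw _ he₁) hc, h.trans hr⟩
    · obtain ⟨c, hc, h⟩ := exists_mul_self_eq_of_notMem_range hw
        (z := w) (Submodule.subset_span (by simp))
      exact ⟨c, hspan _ (hHw _ he') hc, h⟩
  have hce : c ≫ e ≫ dualK σ n c = e' := by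
    have h1 : c ≫ e = e ≫ dualK σ n c := hcH
    have h2 : (c ≫ c) ≫ e = (e' ≫ inv e) ≫ e := congrArg (· ≫ e) hc
    rw [Category.assoc, Category.assoc, IsIso.inv_hom_id, Category.comp_id] at h2
    rw [← h1, h2]
  refine ⟨c, hX.isIso_of_ne_zero hX fun h => h0 ?_, hce⟩
  rw [← hce, h]
  exact zero_comp

/-- If each simple object carries two independent forms, the Witt group is elementary abelian on
the classes of the simple objects. -/
theorem nonempty_addEquiv_zmod (hnm : -n - m = m) {r : ℕ}
    {X : Fin r → CochainComplex (ModuleCat.{u} A) ℤ} (hX : ∀ j, IsStalk (X j) m)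
    (hex : ∀ K, IsStalk K m → ∃ j, ∃ f : (toK A).obj (X j) ⟶ (toK A).obj K, IsIso f)
    (hne : ∀ i j, i ≠ j → ∀ f : (toK A).obj (X i) ⟶ (toK A).obj (X j), f = 0)
    (h : ∀ K, IsStalk K m → ∃ e e₁ : (toK A).obj K ⟶ (toK A).obj (dualComplex σ n K),
      IsIso e ∧ transposeK σ n e = e ∧ transposeK σ n e₁ = e₁ ∧ ∀ c : ℝ, e₁ ≠ c • e) :
    Nonempty (WittGroup σ n ≃+ (Fin r → ZMod 2)) := by
  choose e e₁ hi he he₁ hind using fun j => h _ (hX j)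
  choose μ hμe hμ using fun j =>
    exists_symmetric_functional ((hX j).ne_zero_of_isIso (e j)) (he j)
  have hall : ∀ j (e' : (toK A).obj (X j) ⟶ (toK A).obj (dualComplex σ n (X j)))
      (he' : transposeK σ n e' = e') (hi' : IsIso e'),
      (ofK (X j) (hX j).isPerf e' he' hi').wittClass =
        (ofK (X j) (hX j).isPerf (e j) (he j) (hi j)).wittClass := fun j e' he' hi' => by
    obtain ⟨c, hc, h⟩ := exists_comp_dualK_eq (hX j) (hi j) (he j) (he₁ j) (hind j) he'
      ((hX j).ne_zero_of_isIso e')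
    exact wittClass_ofK_eq c hc h
  refine nonempty_addEquiv_of_separated_two
    (fun j => (ofK (X j) (hX j).isPerf (e j) (he j) (hi j)).wittClass) ?_ ?_
    (fun j => dimHom (hX j) (hi j) (he j) (hμe j) (hμ j)) ?_ ?_
  · refine closure_range_eq_top hnm hX hex _ fun j e' he' hi' => ?_
    rw [hall]
    exact AddSubgroup.subset_closure ⟨j, rfl⟩
  · intro j
    have he2 : transposeK σ n (-e j) = -e j := by
      rw [← neg_one_smul ℝ (e j), transposeK_smul, he]
    have hi2 : IsIso (-e j) := ⟨-inv (e j), by simp, by simp⟩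
    rw [← eq_neg_iff_add_eq_zero, ← wittClass_ofK_neg (he' := he2) (hi' := hi2) rfl, hall j _ he2]
  · intro i j hij
    rw [dimHom_wittClass]
    have : Subsingleton ((toK A).obj (X i) ⟶
        (toK A).obj (ofK (X j) (hX j).isPerf (e j) (he j) (hi j)).K) :=
      ⟨fun f g => (hne i j hij f).trans (hne i j hij g).symm⟩
    exact (congrArg _ Module.finrank_zero_of_subsingleton).trans Nat.cast_zero
  · intro i
    rw [dimHom_wittClass]
    have := (hX i).finite_hom (hX i).isPerf
    have : Nontrivial ((toK A).obj (X i) ⟶ (toK A).obj (X i)) :=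
      ⟨𝟙 ((toK A).obj (X i)), 0, (hX i).id_ne_zero⟩
    have hpos : 0 < Module.finrank ℝ ((toK A).obj (X i) ⟶ (toK A).obj (X i)) :=
      Module.finrank_pos
    change ((Module.finrank ℝ ((toK A).obj (X i) ⟶ (toK A).obj (X i)) : ℕ) :
      ZMod (2 * Module.finrank ℝ ((toK A).obj (X i) ⟶ (toK A).obj (X i)))) ≠ 0
    rw [Ne, ZMod.natCast_eq_zero_iff]
    intro hd
    have := Nat.le_of_dvd hpos hd
    omega

end SymSpace

end Classification

/-! ### Real sesquilinear forms on simple modules -/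

section RealForms

open CategoryTheory CategoryTheory.Limits CategoryTheory.Pretriangulated

variable {A : Type u} [Ring A]

variable {σ : RingInvo A} {n m : ℤ} {X : CochainComplex (ModuleCat.{u} A) ℤ}

/-- The value of a chain map `X → X^#` as a pairing on the term of degree `m`. -/
def chainPair (hnm : -n - m = m) (φ : X ⟶ dualComplex σ n X) (x y : X.X m) : A :=
  (show HermDual σ (X.X (-n - m)) from (φ.f m).hom x) ((X.XIsoOfEq hnm.symm).hom.hom y)

lemma chainPair_add_left (hnm : -n - m = m) (φ : X ⟶ dualComplex σ n X) (x x' y : X.X m) :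
    chainPair hnm φ (x + x') y = chainPair hnm φ x y + chainPair hnm φ x' y := by
  simp only [chainPair, map_add]
  rfl

lemma chainPair_smul_left (hnm : -n - m = m) (φ : X ⟶ dualComplex σ n X) (a : A) (x y : X.X m) :
    chainPair hnm φ (a • x) y = chainPair hnm φ x y * (σ a).unop := by
  simp only [chainPair, map_smul]
  rfl

lemma chainPair_smul_right (hnm : -n - m = m) (φ : X ⟶ dualComplex σ n X) (a : A) (x y : X.X m) :
    chainPair hnm φ x (a • y) = a * chainPair hnm φ x y := by
  simp only [chainPair, map_smul]
  exact HermDual.apply_smul _ _ _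

lemma chainPair_transpose (hnm : -n - m = m) (φ : X ⟶ dualComplex σ n X) (x y : X.X m) :
    chainPair hnm (doubleDual σ n X ≫ dualMap σ n φ) x y =
      (n * (n + 1) / 2).negOnePow • (σ (chainPair hnm φ y x)).unop := by
  have key : ∀ (k l : ℤ) (hk : m = k) (hl : m = -n - k) (hl' : k = -n - m),
      (σ ((show HermDual σ (X.X (-n - k)) from
        (φ.f k).hom ((X.XIsoOfEq hk).hom.hom y)) ((X.XIsoOfEq hl).hom.hom x))).unop =
      (σ (chainPair hnm φ y x)).unop := by
    rintro k l rfl hl hl'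
    rfl
  rw [← key (-n - m) m hnm.symm (by omega) rfl]
  change (((n * (n + 1) / 2).negOnePow • ((X.XIsoOfEq (show m = -n - (-n - m) by omega)).hom ≫
    hermEval σ (X.X (-n - (-n - m))))).hom x : HermDual σ (HermDual σ (X.X (-n - (-n - m)))))
    (show HermDual σ (X.X (-n - (-n - m))) from
      (φ.f (-n - m)).hom ((X.XIsoOfEq hnm.symm).hom.hom y)) = _
  rcases Int.units_eq_one_or (n * (n + 1) / 2).negOnePow with h | h
  · rw [h, one_smul, one_smul]; rfl
  · rw [h, Units.neg_smul, one_smul, Units.neg_smul, one_smul]; rfl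

lemma chainPair_ext (hnm : -n - m = m) (hX : IsStalk X m) {φ ψ : X ⟶ dualComplex σ n X}
    (h : ∀ x y, chainPair hnm φ x y = chainPair hnm ψ x y) : φ = ψ := by
  refine hX.hom_ext_from (ModuleCat.hom_ext (LinearMap.ext fun x => ?_))
  refine HermDual.ext (σ := σ) fun y => ?_
  obtain ⟨y, rfl⟩ := XIsoOfEq_hom_surjective X hnm.symm y
  exact h x y

/-- A pairing that is linear on the right and `σ`-semilinear on the left comes from a chain map. -/
lemma exists_chainPair_eq (hnm : -n - m = m) (hX : IsStalk X m) (h : X.X m → X.X m → A)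
    (h1 : ∀ x x' y, h (x + x') y = h x y + h x' y) (h2 : ∀ a x y, h (a • x) y = h x y * (σ a).unop)
    (h3 : ∀ x y y', h x (y + y') = h x y + h x y') (h4 : ∀ a x y, h x (a • y) = a * h x y) :
    ∃ φ : X ⟶ dualComplex σ n X, ∀ x y, chainPair hnm φ x y = h x y := by
  let g (x : X.X m) : HermDual σ (X.X (-n - m)) :=
    ({ toFun := fun y => h x ((X.XIsoOfEq hnm.symm).inv.hom y)
       map_add' := fun y y' => by rw [map_add, h3]
       map_smul' := fun a y => by rw [map_smul, h4]; rfl } : X.X (-n - m) →ₗ[A] A)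
  let f : X.X m ⟶ (dualComplex σ n X).X m := ModuleCat.ofHom (X := X.X m)
    (Y := HermDual σ (X.X (-n - m)))
    { toFun := g
      map_add' := fun x x' => HermDual.ext fun y => h1 _ _ _
      map_smul' := fun a x => HermDual.ext fun y => h2 _ _ _ }
  refine ⟨hX.mkHomFrom f (by rw [hX.zeroDiff.dual n, comp_zero]), fun x y => ?_⟩
  have : (hX.mkHomFrom f (by rw [hX.zeroDiff.dual n, comp_zero])).f m = f := hX.mkHomFrom_f f _
  rw [chainPair, this]
  change h x ((X.XIsoOfEq hnm.symm).inv.hom ((X.XIsoOfEq hnm.symm).hom.hom y)) = h x y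
  rw [← ModuleCat.comp_apply, Iso.hom_inv_id]
  rfl

namespace SymSpace

lemma exists_chain_rep (hX : ZeroDiff X) {e : (toK A).obj X ⟶ (toK A).obj (dualComplex σ n X)}
    (he : transposeK σ n e = e) : ∃ φ : X ⟶ dualComplex σ n X, (toK A).map φ = e ∧
      doubleDual σ n X ≫ dualMap σ n φ = φ := by
  obtain ⟨φ, rfl⟩ := (toK A).map_surjective e
  refine ⟨φ, rfl, hX.map_injective (hX.dual n) ?_⟩
  rw [transposeK, dualK_map, ← Functor.map_comp] at he
  exact he

lemma transposeK_map_eq {φ : X ⟶ dualComplex σ n X}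
    (h : doubleDual σ n X ≫ dualMap σ n φ = φ) :
    transposeK σ n ((toK A).map φ) = (toK A).map φ := by
  rw [transposeK, dualK_map, ← Functor.map_comp, h]

variable {r : ℕ} (S : Fin r → ModuleCat.{u} A)

/-- The simple modules, as complexes in degree `m`. -/
noncomputable abbrev stalks (m : ℤ) (j : Fin r) : CochainComplex (ModuleCat.{u} A) ℤ :=
  (HomologicalComplex.single (ModuleCat.{u} A) (ComplexShape.up ℤ) m).obj (S j)

variable {S}

lemma exists_iso_stalks (hS : ∀ j, IsSimpleModule A (S j))
    (hex : ∀ (M : Type u) [AddCommGroup M] [Module A M] [IsSimpleModule A M],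
      ∃ j, Nonempty (S j ≃ₗ[A] M)) (K : CochainComplex (ModuleCat.{u} A) ℤ) (hK : IsStalk K m) :
    ∃ j, ∃ f : (toK A).obj (stalks S m j) ⟶ (toK A).obj K, IsIso f := by
  have := hK.simple
  obtain ⟨j, ⟨e⟩⟩ := hex (K.X m)
  have := hS j
  exact ⟨j, (isStalk_single m (S j)).exists_iso hK
    ((HomologicalComplex.singleObjXSelf (ComplexShape.up ℤ) m (S j)).toLinearEquiv.trans e)⟩

lemma stalks_hom_eq_zero [IsSemisimpleRing A] (hS : ∀ j, IsSimpleModule A (S j))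
    (hne : ∀ i j, i ≠ j → IsEmpty (S i ≃ₗ[A] S j)) (i j : Fin r) (hij : i ≠ j)
    (f : (toK A).obj (stalks S m i) ⟶ (toK A).obj (stalks S m j)) : f = 0 := by
  by_contra hf
  have := hS i
  have := hS j
  obtain ⟨e⟩ := (isStalk_single m (S i)).nonempty_linearEquiv (isStalk_single m (S j)) f
    ((isStalk_single m (S i)).isIso_of_ne_zero (isStalk_single m (S j)) hf)
  exact (hne i j hij).false
    ((HomologicalComplex.singleObjXSelf (ComplexShape.up ℤ) m (S i)).toLinearEquiv.symm.trans
      (e.trans (HomologicalComplex.singleObjXSelf (ComplexShape.up ℤ) m (S j)).toLinearEquiv))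

end SymSpace

variable [Algebra ℝ A]

/-- The real bilinear forms on an `A`-module for which the adjoint of `a` is `σ a`, and which are
`ε`-symmetric. The real structure of the module is the one given by `ℝ → A`. -/
def epsForms (σ : RingInvo A) (ε : ℝ) (M : Type*) [AddCommGroup M] [Module A M] :
    Submodule ℝ (M → M → ℝ) where
  carrier := {β | (∀ x x' y, β (x + x') y = β x y + β x' y) ∧
    (∀ (r : ℝ) x y, β (algebraMap ℝ A r • x) y = r * β x y) ∧
    (∀ a x y, β (a • x) y = β x ((σ a).unop • y)) ∧ ∀ x y, β y x = ε * β x y}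
  zero_mem' := by simp
  add_mem' := by
    rintro β β' ⟨h1, h2, h3, h4⟩ ⟨h1', h2', h3', h4'⟩
    refine ⟨fun x x' y => ?_, fun r x y => ?_, fun a x y => ?_, fun x y => ?_⟩
    · simp only [Pi.add_apply, h1, h1']; ring
    · simp only [Pi.add_apply, h2, h2']; ring
    · simp only [Pi.add_apply, h3, h3']
    · simp only [Pi.add_apply, h4 x y, h4' x y]; ring
  smul_mem' := by
    rintro c β ⟨h1, h2, h3, h4⟩
    refine ⟨fun x x' y => ?_, fun r x y => ?_, fun a x y => ?_, fun x y => ?_⟩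
    · simp only [Pi.smul_apply, smul_eq_mul, h1]; ring
    · simp only [Pi.smul_apply, smul_eq_mul, h2]; ring
    · simp only [Pi.smul_apply, smul_eq_mul, h3]
    · simp only [Pi.smul_apply, smul_eq_mul, h4 x y]; ring

/-- A nondegenerate trace on a real algebra with involution. -/
structure IsInvTrace (σ : RingInvo A) (lam : A →ₗ[ℝ] ℝ) : Prop where
  mul_comm : ∀ a b, lam (a * b) = lam (b * a)
  invo : ∀ a, lam (σ a).unop = lam a
  eq_zero : ∀ a, (∀ b, lam (b * a) = 0) → a = 0

variable {lam : A →ₗ[ℝ] ℝ}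

/-- Every form on `X` whose pairing is nonzero is an isomorphism. -/
lemma isIso_of_chainPair_ne_zero [σ.IsReal] [IsSemisimpleRing A] [Module.Finite ℝ A]
    (hlam : IsInvTrace σ lam) (hnm : -n - m = m) (hX : IsStalk X m)
    {φ : X ⟶ dualComplex σ n X} (h0 : φ ≠ 0) : IsIso φ := by
  have hsimple := hX.simple
  have hfin := hX.isPerf.finite m
  let : Module ℝ (X.X m) := Module.compHom _ (algebraMap ℝ A)
  have : IsScalarTower ℝ A (X.X m) := ⟨fun r a x => by
    rw [Algebra.smul_def, mul_smul]; rfl⟩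
  have : Module.Finite ℝ (X.X m) := Module.Finite.trans A _
  have hinj : Function.Injective (φ.f m).hom := LinearMap.injective_of_ne_zero fun h =>
    h0 (hX.hom_ext_from (ModuleCat.hom_ext h))
  -- a functional on `X` with values in `A` is determined by its trace
  have hsep : ∀ f g : HermDual σ (X.X (-n - m)),
      (∀ y : X.X m, lam (f ((X.XIsoOfEq hnm.symm).hom.hom y)) =
        lam (g ((X.XIsoOfEq hnm.symm).hom.hom y))) → f = g := fun f g h => by
    refine HermDual.ext fun y => ?_
    obtain ⟨y, rfl⟩ := XIsoOfEq_hom_surjective X hnm.symm y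
    rw [← sub_eq_zero]
    refine hlam.eq_zero _ fun b => ?_
    have := h (b • y)
    rw [map_smul, HermDual.apply_smul, HermDual.apply_smul] at this
    rw [mul_sub, map_sub, this, sub_self]
  let B (f : HermDual σ (X.X (-n - m))) : Module.Dual ℝ (X.X m) :=
    { toFun := fun y => lam (f ((X.XIsoOfEq hnm.symm).hom.hom y))
      map_add' := fun y y' => by rw [map_add, HermDual.apply_add, map_add]
      map_smul' := fun r y => by
        change lam (f ((X.XIsoOfEq hnm.symm).hom.hom (algebraMap ℝ A r • y))) = _
        rw [map_smul, HermDual.apply_smul, ← Algebra.smul_def, map_smul]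
        rfl }
  let L : X.X m →ₗ[ℝ] Module.Dual ℝ (X.X m) :=
    { toFun := fun x => B ((φ.f m).hom x)
      map_add' := fun x x' => LinearMap.ext fun y => by
        change lam (chainPair hnm φ (x + x') y) = lam (chainPair hnm φ x y) +
          lam (chainPair hnm φ x' y)
        rw [chainPair_add_left, map_add]
      map_smul' := fun r x => LinearMap.ext fun y => by
        change lam (chainPair hnm φ (algebraMap ℝ A r • x) y) = r * lam (chainPair hnm φ x y)
        rw [chainPair_smul_left, RingInvo.IsReal.apply_algebraMap, ← Algebra.commutes,
          ← Algebra.smul_def, map_smul, smul_eq_mul] }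
  have hB : Function.Injective B := fun f g h => hsep f g fun y => LinearMap.congr_fun h y
  have hL : Function.Injective L := fun x x' h => hinj (hB h)
  have hL' : Function.Surjective L := (LinearMap.injective_iff_surjective_of_finrank_eq_finrank
    Subspace.dual_finrank_eq.symm).1 hL
  have hbij : Function.Bijective (φ.f m).hom := ⟨hinj, fun f => by
    obtain ⟨x, hx⟩ := hL' (B f)
    exact ⟨x, hB hx⟩⟩
  have : ∀ i, IsIso (φ.f i) := fun i => by
    by_cases hi : i = m
    · subst hi
      exact ModuleCat.isIso_of_bijective _ hbij
    · have h1 := ModuleCat.subsingleton_of_isZero (hX.isZero i hi)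
      have h2 := ModuleCat.subsingleton_of_isZero (hX.isZero (-n - i) (by omega))
      refine ModuleCat.isIso_of_bijective _ ⟨fun x y _ => Subsingleton.elim x y, fun f => ⟨0, ?_⟩⟩
      refine HermDual.ext (σ := σ) fun y => ?_
      have h0 : ∀ g : HermDual σ (X.X (-n - i)), g y = 0 := fun g => by
        rw [Subsingleton.elim y 0]
        simpa using g.apply_smul 0 0
      exact (h0 _).trans (h0 _).symm
  exact HomologicalComplex.Hom.isIso_of_components φ

/-- The symmetric forms on `X`, as chain maps, are the real `ε`-symmetric forms on its term. -/
lemma chainPair_mem_epsForms [σ.IsReal] (hlam : IsInvTrace σ lam) (hnm : -n - m = m)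
    {φ : X ⟶ dualComplex σ n X} (hφ : doubleDual σ n X ≫ dualMap σ n φ = φ) {ε : ℝ}
    (hε : ε = (((n * (n + 1) / 2).negOnePow : ℤ) : ℝ)) :
    (fun x y => lam (chainPair hnm φ x y)) ∈ epsForms σ ε (X.X m) := by
  refine ⟨fun x x' y => ?_, fun r x y => ?_, fun a x y => ?_, fun x y => ?_⟩
  · simp only [chainPair_add_left, map_add]
  · simp only [chainPair_smul_left]
    rw [RingInvo.IsReal.apply_algebraMap, ← Algebra.commutes, ← Algebra.smul_def, map_smul,
      smul_eq_mul]
  · simp only [chainPair_smul_left, chainPair_smul_right]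
    exact hlam.mul_comm _ _
  · have h := chainPair_transpose hnm φ y x
    rw [hφ] at h
    change lam (chainPair hnm φ y x) = ε * lam (chainPair hnm φ x y)
    rw [h, hε]
    rcases Int.units_eq_one_or (n * (n + 1) / 2).negOnePow with h | h
    · rw [h, one_smul, hlam.invo]; simp
    · rw [h, Units.neg_smul, one_smul, map_neg, hlam.invo]; simp

lemma eq_of_lam_chainPair_eq (hlam : IsInvTrace σ lam) (hnm : -n - m = m) (hX : IsStalk X m)
    {φ ψ : X ⟶ dualComplex σ n X}
    (h : ∀ x y, lam (chainPair hnm φ x y) = lam (chainPair hnm ψ x y)) : φ = ψ := by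
  refine chainPair_ext hnm hX fun x y => ?_
  rw [← sub_eq_zero]
  refine hlam.eq_zero _ fun b => ?_
  have := h x (b • y)
  rw [chainPair_smul_right, chainPair_smul_right] at this
  rw [mul_sub, map_sub, this, sub_self]

lemma exists_lam_chainPair_eq [Module.Finite ℝ A] (hlam : IsInvTrace σ lam)
    (hnm : -n - m = m) (hX : IsStalk X m) {ε : ℝ}
    (hε : ε = (((n * (n + 1) / 2).negOnePow : ℤ) : ℝ)) {β : X.X m → X.X m → ℝ}
    (hβ : β ∈ epsForms σ ε (X.X m)) :
    ∃ φ : X ⟶ dualComplex σ n X, doubleDual σ n X ≫ dualMap σ n φ = φ ∧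
      ∀ x y, lam (chainPair hnm φ x y) = β x y := by
  obtain ⟨b1, b2, b3, b4⟩ := hβ
  have hε2 : ε * ε = 1 := by
    rw [hε]
    rcases Int.units_eq_one_or (n * (n + 1) / 2).negOnePow with h | h <;> simp [h]
  have b1' : ∀ x y y', β x (y + y') = β x y + β x y' := fun x y y' => by
    rw [b4 (y + y'), b1, b4 y x, b4 y' x]
    ring
  have b2' : ∀ (r : ℝ) x y, β x (algebraMap ℝ A r • y) = r * β x y := fun r x y => by
    rw [b4 (algebraMap ℝ A r • y), b2, b4 y x]
    ring
  have hsep : ∀ a b : A, (∀ c, lam (c * a) = lam (c * b)) → a = b := fun a b h => by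
    rw [← sub_eq_zero]
    refine hlam.eq_zero _ fun c => ?_
    rw [mul_sub, map_sub, h, sub_self]
  -- every real functional on `A` is a multiple of the trace
  have hrep : ∀ f : Module.Dual ℝ A, ∃ b, ∀ c, lam (c * b) = f c := fun f => by
    let T : A →ₗ[ℝ] Module.Dual ℝ A := (LinearMap.mul ℝ A).flip.compr₂ lam
    have hT : Function.Injective T := fun a b h => hsep a b fun c => LinearMap.congr_fun h c
    obtain ⟨b, hb⟩ := (LinearMap.injective_iff_surjective_of_finrank_eq_finrank
      Subspace.dual_finrank_eq.symm).1 hT f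
    exact ⟨b, fun c => LinearMap.congr_fun hb c⟩
  have hex : ∀ x y, ∃ b, ∀ c, lam (c * b) = β x (c • y) := fun x y => hrep
    { toFun := fun c => β x (c • y)
      map_add' := fun c c' => by rw [add_smul, b1']
      map_smul' := fun r c => by
        rw [Algebra.smul_def, mul_smul, b2']; rfl }
  choose h hh using hex
  obtain ⟨φ, hφ⟩ := exists_chainPair_eq (σ := σ) hnm hX h
    (fun x x' y => hsep _ _ fun c => by rw [mul_add, map_add, hh, hh, hh, b1])
    (fun a x y => hsep _ _ fun c => by
      rw [hh, b3, ← mul_smul, ← hh, ← mul_assoc, hlam.mul_comm (c * _), ← mul_assoc])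
    (fun x y y' => hsep _ _ fun c => by rw [mul_add, map_add, hh, hh, hh, smul_add, b1'])
    (fun a x y => hsep _ _ fun c => by rw [hh, ← mul_assoc, hh, mul_smul])
  have hφβ : ∀ x y, lam (chainPair hnm φ x y) = β x y := fun x y => by
    rw [hφ, ← one_mul (h x y), hh, one_smul]
  refine ⟨φ, eq_of_lam_chainPair_eq hlam hnm hX fun x y => ?_, hφβ⟩
  rw [chainPair_transpose, hφβ]
  have e : ∀ e : ℤˣ, lam (e • (σ (chainPair hnm φ y x)).unop) = ((e : ℤ) : ℝ) * β y x := fun e => by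
    rcases Int.units_eq_one_or e with h | h
    · rw [h, one_smul, hlam.invo, hφβ]; simp
    · rw [h, Units.neg_smul, one_smul, map_neg, hlam.invo, hφβ]; simp
  rw [e, ← hε, ← b4]

namespace SymSpace

variable [σ.IsReal] [IsSemisimpleRing A]

/-- If the simple modules carry no `ε`-symmetric forms, the Witt group vanishes. -/
theorem subsingleton_wittGroup_of_epsForms (hlam : IsInvTrace σ lam) (hnm : -n - m = m)
    {ε : ℝ} (hε : ε = (((n * (n + 1) / 2).negOnePow : ℤ) : ℝ))
    (h : ∀ (M : Type u) [AddCommGroup M] [Module A M] [IsSimpleModule A M],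
      epsForms σ ε M = ⊥) : Subsingleton (WittGroup σ n) := by
  refine subsingleton_wittGroup_of_forall_eq_zero hnm fun K hK e he => ?_
  obtain ⟨φ, rfl, hφ⟩ := exists_chain_rep hK.zeroDiff he
  have := hK.simple
  have hmem := chainPair_mem_epsForms hlam hnm hφ hε
  rw [h, Submodule.mem_bot] at hmem
  have : φ = 0 := eq_of_lam_chainPair_eq hlam hnm hK fun x y => by
    refine (congrFun (congrFun hmem x) y).trans ?_
    exact (map_zero lam).symm
  rw [this, Functor.map_zero]

variable [Module.Finite ℝ A]

/-- If the `ε`-symmetric forms on each simple module are unique up to scalars, the Witt group is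
free on the simple modules. -/
theorem nonempty_addEquiv_int_of_epsForms {r : ℕ} {S : Fin r → ModuleCat.{u} A}
    (hlam : IsInvTrace σ lam) (hnm : -n - m = m)
    {ε : ℝ} (hε : ε = (((n * (n + 1) / 2).negOnePow : ℤ) : ℝ))
    (hS : ∀ j, IsSimpleModule A (S j))
    (hex : ∀ (M : Type u) [AddCommGroup M] [Module A M] [IsSimpleModule A M],
      ∃ j, Nonempty (S j ≃ₗ[A] M))
    (hne : ∀ i j, i ≠ j → IsEmpty (S i ≃ₗ[A] S j))
    (h : ∀ (M : Type u) [AddCommGroup M] [Module A M] [IsSimpleModule A M],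
      Module.finrank ℝ (epsForms σ ε M) = 1) : Nonempty (WittGroup σ n ≃+ (Fin r → ℤ)) := by
  refine nonempty_addEquiv_int hnm (X := stalks S m)
    (fun j => have := hS j; isStalk_single m (S j)) (exists_iso_stalks hS hex)
    (stalks_hom_eq_zero hS hne) fun K hK => ?_
  have := hK.simple
  obtain ⟨⟨β, hβ⟩, hβ0, hβs⟩ := finrank_eq_one_iff'.1 (h (K.X m))
  obtain ⟨φ, hφ, hφβ⟩ := exists_lam_chainPair_eq hlam hnm hK hε hβ
  have hφ0 : φ ≠ 0 := fun h0 => hβ0 (Subtype.ext (funext fun x => funext fun y =>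
    (hφβ x y).symm.trans (by rw [h0]; exact map_zero lam)))
  have := isIso_of_chainPair_ne_zero hlam hnm hK hφ0
  refine ⟨(toK A).map φ, inferInstance, transposeK_map_eq hφ, fun e' he' => ?_⟩
  obtain ⟨ψ, rfl, hψ⟩ := exists_chain_rep hK.zeroDiff he'
  obtain ⟨c, hc⟩ := hβs ⟨_, chainPair_mem_epsForms hlam hnm hψ hε⟩
  refine ⟨c, ?_⟩
  rw [← (toK A).map_smul]
  congr 1
  refine eq_of_lam_chainPair_eq hlam hnm hK fun x y => ?_
  have h1 : c * β x y = lam (chainPair hnm ψ x y) :=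
    congrFun (congrFun (congrArg Subtype.val hc) x) y
  rw [← h1, ← hφβ, ← smul_eq_mul, ← map_smul, Algebra.smul_def]
  have h2 : chainPair hnm (c • φ) x y = chainPair hnm φ (algebraMap ℝ A c • x) y := by
    rw [chainPair, chainPair, map_smul]
    rfl
  rw [h2, chainPair_smul_left, RingInvo.IsReal.apply_algebraMap, Algebra.commutes]

/-- If each simple module carries independent `ε`-symmetric forms, the Witt group is elementary
abelian on the simple modules. -/
theorem nonempty_addEquiv_zmod_of_epsForms {r : ℕ} {S : Fin r → ModuleCat.{u} A}
    (hlam : IsInvTrace σ lam) (hnm : -n - m = m)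
    {ε : ℝ} (hε : ε = (((n * (n + 1) / 2).negOnePow : ℤ) : ℝ))
    (hS : ∀ j, IsSimpleModule A (S j))
    (hex : ∀ (M : Type u) [AddCommGroup M] [Module A M] [IsSimpleModule A M],
      ∃ j, Nonempty (S j ≃ₗ[A] M))
    (hne : ∀ i j, i ≠ j → IsEmpty (S i ≃ₗ[A] S j))
    (h : ∀ (M : Type u) [AddCommGroup M] [Module A M] [IsSimpleModule A M],
      1 < Module.finrank ℝ (epsForms σ ε M)) : Nonempty (WittGroup σ n ≃+ (Fin r → ZMod 2)) := by
  refine nonempty_addEquiv_zmod hnm (X := stalks S m)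
    (fun j => have := hS j; isStalk_single m (S j)) (exists_iso_stalks hS hex)
    (stalks_hom_eq_zero hS hne) fun K hK => ?_
  have := hK.simple
  have hfin := Module.finite_of_finrank_pos (zero_lt_one.trans (h (K.X m)))
  have : Nontrivial (epsForms σ ε (K.X m)) :=
    Module.nontrivial_of_finrank_pos (R := ℝ) (zero_lt_one.trans (h (K.X m)))
  obtain ⟨⟨β, hβ⟩, hβ0⟩ := exists_ne (0 : epsForms σ ε (K.X m))
  obtain ⟨⟨β₁, hβ₁⟩, hβ₁0⟩ := exists_linearIndependent_pair_of_one_lt_finrank (h (K.X m)) hβ0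
  rw [LinearIndependent.pair_iff' hβ0] at hβ₁0
  obtain ⟨φ, hφ, hφβ⟩ := exists_lam_chainPair_eq hlam hnm hK hε hβ
  obtain ⟨ψ, hψ, hψβ⟩ := exists_lam_chainPair_eq hlam hnm hK hε hβ₁
  have hφ0 : φ ≠ 0 := fun h0 => hβ0 (Subtype.ext (funext fun x => funext fun y =>
    (hφβ x y).symm.trans (by rw [h0]; exact map_zero lam)))
  have := isIso_of_chainPair_ne_zero hlam hnm hK hφ0
  refine ⟨(toK A).map φ, (toK A).map ψ, inferInstance, transposeK_map_eq hφ,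
    transposeK_map_eq hψ, fun c hc => hβ₁0 c (Subtype.ext (funext fun x => funext fun y => ?_))⟩
  rw [← (toK A).map_smul] at hc
  have hc := hK.zeroDiff.map_injective (hK.zeroDiff.dual n) hc
  have h2 : chainPair hnm (c • φ) x y = chainPair hnm φ (algebraMap ℝ A c • x) y := by
    rw [chainPair, chainPair, map_smul]
    rfl
  change c * β x y = β₁ x y
  rw [← hψβ, hc, h2, chainPair_smul_left, RingInvo.IsReal.apply_algebraMap, ← Algebra.commutes,
    ← Algebra.smul_def, map_smul, hφβ, smul_eq_mul]

end SymSpace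

end RealForms

/-! ### Monomials in anticommuting generators -/

section Monomials

variable {A : Type u} [Ring A] [Algebra ℝ A]

/-- Pairwise anticommuting elements with square `s`. -/
structure IsAnticommuting (s : ℝ) {m : ℕ} (g : Fin m → A) : Prop where
  sq : ∀ j, g j * g j = algebraMap ℝ A s
  anti : ∀ i j, i ≠ j → g i * g j = -(g j * g i)

/-- The product of the generators selected by `v`, in increasing order. -/
def cliffMon : {m : ℕ} → (Fin m → A) → (Fin m → Bool) → A
  | 0, _, _ => 1
  | _ + 1, g, v => (if v 0 then g 0 else 1) * cliffMon (Fin.tail g) (Fin.tail v)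

/-- The degree of a monomial. -/
def monDeg : {m : ℕ} → (Fin m → Bool) → ℕ
  | 0, _ => 0
  | _ + 1, v => monDeg (Fin.tail v) + (if v 0 then 1 else 0)

/-- The sign `t^k (-1)^{k(k-1)/2}`: the effect on a monomial of degree `k` of the
anti-automorphism multiplying the generators by `t`, and also the square of the monomial
if the generators have square `t`. -/
def revSign (t : ℝ) : ℕ → ℝ
  | 0 => 1
  | k + 1 => t * (-1) ^ k * revSign t k

/-- The sum of the signs of all monomials in `m` generators. -/
def signSum (t : ℝ) (m : ℕ) : ℝ := ∑ v : Fin m → Bool, revSign t (monDeg v)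

lemma sum_cons {Y : Type*} [AddCommMonoid Y] {m : ℕ} (F : (Fin (m + 1) → Bool) → Y) :
    ∑ v, F v = ∑ v : Fin m → Bool, (F (Fin.cons false v) + F (Fin.cons true v)) := by
  rw [← (Fin.consEquiv fun _ => Bool).sum_comp, Fintype.sum_prod_type]
  simp only [Fintype.sum_bool]
  rw [add_comm, ← Finset.sum_add_distrib]
  rfl

@[simp] lemma monDeg_cons_false {m : ℕ} (v : Fin m → Bool) :
    monDeg (Fin.cons false v : Fin (m + 1) → Bool) = monDeg v := by
  simp [monDeg]

@[simp] lemma monDeg_cons_true {m : ℕ} (v : Fin m → Bool) :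
    monDeg (Fin.cons true v : Fin (m + 1) → Bool) = monDeg v + 1 := by
  simp [monDeg]

lemma neg_one_pow_mul_self (k : ℕ) : (-1 : ℝ) ^ k * (-1) ^ k = 1 := by
  rw [← mul_pow]; norm_num

lemma revSign_neg (t : ℝ) (k : ℕ) : revSign (-t) k = (-1) ^ k * revSign t k := by
  induction k with
  | zero => simp [revSign]
  | succ k ih => rw [revSign, revSign, ih, pow_succ]; ring

lemma revSign_succ (t : ℝ) (k : ℕ) : revSign t (k + 1) = t * revSign (-t) k := by
  rw [revSign_neg, revSign]; ring

lemma revSign_mul_self {t : ℝ} (ht : t * t = 1) (k : ℕ) : revSign t k * revSign t k = 1 := by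
  induction k with
  | zero => simp [revSign]
  | succ k ih =>
    rw [revSign]
    linear_combination (t * t) * (revSign t k * revSign t k) * neg_one_pow_mul_self k +
      (t * t) * ih + ht

lemma signSum_zero (t : ℝ) : signSum t 0 = 1 := by
  simp [signSum, monDeg, revSign]

lemma signSum_succ (t : ℝ) (m : ℕ) : signSum t (m + 1) = signSum t m + t * signSum (-t) m := by
  rw [signSum, sum_cons, Finset.sum_add_distrib, signSum, signSum, Finset.mul_sum]
  simp only [monDeg_cons_false, monDeg_cons_true, revSign_succ]

lemma signSum_add_eight {t : ℝ} (ht : t * t = 1) (m : ℕ) :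
    signSum t (m + 8) = 16 * signSum t m := by
  simp only [signSum_succ, neg_neg]
  rcases mul_self_eq_one_iff.1 ht with rfl | rfl <;> ring_nf

lemma signSum_add_mul_eight {t : ℝ} (ht : t * t = 1) (m k : ℕ) :
    signSum t (m + 8 * k) = 16 ^ k * signSum t m := by
  induction k with
  | zero => simp
  | succ k ih => rw [mul_add, mul_one, ← add_assoc, signSum_add_eight ht, ih]; ring

/-- Weighted sums of signs that arise when a monomial is moved past a generator. -/
lemma sum_revSign_mul {m : ℕ} (j : Fin m) :
    (∑ v : Fin m → Bool, revSign 1 (monDeg v) * (if v j then -1 else 1)) = -signSum (-1) m ∧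
    (∑ v : Fin m → Bool, revSign 1 (monDeg v) * ((-1) ^ monDeg v * if v j then -1 else 1)) =
      signSum 1 m := by
  have h1 : ∀ k, revSign 1 (k + 1) = (-1) ^ k * revSign 1 k := fun k => by
    rw [revSign_succ, one_mul, revSign_neg]
  induction m with
  | zero => exact j.elim0
  | succ m ih =>
    refine Fin.cases ?_ (fun j => ?_) j
    · rw [sum_cons, sum_cons, signSum_succ, signSum_succ, neg_neg]
      simp only [Fin.cons_zero, monDeg_cons_false, monDeg_cons_true, h1, Bool.false_eq_true,
        if_false, if_true, Finset.sum_add_distrib]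
      have e1 : ∑ v : Fin m → Bool, revSign 1 (monDeg v) = signSum 1 m := rfl
      have e2 : ∑ v : Fin m → Bool, (-1) ^ monDeg v * revSign 1 (monDeg v) = signSum (-1) m := by
        simp only [signSum, revSign_neg]
      constructor
      · simp only [mul_one, mul_neg, Finset.sum_neg_distrib, e1, e2]
        ring
      · have e3 : ∀ v : Fin m → Bool, (-1) ^ monDeg v * revSign 1 (monDeg v) *
            ((-1) ^ (monDeg v + 1) * -1) = revSign 1 (monDeg v) := fun v => by
          rw [pow_succ]
          linear_combination revSign 1 (monDeg v) * neg_one_pow_mul_self (monDeg v)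
        simp only [mul_one, e3, e1]
        simp only [mul_comm (revSign 1 _) _, e2]
        ring
    · obtain ⟨ih1, ih2⟩ := ih j
      rw [sum_cons, sum_cons, signSum_succ, signSum_succ, neg_neg]
      simp only [Fin.cons_succ, monDeg_cons_false, monDeg_cons_true, h1, Finset.sum_add_distrib]
      have e2 : ∑ v : Fin m → Bool, (-1) ^ monDeg v * revSign 1 (monDeg v) *
          (if v j then -1 else 1) = signSum 1 m := by
        rw [← ih2]
        exact Finset.sum_congr rfl fun v _ => by ring
      have e3 : ∑ v : Fin m → Bool, (-1) ^ monDeg v * revSign 1 (monDeg v) *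
          ((-1) ^ (monDeg v + 1) * if v j then -1 else 1) = signSum (-1) m := by
        rw [← neg_neg (signSum (-1) m), ← ih1, ← Finset.sum_neg_distrib]
        refine Finset.sum_congr rfl fun v _ => ?_
        rw [pow_succ]
        linear_combination (-revSign 1 (monDeg v) * (if v j then -1 else 1)) *
          neg_one_pow_mul_self (monDeg v)
      rw [ih1, ih2, e2, e3]
      constructor <;> ring

/-- An element that anticommutes with all generators. -/
lemma mul_cliffMon_of_anti {m : ℕ} {g : Fin m → A} {x : A} (h : ∀ j, x * g j = -(g j * x))
    (v : Fin m → Bool) : x * cliffMon g v = (-1 : ℝ) ^ monDeg v • (cliffMon g v * x) := by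
  induction m with
  | zero => simp [cliffMon, monDeg]
  | succ m ih =>
    have ih := ih (g := Fin.tail g) (fun j => h j.succ) (Fin.tail v)
    rw [cliffMon, monDeg]
    by_cases h0 : v 0
    · rw [if_pos h0, if_pos h0, ← mul_assoc, h 0, neg_mul, mul_assoc, ih, pow_succ,
        mul_smul_comm, mul_neg_one, neg_smul, mul_assoc]
    · rw [if_neg h0, if_neg h0, one_mul, ih, add_zero]

namespace IsAnticommuting

variable {s : ℝ} {m : ℕ}

lemma tail {g : Fin (m + 1) → A} (h : IsAnticommuting s g) : IsAnticommuting s (Fin.tail g) :=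
  ⟨fun j => h.sq j.succ, fun i j hij => h.anti i.succ j.succ (by simpa using hij)⟩

lemma zero_mul_cliffMon {g : Fin (m + 1) → A} (h : IsAnticommuting s g) (v : Fin m → Bool) :
    g 0 * cliffMon (Fin.tail g) v = (-1 : ℝ) ^ monDeg v • (cliffMon (Fin.tail g) v * g 0) :=
  mul_cliffMon_of_anti (fun j => h.anti 0 j.succ (Fin.succ_ne_zero j).symm) v

lemma cliffMon_mul_zero {g : Fin (m + 1) → A} (h : IsAnticommuting s g) (v : Fin m → Bool) :
    cliffMon (Fin.tail g) v * g 0 = (-1 : ℝ) ^ monDeg v • (g 0 * cliffMon (Fin.tail g) v) := by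
  rw [h.zero_mul_cliffMon, smul_smul, neg_one_pow_mul_self, one_smul]

lemma gen_mul_cliffMon {g : Fin m → A} (h : IsAnticommuting s g) (j : Fin m) (v : Fin m → Bool) :
    g j * cliffMon g v =
      ((-1 : ℝ) ^ monDeg v * if v j then -1 else 1) • (cliffMon g v * g j) := by
  induction m with
  | zero => exact j.elim0
  | succ m ih =>
    rw [cliffMon, monDeg]
    refine Fin.cases ?_ (fun j => ?_) j
    · by_cases h0 : v 0
      · rw [if_pos h0, if_pos h0, if_pos h0, mul_assoc (g 0) (cliffMon _ _), h.cliffMon_mul_zero,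
          mul_smul_comm, smul_smul, pow_succ]
        have : (-1 : ℝ) ^ monDeg (Fin.tail v) * -1 * -1 * (-1) ^ monDeg (Fin.tail v) = 1 := by
          linear_combination neg_one_pow_mul_self (monDeg (Fin.tail v))
        rw [this, one_smul]
      · rw [if_neg h0, if_neg h0, if_neg h0, one_mul, h.zero_mul_cliffMon, add_zero, mul_one]
    · have ih := ih h.tail j (Fin.tail v)
      rw [show g j.succ = Fin.tail g j from rfl]
      change _ = (_ * if Fin.tail v j then -1 else 1) • _
      by_cases h0 : v 0
      · rw [if_pos h0, if_pos h0, ← mul_assoc, show Fin.tail g j * g 0 = -(g 0 * Fin.tail g j) from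
          h.anti j.succ 0 (Fin.succ_ne_zero j), neg_mul, mul_assoc, ih, mul_smul_comm, mul_assoc,
          pow_add, ← neg_smul]
        congr 1
        ring
      · rw [if_neg h0, if_neg h0, one_mul, ih, add_zero]

lemma cliffMon_mul_self {g : Fin m → A} (h : IsAnticommuting s g) (v : Fin m → Bool) :
    cliffMon g v * cliffMon g v = algebraMap ℝ A (revSign s (monDeg v)) := by
  induction m with
  | zero => simp [cliffMon, monDeg, revSign]
  | succ m ih =>
    rw [cliffMon, monDeg]
    by_cases h0 : v 0
    · rw [if_pos h0, if_pos h0, mul_assoc, ← mul_assoc (cliffMon _ _), h.cliffMon_mul_zero,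
        smul_mul_assoc, mul_smul_comm, mul_assoc, ih h.tail, ← mul_assoc, h.sq, revSign,
        Algebra.smul_def, ← map_mul, ← map_mul]
      congr 1
      ring
    · rw [if_neg h0, if_neg h0, one_mul, ih h.tail, add_zero]

/-- Monomials multiply like elements of an elementary abelian group, up to sign. -/
lemma exists_cliffMon_mul_cliffMon (hs : s * s = 1) {g : Fin m → A} (h : IsAnticommuting s g)
    (v w : Fin m → Bool) : ∃ γ : ℝ, γ * γ = 1 ∧
      cliffMon g v * cliffMon g w = γ • cliffMon g (fun i => xor (v i) (w i)) := by
  induction m with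
  | zero => exact ⟨1, by simp, by simp [cliffMon]⟩
  | succ m ih =>
    obtain ⟨γ, hγ, hm⟩ := ih h.tail (Fin.tail v) (Fin.tail w)
    have htail : Fin.tail (fun i => xor (v i) (w i)) =
      fun i => xor (Fin.tail v i) (Fin.tail w i) := rfl
    have hk := neg_one_pow_mul_self (monDeg (Fin.tail v))
    simp only [cliffMon, htail]
    rcases Bool.eq_false_or_eq_true (v 0) with hv | hv <;>
      rcases Bool.eq_false_or_eq_true (w 0) with hw | hw
    · refine ⟨s * (-1) ^ monDeg (Fin.tail v) * γ, by
        linear_combination (s * s * γ * γ) * hk + (γ * γ) * hs + hγ, ?_⟩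
      simp only [hv, hw, if_true, Bool.xor_self, Bool.false_eq_true, if_false, one_mul]
      rw [mul_assoc, ← mul_assoc (cliffMon _ _), h.cliffMon_mul_zero, smul_mul_assoc,
        mul_smul_comm, mul_assoc, hm, ← mul_assoc, h.sq, mul_smul_comm, ← Algebra.smul_def,
        smul_smul, smul_smul]
      congr 1
      ring
    · refine ⟨γ, hγ, ?_⟩
      simp only [hv, hw, if_true, Bool.xor_false, Bool.false_eq_true, if_false, one_mul]
      rw [mul_assoc, hm, mul_smul_comm]
    · refine ⟨(-1) ^ monDeg (Fin.tail v) * γ, by linear_combination (γ * γ) * hk + hγ, ?_⟩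
      simp only [hv, hw, if_true, Bool.false_xor, Bool.false_eq_true, if_false, one_mul]
      rw [← mul_assoc, h.cliffMon_mul_zero, smul_mul_assoc, mul_assoc, hm, mul_smul_comm, smul_smul]
    · refine ⟨γ, hγ, ?_⟩
      simp only [hv, hw, Bool.xor_self, Bool.false_eq_true, if_false, one_mul]
      exact hm

/-- The effect on monomials of an involution acting by the sign `t` on the generators. -/
lemma invo_cliffMon {g : Fin m → A} (h : IsAnticommuting s g) (σ : RingInvo A) [σ.IsReal] {t : ℝ}
    (hσ : ∀ j, (σ (g j)).unop = t • g j) (v : Fin m → Bool) :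
    (σ (cliffMon g v)).unop = revSign t (monDeg v) • cliffMon g v := by
  induction m with
  | zero => simp [cliffMon, monDeg, revSign]
  | succ m ih =>
    have ih := ih h.tail (fun j => hσ j.succ) (Fin.tail v)
    rw [cliffMon, monDeg, map_mul, MulOpposite.unop_mul, ih]
    by_cases h0 : v 0
    · rw [if_pos h0, if_pos h0, hσ, revSign, mul_smul_comm, smul_mul_assoc,
        h.cliffMon_mul_zero, smul_smul, smul_smul]
      congr 1
      ring
    · rw [if_neg h0, if_neg h0, map_one, MulOpposite.unop_one, mul_one, one_mul, add_zero]

lemma hom_cliffMon {g : Fin m → A} (θ : A →ₐ[ℝ] A) (hθ : ∀ j, θ (g j) = -g j)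
    (v : Fin m → Bool) : θ (cliffMon g v) = (-1 : ℝ) ^ monDeg v • cliffMon g v := by
  induction m with
  | zero => simp [cliffMon, monDeg]
  | succ m ih =>
    have ih := ih (g := Fin.tail g) (fun j => hθ j.succ) (Fin.tail v)
    rw [cliffMon, monDeg, map_mul, ih]
    by_cases h0 : v 0
    · rw [if_pos h0, if_pos h0, hθ, pow_add, pow_one, mul_smul_comm, neg_mul, mul_neg_one,
        neg_smul, smul_neg]
    · rw [if_neg h0, if_neg h0, map_one, add_zero, one_mul, one_mul]

end IsAnticommuting

lemma monDeg_const_false (m : ℕ) : monDeg (fun _ : Fin m => false) = 0 := by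
  induction m with
  | zero => rfl
  | succ m ih => rw [monDeg, if_neg (by simp), add_zero]; exact ih

lemma monDeg_const_true (m : ℕ) : monDeg (fun _ : Fin m => true) = m := by
  induction m with
  | zero => rfl
  | succ m ih => rw [monDeg, if_pos rfl]; exact congrArg (· + 1) ih

omit [Algebra ℝ A] in
lemma cliffMon_const_false {m : ℕ} (g : Fin m → A) : cliffMon g (fun _ => false) = 1 := by
  induction m with
  | zero => rfl
  | succ m ih => rw [cliffMon, if_neg (by simp), one_mul]; exact ih _

end Monomials

/-! ### Averaging over an invertible frame -/

section Frame

open TensorProduct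

/-- A finite family `e` of units with inverses `u` such that `∑ uᵢ ⊗ eᵢ` is a Casimir element:
the features of a finite group in its group algebra that allow averaging. -/
structure IsFrame {A : Type*} [Ring A] [Algebra ℝ A] {ι : Type*} [Fintype ι] (e u : ι → A) :
    Prop where
  inv_mul : ∀ i, u i * e i = 1
  casimir : ∀ a, ∑ i, (a * u i) ⊗ₜ[ℝ] e i = ∑ i, u i ⊗ₜ[ℝ] (e i * a)

variable {A : Type*} [Ring A] [Algebra ℝ A] {ι : Type*} [Fintype ι] {e u : ι → A}
variable {M : Type*} [AddCommGroup M] [Module A M] [Module ℝ M] [IsScalarTower ℝ A M]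
variable {N : Type*} [AddCommGroup N] [Module A N] [Module ℝ N] [IsScalarTower ℝ A N]

/-- The trace of the action of `a` on the module `M`. -/
noncomputable def modTrace (M : Type*) [AddCommGroup M] [Module A M] [Module ℝ M]
    [IsScalarTower ℝ A M] : A →ₗ[ℝ] ℝ :=
  LinearMap.trace ℝ M ∘ₗ (Algebra.lsmul ℝ ℝ M : A →ₐ[ℝ] Module.End ℝ M).toLinearMap

lemma modTrace_mul_comm (a b : A) : modTrace M (a * b) = modTrace M (b * a) := by
  simp only [modTrace, LinearMap.comp_apply, AlgHom.toLinearMap_apply, map_mul]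
  exact LinearMap.trace_mul_comm _ _ _

lemma modTrace_one [Module.Finite ℝ M] : modTrace M (1 : A) = Module.finrank ℝ M := by
  simp only [modTrace, LinearMap.comp_apply, AlgHom.toLinearMap_apply, map_one]
  exact LinearMap.trace_one _ _

lemma modTrace_conj {a b : A} (h : b * a = 1) (x : A) :
    modTrace M (a * x * b) = modTrace M x := by
  rw [modTrace_mul_comm, ← mul_assoc, h, one_mul]

namespace IsFrame

lemma sum_eq (h : IsFrame e u) {V : Type*} [AddCommGroup V] [Module ℝ V]
    (B : A →ₗ[ℝ] A →ₗ[ℝ] V) (a : A) : ∑ i, B (a * u i) (e i) = ∑ i, B (u i) (e i * a) := by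
  simpa using congrArg (TensorProduct.lift B) (h.casimir a)

/-- The average of a linear map, which is linear over `A`. -/
def avg (h : IsFrame e u) (f : M →ₗ[ℝ] N) : M →ₗ[A] N where
  toFun x := ∑ i, u i • f (e i • x)
  map_add' x y := by simp only [smul_add, map_add, Finset.sum_add_distrib]
  map_smul' a x := by
    have := h.sum_eq (LinearMap.mk₂ ℝ (fun b c : A => b • f (c • x))
      (fun _ _ _ => add_smul _ _ _) (fun _ _ _ => smul_assoc _ _ _)
      (fun _ _ _ => by rw [add_smul, map_add, smul_add])
      (fun r b c => by rw [smul_assoc, map_smul, smul_comm])) a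
    simpa only [LinearMap.mk₂_apply, mul_smul, ← Finset.smul_sum, RingHom.id_apply] using this.symm

lemma avg_apply (h : IsFrame e u) (f : M →ₗ[ℝ] N) (x : M) :
    h.avg f x = ∑ i, u i • f (e i • x) := rfl

/-- Averaging a real projection onto a submodule gives a projection of `A`-modules. -/
lemma isSemisimpleModule [Nonempty ι] (h : IsFrame e u) : IsSemisimpleModule A M := by
  refine (isSemisimpleModule_iff A M).2 ⟨fun p => ?_⟩
  obtain ⟨f, hf⟩ := LinearMap.exists_leftInverse_of_injective
    ((p.restrictScalars ℝ).subtype) (Submodule.ker_subtype _)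
  have hf' : ∀ x : p, f x = x := fun x => LinearMap.congr_fun hf x
  have hc : (Fintype.card ι : ℝ) ≠ 0 := Nat.cast_ne_zero.2 Fintype.card_ne_zero
  let f' : M →ₗ[ℝ] p := f
  refine ⟨_, LinearMap.isCompl_of_proj
    (f := ((algebraMap ℝ (Module.End A p) (Fintype.card ι : ℝ)⁻¹) ∘ₗ h.avg f')) fun x => ?_⟩
  have : ∀ i, u i • f' (e i • (x : M)) = x := fun i => by
    rw [show f' (e i • (x : M)) = e i • x from hf' (e i • x), ← mul_smul, h.inv_mul, one_smul]
  change (Fintype.card ι : ℝ)⁻¹ • (h.avg f' x) = x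
  rw [avg_apply, Finset.sum_congr rfl fun i _ => this i, Finset.sum_const, Finset.card_univ,
    ← Nat.cast_smul_eq_nsmul ℝ, smul_smul, inv_mul_cancel₀ hc, one_smul]

end IsFrame

end Frame

/-! ### Traces of operators on spaces of maps and of bilinear forms -/

section HomTrace

open TensorProduct

variable {M N : Type*} [AddCommGroup M] [Module ℝ M] [AddCommGroup N] [Module ℝ N]

/-- The operator `f ↦ X ∘ f ∘ Y`. -/
def sandwich (X : N →ₗ[ℝ] N) (Y : M →ₗ[ℝ] M) : (M →ₗ[ℝ] N) →ₗ[ℝ] (M →ₗ[ℝ] N) :=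
  (LinearMap.llcomp ℝ M N N X) ∘ₗ (LinearMap.lcomp ℝ N Y)

/-- The operator taking a form `β` to the form `(x, y) ↦ β (Y y) (X x)`. -/
def flipSandwich (X Y : M →ₗ[ℝ] M) :
    (M →ₗ[ℝ] Module.Dual ℝ M) →ₗ[ℝ] (M →ₗ[ℝ] Module.Dual ℝ M) :=
  LinearMap.lflip.toLinearMap ∘ₗ sandwich (X.dualMap) Y

lemma trace_eq_of_semiconj {V W : Type*} [AddCommMonoid V] [Module ℝ V] [AddCommMonoid W]
    [Module ℝ W] [Module.Finite ℝ V] (e : V ≃ₗ[ℝ] W) {T : W →ₗ[ℝ] W} {S : V →ₗ[ℝ] V}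
    (h : ∀ x, T (e x) = e (S x)) : LinearMap.trace ℝ W T = LinearMap.trace ℝ V S := by
  have : T = e.conj S := LinearMap.ext fun w => by
    rw [LinearEquiv.conj_apply_apply, ← h, LinearEquiv.apply_symm_apply]
  have := Module.Finite.equiv e
  let _ : AddCommGroup V := Module.addCommMonoidToAddCommGroup ℝ
  let _ : AddCommGroup W := Module.addCommMonoidToAddCommGroup ℝ
  exact (congrArg _ ‹T = _›).trans (LinearMap.trace_conj' S e)

lemma trace_sandwich [Module.Finite ℝ M] [Module.Finite ℝ N] (X : N →ₗ[ℝ] N) (Y : M →ₗ[ℝ] M) :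
    LinearMap.trace ℝ _ (sandwich X Y) = LinearMap.trace ℝ N X * LinearMap.trace ℝ M Y := by
  have h : ∀ x : Module.Dual ℝ M ⊗[ℝ] N, sandwich X Y (dualTensorHomEquiv ℝ M N x) =
      dualTensorHomEquiv ℝ M N (TensorProduct.map Y.dualMap X x) := fun x => by
    induction x with
    | zero => simp only [map_zero]
    | add x y hx hy => simp only [map_add, hx, hy]
    | tmul φ n =>
      ext y
      change X (dualTensorHom ℝ M N (φ ⊗ₜ n) (Y y)) = dualTensorHom ℝ M N (φ.comp Y ⊗ₜ X n) y
      simp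
  have := trace_eq_of_semiconj (T := sandwich X Y) (S := TensorProduct.map Y.dualMap X)
    (dualTensorHomEquiv ℝ M N) h
  rw [this]
  refine (LinearMap.trace_tensorProduct' Y.dualMap X).trans ((mul_comm _ _).trans ?_)
  exact congrArg _ (LinearMap.trace_transpose' Y)

lemma trace_map_comm [Module.Finite ℝ M] (X Y : M →ₗ[ℝ] M) :
    LinearMap.trace ℝ (M ⊗[ℝ] M)
      (TensorProduct.map X Y ∘ₗ (TensorProduct.comm ℝ M M).toLinearMap) =
      LinearMap.trace ℝ M (X ∘ₗ Y) := by
  obtain ⟨x, rfl⟩ := (dualTensorHomEquiv ℝ M M).surjective X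
  obtain ⟨y, rfl⟩ := (dualTensorHomEquiv ℝ M M).surjective Y
  induction x with
  | zero => simp only [map_zero, LinearMap.zero_comp, TensorProduct.map_zero_left]
  | add x x' hx hx' => simp only [map_add, LinearMap.add_comp, TensorProduct.map_add_left, hx, hx']
  | tmul φ a =>
    induction y with
    | zero => simp only [map_zero, LinearMap.comp_zero, TensorProduct.map_zero_right,
        LinearMap.zero_comp]
    | add x x' hx hx' =>
      simp only [map_add, LinearMap.comp_add, LinearMap.add_comp, TensorProduct.map_add_right,
        hx, hx']
    | tmul ψ b =>
      have e1 : TensorProduct.map (dualTensorHomEquiv ℝ M M (φ ⊗ₜ a))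
          (dualTensorHomEquiv ℝ M M (ψ ⊗ₜ b)) ∘ₗ (TensorProduct.comm ℝ M M).toLinearMap =
          (TensorProduct.dualDistrib ℝ M M (ψ ⊗ₜ φ)).smulRight (a ⊗ₜ b) := by
        ext x y
        change dualTensorHom ℝ M M (φ ⊗ₜ a) y ⊗ₜ dualTensorHom ℝ M M (ψ ⊗ₜ b) x = _
        simp [TensorProduct.smul_tmul', TensorProduct.tmul_smul, smul_smul]
      have e2 : (dualTensorHomEquiv ℝ M M (φ ⊗ₜ a)) ∘ₗ (dualTensorHomEquiv ℝ M M (ψ ⊗ₜ b)) =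
          ψ.smulRight (φ b • a) := by
        ext x
        change dualTensorHom ℝ M M (φ ⊗ₜ a) (dualTensorHom ℝ M M (ψ ⊗ₜ b) x) = _
        simp
      rw [e1, e2, LinearMap.trace_smulRight, LinearMap.trace_smulRight]
      simp [mul_comm]

lemma trace_flipSandwich [Module.Finite ℝ M] (X Y : M →ₗ[ℝ] M) :
    LinearMap.trace ℝ _ (flipSandwich X Y) = LinearMap.trace ℝ M (X ∘ₗ Y) := by
  have h : ∀ x : Module.Dual ℝ M ⊗[ℝ] Module.Dual ℝ M,
      flipSandwich X Y (dualTensorHomEquiv ℝ M (Module.Dual ℝ M) x) =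
      dualTensorHomEquiv ℝ M (Module.Dual ℝ M) ((TensorProduct.map X.dualMap Y.dualMap ∘ₗ
        (TensorProduct.comm ℝ _ _).toLinearMap) x) := fun x => by
    induction x with
    | zero => simp only [map_zero]
    | add x y hx hy => simp only [map_add, hx, hy]
    | tmul φ ψ =>
      ext x y
      change dualTensorHom ℝ M (Module.Dual ℝ M) (φ ⊗ₜ ψ) (Y y) (X x) =
        dualTensorHom ℝ M (Module.Dual ℝ M) (ψ.comp X ⊗ₜ φ.comp Y) x y
      simp [mul_comm]
  have := trace_eq_of_semiconj (T := flipSandwich X Y)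
    (S := TensorProduct.map X.dualMap Y.dualMap ∘ₗ (TensorProduct.comm ℝ _ _).toLinearMap)
    (dualTensorHomEquiv ℝ M (Module.Dual ℝ M)) h
  rw [this]
  refine (trace_map_comm _ _).trans ?_
  refine Eq.trans ?_ ((LinearMap.trace_transpose' (Y ∘ₗ X)).trans
    (LinearMap.trace_mul_comm ℝ Y X))
  rfl

end HomTrace

/-! ### The dimension of the space of invariant forms -/

section InvForms

variable {A : Type*} [Ring A] [Algebra ℝ A] {ι : Type*} [Fintype ι] {e u : ι → A}
variable {M : Type*} [AddCommGroup M] [Module A M] [Module ℝ M] [IsScalarTower ℝ A M]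
variable {σ : RingInvo A} {ε : ℝ}

/-- The space `epsForms` as a space of bilinear forms. -/
def invForms (σ : RingInvo A) (ε : ℝ) (M : Type*) [AddCommGroup M] [Module A M] [Module ℝ M] :
    Submodule ℝ (M →ₗ[ℝ] Module.Dual ℝ M) where
  carrier := {β | (∀ (a : A) x y, β (a • x) y = β x ((σ a).unop • y)) ∧
    ∀ x y, β y x = ε * β x y}
  add_mem' := fun {β γ} hβ hγ => ⟨fun a x y => by simp [hβ.1, hγ.1],
    fun x y => by simp [hβ.2 x y, hγ.2 x y, mul_add]⟩
  zero_mem' := by simp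
  smul_mem' := fun r β hβ => ⟨fun a x y => by simp [hβ.1], fun x y => by
    simp only [LinearMap.smul_apply, smul_eq_mul, hβ.2 x y]; ring⟩

lemma nonempty_invForms_equiv_epsForms :
    Nonempty (invForms σ ε M ≃ₗ[ℝ] epsForms σ ε M) := by
  let L : (M →ₗ[ℝ] Module.Dual ℝ M) →ₗ[ℝ] (M → M → ℝ) :=
    { toFun := fun β x y => β x y
      map_add' := fun _ _ => rfl
      map_smul' := fun _ _ => rfl }
  have hL : Function.Injective L := fun β γ h =>
    LinearMap.ext fun x => LinearMap.ext fun y => congrFun (congrFun h x) y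
  have hmap : (invForms σ ε M).map L = epsForms σ ε M := by
    ext β
    constructor
    · rintro ⟨γ, ⟨h1, h2⟩, rfl⟩
      refine ⟨fun x x' y => ?_, fun r x y => ?_, h1, h2⟩
      · change γ (x + x') y = γ x y + γ x' y
        rw [map_add]; rfl
      · change γ (algebraMap ℝ A r • x) y = r * γ x y
        rw [algebraMap_smul, map_smul]; rfl
    · rintro ⟨h1, h2, h3, h4⟩
      refine ⟨LinearMap.mk₂ ℝ β h1 (fun r x y => ?_) (fun x y y' => ?_) (fun r x y => ?_),
        ⟨h3, h4⟩, rfl⟩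
      · rw [← algebraMap_smul A r x, h2]; rfl
      · rw [h4, h1, mul_add, ← h4, ← h4]
      · rw [h4, ← algebraMap_smul A r y, h2, smul_eq_mul, h4 y x]; ring
  rw [← hmap]
  exact ⟨Submodule.equivMapOfInjective L hL _⟩

lemma finrank_epsForms_eq_finrank_invForms :
    Module.finrank ℝ (epsForms σ ε M) = Module.finrank ℝ (invForms σ ε M) :=
  nonempty_invForms_equiv_epsForms.some.finrank_eq.symm

omit [Algebra ℝ A] [IsScalarTower ℝ A M] in
lemma finite_invForms [Module.Finite ℝ M] : Module.Finite ℝ (invForms σ ε M) :=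
  FiniteDimensional.finiteDimensional_submodule (V := M →ₗ[ℝ] Module.Dual ℝ M) _

lemma epsForms_eq_bot [Module.Finite ℝ M] (h : Module.finrank ℝ (epsForms σ ε M) = 0) :
    epsForms σ ε M = ⊥ := by
  have := finite_invForms (σ := σ) (ε := ε) (M := M)
  have : Module.Finite ℝ (epsForms σ ε M) :=
    Module.Finite.equiv nonempty_invForms_equiv_epsForms.some
  exact Submodule.finrank_eq_zero.1 h

lemma trace_eq_finrank_of_isProj {V : Type*} [AddCommGroup V] [Module ℝ V] [Module.Finite ℝ V]
    {p : Submodule ℝ V} {f : V →ₗ[ℝ] V} (h : LinearMap.IsProj p f) :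
    LinearMap.trace ℝ V f = Module.finrank ℝ p := h.trace

lemma IsFrame.sum_apply_smul [σ.IsReal] (h : IsFrame e u) (β : M →ₗ[ℝ] Module.Dual ℝ M)
    (a : A) (x y : M) : ∑ i, β (e i • a • x) ((σ (u i)).unop • y) =
      ∑ i, β (e i • x) ((σ (u i)).unop • (σ a).unop • y) := by
  have key := h.sum_eq (LinearMap.mk₂ ℝ (fun b c : A => β (c • x) ((σ b).unop • y))
    (fun b b' c => by rw [map_add, MulOpposite.unop_add, add_smul, map_add])
    (fun r b c => by
      rw [Algebra.smul_def, map_mul, MulOpposite.unop_mul,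
        RingInvo.IsReal.apply_algebraMap (σ := σ), mul_smul, algebraMap_smul,
        smul_comm (σ b).unop r y, map_smul])
    (fun b c c' => by rw [add_smul, map_add]; rfl)
    (fun r b c => by rw [smul_assoc, LinearMap.map_smul β r]; rfl)) a
  simp only [LinearMap.mk₂_apply, map_mul, MulOpposite.unop_mul, mul_smul] at key
  exact key.symm

/-- The number of independent invariant forms, as the trace of the projection that averages over
the frame and (anti)symmetrises. -/
theorem IsFrame.two_mul_card_mul_finrank_epsForms [Nonempty ι] [Module.Finite ℝ M] [σ.IsReal]
    (h : IsFrame e u) (hε : ε * ε = 1) :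
    2 * (Fintype.card ι : ℝ) * Module.finrank ℝ (epsForms σ ε M) =
      ∑ i, (modTrace M (e i) * modTrace M (σ (u i)).unop +
        ε * modTrace M ((σ (u i)).unop * e i)) := by
  have hc : (Fintype.card ι : ℝ) ≠ 0 := Nat.cast_ne_zero.2 Fintype.card_ne_zero
  let R : A → (M →ₗ[ℝ] M) := fun a => Algebra.lsmul ℝ ℝ M a
  let P : (M →ₗ[ℝ] Module.Dual ℝ M) →ₗ[ℝ] (M →ₗ[ℝ] Module.Dual ℝ M) :=
    (2 * (Fintype.card ι : ℝ))⁻¹ • ∑ i, (sandwich (R (σ (u i)).unop).dualMap (R (e i)) +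
      ε • flipSandwich (R (σ (u i)).unop) (R (e i)))
  have hP : ∀ β x y, P β x y = (2 * (Fintype.card ι : ℝ))⁻¹ *
      (∑ i, β (e i • x) ((σ (u i)).unop • y) + ε * ∑ i, β (e i • y) ((σ (u i)).unop • x)) := by
    intro β x y
    rw [Finset.mul_sum, ← Finset.sum_add_distrib]
    simp only [P, LinearMap.smul_apply, LinearMap.sum_apply, LinearMap.add_apply]
    rfl
  have hσσ : ∀ a, (σ (σ a).unop).unop = a := fun a => σ.involution' a
  have hproj : LinearMap.IsProj (invForms σ ε M) P := by
    constructor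
    · intro β
      refine ⟨fun a x y => ?_, fun x y => ?_⟩
      · rw [hP, hP, h.sum_apply_smul]
        have := h.sum_apply_smul (σ := σ) β (σ a).unop y x
        rw [hσσ] at this
        rw [this]
      · rw [hP, hP]
        linear_combination (2 * (Fintype.card ι : ℝ))⁻¹ *
          (- ∑ i, β (e i • y) ((σ (u i)).unop • x)) * hε
    · rintro β ⟨h1, h2⟩
      have h3 : ∀ i x y, β (e i • x) ((σ (u i)).unop • y) = β x y := fun i x y => by
        rw [← h1, ← mul_smul, h.inv_mul, one_smul]
      refine LinearMap.ext fun x => LinearMap.ext fun y => ?_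
      rw [hP]
      simp only [h3, Finset.sum_const, Finset.card_univ, nsmul_eq_mul]
      rw [h2 x y]
      field_simp
      linear_combination (β x y) * hε
  have htr := trace_eq_finrank_of_isProj (V := M →ₗ[ℝ] Module.Dual ℝ M) hproj
  rw [finrank_epsForms_eq_finrank_invForms, ← htr]
  simp only [P, map_smul, map_sum, map_add, smul_eq_mul]
  rw [mul_inv_cancel_left₀ (mul_ne_zero two_ne_zero hc)]
  refine Finset.sum_congr rfl fun i _ => ?_
  have e1 := trace_sandwich (R (σ (u i)).unop).dualMap (R (e i))
  have e2 := trace_flipSandwich (R (σ (u i)).unop) (R (e i))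
  have e3 : LinearMap.trace ℝ _ (R (σ (u i)).unop).dualMap =
    LinearMap.trace ℝ M (R (σ (u i)).unop) := LinearMap.trace_transpose' _
  rw [e1, e2, e3, mul_comm]
  congr 2
  simp only [modTrace, LinearMap.comp_apply, AlgHom.toLinearMap_apply, map_mul, R]
  rfl

/-- Modules with a nonzero value of the averaged product of characters are linked by a map. -/
theorem IsFrame.exists_hom_ne_zero {N : Type*} [AddCommGroup N] [Module A N] [Module ℝ N]
    [IsScalarTower ℝ A N] [Module.Finite ℝ M] [Module.Finite ℝ N] (h : IsFrame e u)
    (hne : ∑ i, modTrace N (u i) * modTrace M (e i) ≠ 0) : ∃ f : M →ₗ[A] N, f ≠ 0 := by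
  by_contra! h0
  refine hne ?_
  have : ∑ i, sandwich (Algebra.lsmul ℝ ℝ N (u i)) (Algebra.lsmul ℝ ℝ M (e i)) = 0 := by
    refine LinearMap.ext fun f => LinearMap.ext fun x => ?_
    have := LinearMap.congr_fun (h0 (h.avg f)) x
    rw [h.avg_apply] at this
    rw [LinearMap.sum_apply, LinearMap.sum_apply]
    exact this
  have := congrArg (LinearMap.trace ℝ _) this
  rw [map_sum, map_zero] at this
  rw [← this]
  exact Finset.sum_congr rfl fun i _ => (trace_sandwich _ _).symm

end InvForms

/-! ### Positive involutions -/

section Positive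

variable {A : Type*} [Ring A] [Algebra ℝ A] {ι : Type*} [Fintype ι] {e u : ι → A}
variable {M : Type*} [AddCommGroup M] [Module A M] [Module ℝ M] [IsScalarTower ℝ A M]
variable {τ : RingInvo A}

lemma finrank_submodule_eq_one {V : Type*} [AddCommGroup V] [Module ℝ V] {p : Submodule ℝ V}
    {v : V} (hv : v ∈ p) (h0 : v ≠ 0) (h : ∀ w ∈ p, ∃ r : ℝ, r • v = w) :
    Module.finrank ℝ p = 1 :=
  finrank_eq_one (⟨v, hv⟩ : p) (fun hz => h0 (congrArg Subtype.val hz)) fun w =>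
    (h w w.2).imp fun _ hr => Subtype.ext hr

namespace IsFrame

/-- Averaging a scalar product over a frame whose inverses are its images under the involution
gives an invariant scalar product. -/
lemma exists_pos_mem_invForms [Nonempty ι] [Module.Finite ℝ M] [τ.IsReal] (h : IsFrame e u)
    (hτ : ∀ i, (τ (u i)).unop = e i) :
    ∃ β ∈ invForms τ 1 M, ∀ x, x ≠ 0 → 0 < β x x := by
  let b := Module.finBasis ℝ M
  let dot : M →ₗ[ℝ] Module.Dual ℝ M := ∑ k, (b.coord k).smulRight (b.coord k)
  have hdot : ∀ x y, dot x y = ∑ k, b.coord k x * b.coord k y := fun x y => by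
    simp [dot, LinearMap.sum_apply]
  let R : A → (M →ₗ[ℝ] M) := fun a => Algebra.lsmul ℝ ℝ M a
  let B : M →ₗ[ℝ] Module.Dual ℝ M :=
    ∑ i, sandwich (R (τ (u i)).unop).dualMap (R (e i)) dot
  have hB : ∀ x y, B x y = ∑ i, dot (e i • x) ((τ (u i)).unop • y) := fun x y => by
    simp only [B, LinearMap.sum_apply]
    rfl
  refine ⟨B, ⟨fun a x y => ?_, fun x y => ?_⟩, fun x hx => ?_⟩
  · rw [hB, hB, h.sum_apply_smul]
  · rw [hB, hB, one_mul]
    refine Finset.sum_congr rfl fun i _ => ?_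
    rw [hτ, hdot, hdot]
    exact Finset.sum_congr rfl fun k _ => mul_comm _ _
  · rw [hB]
    refine Finset.sum_pos (fun i _ => ?_) Finset.univ_nonempty
    rw [hτ, hdot]
    have hne : e i • x ≠ 0 := fun h0 => hx (by
      rw [← one_smul A x, ← h.inv_mul i, mul_smul, h0, smul_zero])
    obtain ⟨k, hk⟩ : ∃ k, b.coord k (e i • x) ≠ 0 := by
      by_contra! h0
      exact hne (b.forall_coord_eq_zero_iff.1 h0)
    exact Finset.sum_pos' (fun k _ => mul_self_nonneg _)
      ⟨k, Finset.mem_univ k, mul_self_pos.2 hk⟩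

/-- The adjoint of the action of `a` with respect to an invariant scalar product is the action
of `τ a`. -/
lemma modTrace_invo [Nonempty ι] [Module.Finite ℝ M] [τ.IsReal] (h : IsFrame e u)
    (hτ : ∀ i, (τ (u i)).unop = e i) (a : A) :
    modTrace M (τ a).unop = modTrace M a := by
  obtain ⟨β, ⟨h1, -⟩, hpos⟩ := h.exists_pos_mem_invForms (M := M) hτ
  have hinj : Function.Injective β := (injective_iff_map_eq_zero β).2 fun x hx => by
    by_contra h0
    have := hpos x h0
    rw [hx] at this
    exact lt_irrefl _ this
  let E := LinearMap.linearEquivOfInjective β hinj (Subspace.dual_finrank_eq).symm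
  have := trace_eq_of_semiconj (T := (Algebra.lsmul ℝ ℝ M (τ a).unop : M →ₗ[ℝ] M).dualMap)
    (S := Algebra.lsmul ℝ ℝ M a) E fun x => LinearMap.ext fun y => (h1 a x y).symm
  exact (LinearMap.trace_transpose' (Algebra.lsmul ℝ ℝ M (τ a).unop : M →ₗ[ℝ] M)).symm.trans this

/-- On a simple module, the invariant scalar product is unique up to scaling. -/
theorem finrank_epsForms_eq_one [Nonempty ι] [Module.Finite ℝ M] [IsSimpleModule A M] [τ.IsReal]
    (h : IsFrame e u) (hτ : ∀ i, (τ (u i)).unop = e i) :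
    Module.finrank ℝ (epsForms τ 1 M) = 1 := by
  rw [finrank_epsForms_eq_finrank_invForms]
  obtain ⟨β, hβ, hpos⟩ := h.exists_pos_mem_invForms (M := M) hτ
  have h1 := hβ.1
  have h2 := hβ.2
  have hinj : Function.Injective β := (injective_iff_map_eq_zero β).2 fun x hx => by
    by_contra h0
    have := hpos x h0
    rw [hx] at this
    exact lt_irrefl _ this
  let E := LinearMap.linearEquivOfInjective β hinj (Subspace.dual_finrank_eq).symm
  have := IsSimpleModule.nontrivial A M
  obtain ⟨x₀, hx₀⟩ := exists_ne (0 : M)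
  refine finrank_submodule_eq_one (V := M →ₗ[ℝ] Module.Dual ℝ M) hβ (fun h0 => ?_)
    fun γ hγ => ?_
  · have := hpos x₀ hx₀
    rw [h0] at this
    exact lt_irrefl _ this
  · have hH : ∀ x, β (E.symm (γ x)) = γ x := fun x => E.apply_symm_apply (γ x)
    -- the endomorphism relating the two forms is self-adjoint and linear over `A`
    let H : Module.End A M :=
      { toFun := fun x => E.symm (γ x)
        map_add' := fun x y => by rw [map_add, map_add]
        map_smul' := fun a x => hinj (LinearMap.ext fun y => by
          rw [hH, hγ.1, RingHom.id_apply, h1, hH]) }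
    have hHγ : ∀ x y, β (H x) y = γ x y := fun x y => LinearMap.congr_fun (hH x) y
    have hHs : ∀ x y, β (H x) y = β x (H y) := fun x y => by
      rw [hHγ, h2 (H y) x, one_mul, hHγ, hγ.2 x y, one_mul]
    have : IsDomain (Module.End A M) := by
      classical
      exact (inferInstance : IsDomain (Module.End A M))
    have : Module.Finite ℝ (Module.End A M) :=
      Module.Finite.of_injective (LinearMap.restrictScalarsₗ ℝ A M M ℝ)
        (LinearMap.restrictScalars_injective ℝ)
    by_cases hr : H ∈ Set.range (algebraMap ℝ (Module.End A M))
    · obtain ⟨r, hr⟩ := hr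
      refine ⟨r, LinearMap.ext fun x => LinearMap.ext fun y => ?_⟩
      change r * β x y = γ x y
      rw [← hHγ, ← hr, show algebraMap ℝ (Module.End A M) r x = r • x from rfl, map_smul]
      rfl
    · -- a square root of `-1` among the self-adjoint endomorphisms contradicts positivity
      exfalso
      obtain ⟨c, hc, hcc⟩ := exists_mul_self_eq_of_notMem_range hr
        (z := (-1 : Module.End A M)) (by
          rw [← neg_one_smul ℝ]
          exact Submodule.smul_mem _ _ (Submodule.subset_span (by simp)))
      have hcs : ∀ x y, β (c x) y = β x (c y) := by
        obtain ⟨r, s, rfl⟩ := Submodule.mem_span_pair.1 hc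
        intro x y
        simp only [LinearMap.add_apply, LinearMap.smul_apply, map_add, map_smul, hHs]
        rfl
      have := hpos (c x₀) fun h0 => hx₀ (by
        have h3 := LinearMap.congr_fun hcc x₀
        rw [Module.End.mul_apply, h0, map_zero] at h3
        simpa using h3.symm)
      rw [← hcs, ← Module.End.mul_apply, hcc, LinearMap.neg_apply, Module.End.one_apply, map_neg,
        LinearMap.neg_apply] at this
      linarith [hpos x₀ hx₀]

end IsFrame

end Positive

/-! ### Algebras generated by anticommuting elements -/

section CliffordSystem

open TensorProduct

variable {A : Type*} [Ring A] [Algebra ℝ A] {m : ℕ} {s : ℝ} {g : Fin m → A}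

lemma RingInvo.IsReal.apply_smul (σ : RingInvo A) [σ.IsReal] (r : ℝ) (a : A) :
    (σ (r • a)).unop = r • (σ a).unop := by
  rw [Algebra.smul_def, map_mul, MulOpposite.unop_mul, RingInvo.IsReal.apply_algebraMap (σ := σ),
    Algebra.smul_def, Algebra.commutes]

/-- A real algebra generated by anticommuting elements `g` of square `s = ±1`, together with the
automorphism `g ↦ -g` and the involution `g ↦ s g`, under which the monomials in `g` are mapped
to their inverses. -/
structure IsCliffordSystem (s : ℝ) (g : Fin m → A) (θ : A →ₐ[ℝ] A) (τ : RingInvo A) : Prop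
    extends IsAnticommuting s g where
  sq_eq : s * s = 1
  adjoin : Algebra.adjoin ℝ (Set.range g) = ⊤
  hom_gen : ∀ j, θ (g j) = -g j
  invo_gen : ∀ j, (τ (g j)).unop = s • g j

/-- The inverses of the monomials. -/
def cliffInv (s : ℝ) (g : Fin m → A) (v : Fin m → Bool) : A :=
  revSign s (monDeg v) • cliffMon g v

omit [Algebra ℝ A] in
lemma cliffMon_single (g : Fin m → A) (j : Fin m) :
    cliffMon g (fun i => decide (i = j)) = g j := by
  induction m with
  | zero => exact j.elim0
  | succ m ih =>
    refine Fin.cases ?_ (fun j => ?_) j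
    · have : Fin.tail (fun i : Fin (m + 1) => decide (i = 0)) = fun _ => false :=
        funext fun i => decide_eq_false (Fin.succ_ne_zero i)
      rw [cliffMon, this, cliffMon_const_false, mul_one]
      simp
    · have : Fin.tail (fun i : Fin (m + 1) => decide (i = j.succ)) = fun i => decide (i = j) :=
        funext fun i => by simp [Fin.tail]
      rw [cliffMon, this, ih]
      simp [Fin.tail, (Fin.succ_ne_zero j).symm]

namespace IsCliffordSystem

variable {θ : A →ₐ[ℝ] A} {τ : RingInvo A}

lemma inv_mul (h : IsCliffordSystem s g θ τ) (v : Fin m → Bool) :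
    cliffInv s g v * cliffMon g v = 1 := by
  rw [cliffInv, smul_mul_assoc, h.cliffMon_mul_self, Algebra.smul_def, ← map_mul,
    revSign_mul_self h.sq_eq, map_one]

lemma mul_inv (h : IsCliffordSystem s g θ τ) (v : Fin m → Bool) :
    cliffMon g v * cliffInv s g v = 1 := by
  rw [cliffInv, mul_smul_comm, h.cliffMon_mul_self, Algebra.smul_def, ← map_mul,
    revSign_mul_self h.sq_eq, map_one]

lemma span_cliffMon (h : IsCliffordSystem s g θ τ) :
    Submodule.span ℝ (Set.range (cliffMon g)) = ⊤ := by
  set p := Submodule.span ℝ (Set.range (cliffMon g)) with hp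
  have h1 : (1 : A) ∈ p := by
    rw [← cliffMon_const_false g]
    exact Submodule.subset_span ⟨_, rfl⟩
  have h2 : ∀ x y, x ∈ p → y ∈ p → x * y ∈ p := by
    intro x y hx hy
    have := Submodule.mul_mem_mul hx hy
    rw [hp, Submodule.span_mul_span] at this
    refine Submodule.span_le.2 ?_ this
    rintro _ ⟨_, ⟨v, rfl⟩, _, ⟨w, rfl⟩, rfl⟩
    obtain ⟨γ, -, hγ⟩ := h.exists_cliffMon_mul_cliffMon h.sq_eq v w
    change cliffMon g v * cliffMon g w ∈ p
    rw [hγ]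
    exact Submodule.smul_mem _ _ (Submodule.subset_span ⟨_, rfl⟩)
  have h3 : Algebra.adjoin ℝ (Set.range g) ≤ p.toSubalgebra h1 h2 :=
    Algebra.adjoin_le (by
      rintro _ ⟨j, rfl⟩
      exact Submodule.subset_span ⟨_, cliffMon_single g j⟩)
  rw [h.adjoin] at h3
  exact eq_top_iff.2 fun x _ => h3 (Algebra.mem_top (x := x))

lemma finite (h : IsCliffordSystem s g θ τ) : Module.Finite ℝ A :=
  ⟨⟨(Set.finite_range (cliffMon g)).toFinset, by simpa using h.span_cliffMon⟩⟩

lemma isFrame (h : IsCliffordSystem s g θ τ) : IsFrame (cliffMon g) (cliffInv s g) := by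
  refine ⟨h.inv_mul, fun a => ?_⟩
  have ha : a ∈ Submodule.span ℝ (Set.range (cliffMon g)) := h.span_cliffMon ▸ Submodule.mem_top
  induction ha using Submodule.span_induction with
  | zero => simp
  | add x y _ _ hx hy =>
    simp only [add_mul, mul_add, TensorProduct.add_tmul, TensorProduct.tmul_add,
      Finset.sum_add_distrib, hx, hy]
  | smul r x _ hx =>
    simp only [smul_mul_assoc, mul_smul_comm, ← TensorProduct.smul_tmul', TensorProduct.tmul_smul,
      ← Finset.smul_sum, hx]
  | mem x hx =>
    obtain ⟨w, rfl⟩ := hx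
    let π : Equiv.Perm (Fin m → Bool) :=
      Function.Involutive.toPerm (fun v i => xor (v i) (w i)) fun v => funext fun i => by simp
    rw [← Equiv.sum_comp π]
    refine Finset.sum_congr rfl fun v _ => ?_
    obtain ⟨γ, -, hγ⟩ := h.exists_cliffMon_mul_cliffMon h.sq_eq v w
    have hγ' : cliffMon g v * cliffMon g w = γ • cliffMon g (π v) := hγ
    have : cliffMon g w * cliffInv s g (π v) = γ • cliffInv s g v := by
      calc cliffMon g w * cliffInv s g (π v)
          = cliffInv s g v * (cliffMon g v * cliffMon g w) * cliffInv s g (π v) := by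
            rw [← mul_assoc, h.inv_mul, one_mul]
        _ = γ • cliffInv s g v := by
            rw [hγ', mul_smul_comm, smul_mul_assoc, mul_assoc, h.mul_inv, mul_one]
    rw [this, hγ', TensorProduct.smul_tmul]

lemma isSemisimpleRing (h : IsCliffordSystem s g θ τ) : IsSemisimpleRing A :=
  h.isFrame.isSemisimpleModule

lemma invo_cliffMon_eq [τ.IsReal] (h : IsCliffordSystem s g θ τ) (v : Fin m → Bool) :
    (τ (cliffMon g v)).unop = cliffInv s g v := h.invo_cliffMon τ h.invo_gen v

lemma invo_cliffInv [τ.IsReal] (h : IsCliffordSystem s g θ τ) (v : Fin m → Bool) :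
    (τ (cliffInv s g v)).unop = cliffMon g v := by
  rw [cliffInv, RingInvo.IsReal.apply_smul, h.invo_cliffMon_eq, cliffInv, smul_smul,
    revSign_mul_self h.sq_eq, one_smul]

/-- For odd `m` the product of all generators is central. -/
lemma commute_top (h : IsCliffordSystem s g θ τ) (hm : Odd m) (a : A) :
    cliffMon g (fun _ => true) * a = a * cliffMon g (fun _ => true) := by
  have h1 : Algebra.adjoin ℝ (Set.range g) ≤
      Subalgebra.centralizer ℝ {cliffMon g (fun _ => true)} :=
    Algebra.adjoin_le (by
      rintro _ ⟨j, rfl⟩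
      refine Subalgebra.mem_centralizer_iff ℝ |>.2 ?_
      rintro _ rfl
      rw [h.gen_mul_cliffMon, monDeg_const_true, hm.neg_one_pow]
      simp)
  rw [h.adjoin] at h1
  exact (Subalgebra.mem_centralizer_iff ℝ).1 (h1 (Algebra.mem_top (x := a))) _ rfl

lemma top_mul_top (h : IsCliffordSystem s g θ τ) :
    cliffMon g (fun _ => true) * cliffMon g (fun _ => true) = algebraMap ℝ A (revSign s m) := by
  rw [h.cliffMon_mul_self, monDeg_const_true]

/-! ### Characters -/

variable {M : Type*} [AddCommGroup M] [Module A M] [Module ℝ M] [IsScalarTower ℝ A M]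

/-- A monomial that anticommutes with some generator has trace zero. -/
lemma modTrace_cliffMon_eq_zero (h : IsCliffordSystem s g θ τ) {v : Fin m → Bool}
    (h0 : v ≠ fun _ => false) (h1 : ¬(Odd m ∧ v = fun _ => true)) :
    modTrace M (cliffMon g v) = 0 := by
  obtain ⟨j, hj⟩ : ∃ j, ((-1 : ℝ) ^ monDeg v * if v j then -1 else 1) = -1 := by
    rcases Nat.even_or_odd (monDeg v) with hd | hd
    · obtain ⟨j, hj⟩ := Function.ne_iff.1 h0
      exact ⟨j, by rw [hd.neg_one_pow, if_pos (by simpa using hj), one_mul]⟩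
    · by_cases hv : v = fun _ => true
      · subst hv
        rw [monDeg_const_true] at hd
        exact absurd ⟨hd, rfl⟩ h1
      · obtain ⟨j, hj⟩ := Function.ne_iff.1 hv
        exact ⟨j, by rw [hd.neg_one_pow, if_neg (by simpa using hj), mul_one]⟩
  have hg : g j * (s • g j) = 1 := by
    rw [mul_smul_comm, h.sq, Algebra.smul_def, ← map_mul, h.sq_eq, map_one]
  have hg' : (s • g j) * g j = 1 := by rw [smul_mul_assoc, ← mul_smul_comm, hg]
  have h2 := modTrace_conj (M := M) hg' (cliffMon g v)
  rw [h.gen_mul_cliffMon, hj, smul_mul_assoc, mul_assoc, hg, mul_one, map_smul, smul_eq_mul] at h2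
  linarith

lemma sum_eq_of_support {G : (Fin m → Bool) → ℝ}
    (hG : ∀ v, v ≠ (fun _ => false) → ¬(Odd m ∧ v = fun _ => true) → G v = 0) :
    ∑ v, G v = G (fun _ => false) + if Odd m then G (fun _ => true) else 0 := by
  classical
  by_cases hm : Odd m
  · have hne : (fun _ => false : Fin m → Bool) ≠ fun _ => true := fun h => by
      have := congrFun h ⟨0, hm.pos⟩
      simp at this
    rw [if_pos hm, ← Finset.sum_pair hne]
    refine (Finset.sum_subset (Finset.subset_univ _) fun v _ hv => ?_).symm
    simp only [Finset.mem_insert, Finset.mem_singleton, not_or] at hv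
    exact hG v hv.1 fun h => hv.2 h.2
  · rw [if_neg hm, add_zero]
    refine Finset.sum_eq_single _ (fun v _ hv => hG v hv fun h => hm h.1) (by simp)

/-- If the product of all generators has square `-1`, the involution `τ` changes its sign. -/
lemma modTrace_top_eq_zero [Module.Finite ℝ M] [τ.IsReal] (h : IsCliffordSystem s g θ τ)
    (hs : revSign s m ≠ 1) : modTrace M (cliffMon g fun _ => true) = 0 := by
  have h1 := h.isFrame.modTrace_invo (M := M) h.invo_cliffInv (cliffMon g fun _ => true)
  have h2 : revSign s m = -1 :=
    (mul_self_eq_one_iff.1 (revSign_mul_self h.sq_eq m)).resolve_left hs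
  rw [h.invo_cliffMon_eq, cliffInv, monDeg_const_true, h2, map_smul, smul_eq_mul] at h1
  linarith

omit [IsScalarTower ℝ A M] in
/-- If the product of all generators is central of square `1`, it acts on a simple module as a
sign. -/
lemma exists_top_smul [IsSimpleModule A M] (h : IsCliffordSystem s g θ τ) (hm : Odd m)
    (hs : revSign s m = 1) :
    ∃ δ : ℝ, δ * δ = 1 ∧ ∀ x : M, cliffMon g (fun _ => true) • x = δ • x := by
  have hz := h.top_mul_top
  rw [hs, map_one] at hz
  set z := cliffMon g (fun _ => true) with hzdef
  let p : Submodule A M :=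
    { carrier := {x | z • x = x}
      add_mem' := fun {x y} (hx : z • x = x) (hy : z • y = y) => by
        change z • (x + y) = x + y
        rw [smul_add, hx, hy]
      zero_mem' := smul_zero z
      smul_mem' := fun a x (hx : z • x = x) => by
        change z • a • x = a • x
        rw [← mul_smul, h.commute_top hm, mul_smul, hx] }
  rcases eq_bot_or_eq_top p with hp | hp
  · refine ⟨-1, by norm_num, fun x => ?_⟩
    have : x + z • x ∈ p := by
      change z • (x + z • x) = x + z • x
      rw [smul_add, ← mul_smul, hz, one_smul, add_comm]
    rw [hp, Submodule.mem_bot] at this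
    rw [neg_one_smul]
    exact eq_neg_of_add_eq_zero_right this
  · refine ⟨1, by norm_num, fun x => ?_⟩
    have : x ∈ p := hp ▸ Submodule.mem_top
    rw [one_smul]
    exact this

lemma modTrace_of_smul [Module.Finite ℝ M] {z : A} {δ : ℝ} (hz : ∀ x : M, z • x = δ • x) :
    modTrace M z = δ * Module.finrank ℝ M := by
  rw [← modTrace_one (A := A) (M := M), ← smul_eq_mul, ← map_smul]
  have : Algebra.lsmul ℝ ℝ M z = Algebra.lsmul ℝ ℝ M (δ • (1 : A)) :=
    LinearMap.ext fun x => by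
      change z • x = (δ • (1 : A)) • x
      rw [hz, smul_assoc, one_smul]
  simp only [modTrace, LinearMap.comp_apply, AlgHom.toLinearMap_apply, this]

end IsCliffordSystem

end CliffordSystem

/-! ### Dimensions of simple modules and of their spaces of forms -/

section CliffordModules

variable {A : Type u} [Ring A] [Algebra ℝ A] {m : ℕ} {s : ℝ} {g : Fin m → A}

namespace IsCliffordSystem

variable {θ : A →ₐ[ℝ] A} {τ : RingInvo A}

section Dimension

variable {M : Type*} [AddCommGroup M] [Module A M] [Module ℝ M] [IsScalarTower ℝ A M]

open Classical in
lemma sum_mul_modTrace_sq [IsSimpleModule A M] [Module.Finite ℝ M] [τ.IsReal]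
    (h : IsCliffordSystem s g θ τ) (f : (Fin m → Bool) → ℝ) :
    ∑ v, f v * (modTrace M (cliffMon g v) * modTrace M (cliffMon g v)) =
      (f (fun _ => false) + if Odd m ∧ revSign s m = 1 then f (fun _ => true) else 0) *
        (Module.finrank ℝ M : ℝ) ^ 2 := by
  rw [sum_eq_of_support fun v h0 h1 => by
    rw [h.modTrace_cliffMon_eq_zero h0 h1, mul_zero, mul_zero], cliffMon_const_false, modTrace_one]
  by_cases hm : Odd m
  · by_cases hs : revSign s m = 1
    · obtain ⟨δ, hδ, hz⟩ := h.exists_top_smul (M := M) hm hs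
      rw [if_pos hm, if_pos ⟨hm, hs⟩, modTrace_of_smul hz]
      linear_combination f (fun _ => true) * (Module.finrank ℝ M : ℝ) ^ 2 * hδ
    · rw [if_pos hm, if_neg fun h => hs h.2, h.modTrace_top_eq_zero hs]
      ring
  · rw [if_neg hm, if_neg fun h => hm h.1]
    ring

open Classical in
/-- The dimensions of the spaces of invariant forms on a simple module, for an involution that
multiplies the monomials by signs up to conjugation by an element `w`. -/
theorem finrank_epsForms [IsSimpleModule A M] [Module.Finite ℝ M] [τ.IsReal]
    (h : IsCliffordSystem s g θ τ) {σ : RingInvo A} [σ.IsReal] {t ε : ℝ} {w w' : A}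
    (hσ : ∀ v, (σ (cliffMon g v)).unop = revSign t (monDeg v) • (w * cliffMon g v * w'))
    (hw : w * w' = 1) (hw' : w' * w = 1)
    (hsum : ∑ v, revSign t (monDeg v) • (cliffInv s g v * w' * cliffMon g v) = signSum t m • w')
    (hε : ε * ε = 1) :
    2 * (2 : ℝ) ^ m * Module.finrank ℝ (epsForms σ ε M) =
      (1 + if Odd m ∧ revSign s m = 1 then revSign t m else 0) * (Module.finrank ℝ M : ℝ) ^ 2 +
        ε * signSum t m * Module.finrank ℝ M := by
  have hcard : (Fintype.card (Fin m → Bool) : ℝ) = 2 ^ m := by simp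
  rw [← hcard, h.isFrame.two_mul_card_mul_finrank_epsForms hε, Finset.sum_add_distrib,
    ← Finset.mul_sum]
  have e1 : ∀ v, (σ (cliffInv s g v)).unop =
      revSign t (monDeg v) • (w * cliffInv s g v * w') := fun v => by
    rw [cliffInv, RingInvo.IsReal.apply_smul, hσ, mul_smul_comm, smul_mul_assoc, smul_comm]
  congr 1
  · have e2 : ∀ v, modTrace M (cliffMon g v) * modTrace M (σ (cliffInv s g v)).unop =
        (revSign t (monDeg v) * revSign s (monDeg v)) *
          (modTrace M (cliffMon g v) * modTrace M (cliffMon g v)) := fun v => by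
      rw [e1, map_smul, modTrace_conj hw', cliffInv, map_smul, smul_eq_mul, smul_eq_mul]
      ring
    simp only [e2]
    rw [h.sum_mul_modTrace_sq, monDeg_const_false, monDeg_const_true]
    split_ifs with hm
    · rw [hm.2]; simp [revSign]
    · simp [revSign]
  · rw [mul_assoc]
    congr 1
    have e3 : ∀ v, modTrace M ((σ (cliffInv s g v)).unop * cliffMon g v) =
        modTrace M (w * revSign t (monDeg v) • (cliffInv s g v * w' * cliffMon g v)) := fun v => by
      rw [e1, smul_mul_assoc, mul_smul_comm]
      simp only [mul_assoc]
    simp only [e3]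
    rw [← map_sum, ← Finset.mul_sum, hsum, mul_smul_comm, hw, map_smul, modTrace_one, smul_eq_mul]

open Classical in
/-- The equation that determines the dimension of a simple module. -/
theorem two_mul_two_pow_eq [IsSimpleModule A M] [Module.Finite ℝ M] [τ.IsReal]
    (h : IsCliffordSystem s g θ τ) :
    2 * (2 : ℝ) ^ m = (if Odd m ∧ revSign s m = 1 then 2 else 1) * (Module.finrank ℝ M : ℝ) ^ 2 +
      signSum s m * Module.finrank ℝ M := by
  have h1 := h.finrank_epsForms (M := M) (σ := τ) (t := s) (ε := 1) (w := 1) (w' := 1)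
    (fun v => by rw [h.invo_cliffMon_eq, one_mul, mul_one]; rfl) (one_mul 1) (one_mul 1)
    (by simp only [mul_one, h.inv_mul, ← Finset.sum_smul]; rfl) (one_mul 1)
  rw [h.isFrame.finrank_epsForms_eq_one h.invo_cliffInv, Nat.cast_one, mul_one, one_mul] at h1
  rw [h1]
  split_ifs with hm
  · rw [hm.2]; ring
  · ring

/-- The sum of products of characters reduces to the monomials of degree `0` and, for odd `m`, of
degree `m`. -/
lemma exists_hom_ne_zero {N : Type*} [AddCommGroup N] [Module A N] [Module ℝ N]
    [IsScalarTower ℝ A N] [IsSimpleModule A M] [Module.Finite ℝ M] [IsSimpleModule A N]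
    [Module.Finite ℝ N] [τ.IsReal] (h : IsCliffordSystem s g θ τ)
    (hz : Odd m → revSign s m = 1 → ∃ δ : ℝ, (∀ x : M, cliffMon g (fun _ => true) • x = δ • x) ∧
      ∀ x : N, cliffMon g (fun _ => true) • x = δ • x) : ∃ f : M →ₗ[A] N, f ≠ 0 := by
  have := IsSimpleModule.nontrivial A M
  have := IsSimpleModule.nontrivial A N
  have hM : 0 < (Module.finrank ℝ M : ℝ) := Nat.cast_pos.2 Module.finrank_pos
  have hN : 0 < (Module.finrank ℝ N : ℝ) := Nat.cast_pos.2 Module.finrank_pos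
  refine h.isFrame.exists_hom_ne_zero (ne_of_gt ?_)
  rw [sum_eq_of_support fun v h0 h1 => by
    rw [h.modTrace_cliffMon_eq_zero h0 h1, mul_zero], cliffMon_const_false, cliffInv,
    cliffMon_const_false, monDeg_const_false, modTrace_one, revSign, one_smul, modTrace_one]
  refine add_pos_of_pos_of_nonneg (mul_pos hN hM) ?_
  split_ifs with hm
  · by_cases hs : revSign s m = 1
    · obtain ⟨δ, h1, h2⟩ := hz hm hs
      rw [cliffInv, monDeg_const_true, hs, one_smul, modTrace_of_smul h1, modTrace_of_smul h2]
      nlinarith [mul_nonneg (mul_self_nonneg δ) (mul_pos hM hN).le]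
    · rw [h.modTrace_top_eq_zero hs, mul_zero]
  · exact le_rfl

/-- Conjugation of `1` and of the generators by the monomials. -/
lemma sum_conj_eq (h : IsCliffordSystem s g θ τ) {t : ℝ} {w : A}
    (hw : w = 1 ∨ t = 1 ∧ w ∈ Submodule.span ℝ ({1} ∪ Set.range g)) :
    ∑ v, revSign t (monDeg v) • (cliffInv s g v * w * cliffMon g v) = signSum t m • w := by
  have h1 : ∀ t : ℝ, ∑ v, revSign t (monDeg v) • (cliffInv s g v * 1 * cliffMon g v) =
      signSum t m • 1 := fun t => by
    simp only [mul_one, h.inv_mul, ← Finset.sum_smul]; rfl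
  rcases hw with rfl | ⟨rfl, hw⟩
  · exact h1 t
  · induction hw using Submodule.span_induction with
    | zero => simp
    | add x y _ _ hx hy =>
      simp only [mul_add, add_mul, smul_add, Finset.sum_add_distrib, hx, hy]
    | smul r x _ hx =>
      simp only [mul_smul_comm, smul_mul_assoc]
      rw [smul_comm _ r x, ← hx, Finset.smul_sum]
      exact Finset.sum_congr rfl fun v _ => smul_comm _ _ _
    | mem x hx =>
      rcases hx with rfl | ⟨j, rfl⟩
      · exact h1 1
      · rw [← (sum_revSign_mul j).2, Finset.sum_smul]
        refine Finset.sum_congr rfl fun v _ => ?_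
        rw [mul_assoc, h.gen_mul_cliffMon, mul_smul_comm, ← mul_assoc, h.inv_mul, one_mul,
          smul_smul]

end Dimension

/-! ### The regular character -/

/-- In the regular representation the product of all generators has trace zero as well. -/
lemma modTrace_self_eq_zero [Nontrivial A] (h : IsCliffordSystem s g θ τ) {v : Fin m → Bool}
    (h0 : v ≠ fun _ => false) : modTrace A (cliffMon g v) = 0 := by
  have := h.finite
  by_cases h1 : Odd m ∧ v = fun _ => true
  · -- the automorphism `θ` preserves the regular character and changes the sign of `v`
    have hθθ : (θ.comp θ) = AlgHom.id ℝ A := by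
      refine AlgHom.ext_of_adjoin_eq_top h.adjoin ?_
      rintro _ ⟨j, rfl⟩
      simp [h.hom_gen]
    let E : A ≃ₗ[ℝ] A := LinearEquiv.ofInvolutive θ.toLinearMap fun a =>
      DFunLike.congr_fun hθθ a
    have h2 := trace_eq_of_semiconj (T := Algebra.lsmul ℝ ℝ A (θ (cliffMon g v)))
      (S := Algebra.lsmul ℝ ℝ A (cliffMon g v)) E fun x => (map_mul θ _ _).symm
    have h3 : modTrace A (θ (cliffMon g v)) = modTrace A (cliffMon g v) := h2
    rw [IsAnticommuting.hom_cliffMon θ h.hom_gen, h1.2, monDeg_const_true, h1.1.neg_one_pow,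
      map_smul, smul_eq_mul, ← h1.2] at h3
    linarith
  · exact h.modTrace_cliffMon_eq_zero h0 h1

/-- Up to a scalar, the regular character takes the coefficient of the empty monomial. -/
lemma isInvTrace [Nontrivial A] (h : IsCliffordSystem s g θ τ) {σ : RingInvo A} [σ.IsReal] {t : ℝ}
    {w w' : A} (hσ : ∀ v, (σ (cliffMon g v)).unop = revSign t (monDeg v) • (w * cliffMon g v * w'))
    (hw' : w' * w = 1) : IsInvTrace σ (modTrace A : A →ₗ[ℝ] ℝ) := by
  have := h.finite
  refine ⟨modTrace_mul_comm, fun a => ?_, fun a ha => ?_⟩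
  · have ha : a ∈ Submodule.span ℝ (Set.range (cliffMon g)) := h.span_cliffMon ▸ Submodule.mem_top
    induction ha using Submodule.span_induction with
    | zero => simp
    | add x y _ _ hx hy => rw [map_add, MulOpposite.unop_add, map_add, hx, hy, map_add]
    | smul r x _ hx => rw [RingInvo.IsReal.apply_smul, map_smul, hx, map_smul]
    | mem x hx =>
      obtain ⟨v, rfl⟩ := hx
      rw [hσ, map_smul, modTrace_conj hw']
      by_cases hv : v = fun _ => false
      · rw [hv, monDeg_const_false, revSign, one_smul]
      · rw [h.modTrace_self_eq_zero hv, smul_zero]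
  · have ha' : a ∈ Submodule.span ℝ (Set.range (cliffMon g)) :=
      h.span_cliffMon ▸ Submodule.mem_top
    obtain ⟨c, rfl⟩ := (Submodule.mem_span_range_iff_exists_fun ℝ).1 ha'
    refine Finset.sum_eq_zero fun v _ => ?_
    have h1 := ha (cliffInv s g v)
    rw [Finset.mul_sum, map_sum, Finset.sum_eq_single v (fun w _ hwv => ?_) (by simp),
      mul_smul_comm, h.inv_mul, map_smul, modTrace_one, smul_eq_mul] at h1
    · rw [(mul_eq_zero.1 h1).resolve_right (Nat.cast_ne_zero.2 Module.finrank_pos.ne'), zero_smul]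
    · obtain ⟨γ, -, hγ⟩ := h.exists_cliffMon_mul_cliffMon h.sq_eq v w
      have hne : (fun i => xor (v i) (w i)) ≠ fun _ => false := fun h0 =>
        hwv (funext fun i => Eq.symm (by
          have := congrFun h0 i
          simpa using this))
      rw [mul_smul_comm, cliffInv, smul_mul_assoc, hγ, map_smul, map_smul, map_smul,
        h.modTrace_self_eq_zero hne, smul_zero, smul_zero, smul_zero]

end IsCliffordSystem

end CliffordModules

/-! ### Classification of the simple modules -/

section CliffordSimple

variable {A : Type u} [Ring A] [Algebra ℝ A] {m : ℕ} {s : ℝ} {g : Fin m → A}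

namespace IsCliffordSystem

variable {θ : A →ₐ[ℝ] A} {τ : RingInvo A}

/-- Simple modules on which the product of all generators acts by the same sign are isomorphic. -/
lemma nonempty_linearEquiv (h : IsCliffordSystem s g θ τ) [τ.IsReal] {M N : Type u} [AddCommGroup M]
    [Module A M] [IsSimpleModule A M] [AddCommGroup N] [Module A N] [IsSimpleModule A N]
    (hz : Odd m → revSign s m = 1 →
      ∃ δ : ℝ, (∀ x : M, cliffMon g (fun _ => true) • x = algebraMap ℝ A δ • x) ∧
        ∀ x : N, cliffMon g (fun _ => true) • x = algebraMap ℝ A δ • x) :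
    Nonempty (M ≃ₗ[A] N) := by
  have := h.finite
  let _ : Module ℝ M := Module.compHom _ (algebraMap ℝ A)
  let _ : Module ℝ N := Module.compHom _ (algebraMap ℝ A)
  have : IsScalarTower ℝ A M := ⟨fun r a x => by rw [Algebra.smul_def, mul_smul]; rfl⟩
  have : IsScalarTower ℝ A N := ⟨fun r a x => by rw [Algebra.smul_def, mul_smul]; rfl⟩
  have : Module.Finite ℝ M := Module.Finite.trans A _
  have : Module.Finite ℝ N := Module.Finite.trans A _
  obtain ⟨f, hf⟩ := h.exists_hom_ne_zero (M := M) (N := N) hz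
  exact ⟨LinearEquiv.ofBijective f (LinearMap.bijective_of_ne_zero hf)⟩

lemma exists_top_smul' (h : IsCliffordSystem s g θ τ) {M : Type u} [AddCommGroup M]
    [Module A M] [IsSimpleModule A M] (hm : Odd m) (hs : revSign s m = 1) :
    ∃ δ : ℝ, δ * δ = 1 ∧ ∀ x : M, cliffMon g (fun _ => true) • x = algebraMap ℝ A δ • x := by
  let _ : Module ℝ M := Module.compHom _ (algebraMap ℝ A)
  exact h.exists_top_smul hm hs

/-- Both signs occur, on submodules of the left ideals generated by `1 ± z`. -/
lemma exists_simple_top_smul [Nontrivial A] (h : IsCliffordSystem s g θ τ) (hm : Odd m)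
    (hs : revSign s m = 1) {δ : ℝ} (hδ : δ * δ = 1) :
    ∃ S : ModuleCat.{u} A, IsSimpleModule A S ∧
      ∀ x : S, cliffMon g (fun _ => true) • x = algebraMap ℝ A δ • x := by
  have := h.isSemisimpleRing
  set z := cliffMon g (fun _ => true) with hzdef
  have hz : z * z = 1 := by rw [h.top_mul_top, hs, map_one]
  have hδz : z * (1 + δ • z) = algebraMap ℝ A δ * (1 + δ • z) := by
    rw [← Algebra.smul_def, smul_add, smul_smul, hδ, one_smul, mul_add, mul_one, mul_smul_comm, hz,
      add_comm]
  have hne : 1 + δ • z ≠ 0 := fun h0 => by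
    have h1 := congrArg θ h0
    rw [map_add, map_one, map_smul, IsAnticommuting.hom_cliffMon θ h.hom_gen, monDeg_const_true,
      hm.neg_one_pow, neg_one_smul, map_zero, smul_neg] at h1
    have h2 : (2 : ℝ) • (1 : A) = 0 := by
      rw [two_smul]
      calc (1 : A) + 1 = (1 + δ • z) + (1 + -(δ • z)) := by abel
        _ = 0 := by rw [h0, h1, add_zero]
    exact (smul_ne_zero two_ne_zero one_ne_zero) h2
  let I : Submodule A A := Submodule.span A {1 + δ • z}
  have : Nontrivial I := Submodule.nontrivial_iff_ne_bot.2 fun h0 =>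
    hne (Submodule.span_singleton_eq_bot.1 h0)
  obtain ⟨S, hS⟩ := IsSemisimpleModule.exists_simple_submodule A I
  refine ⟨ModuleCat.of A S, hS, fun (x : S) => Subtype.ext (Subtype.ext ?_)⟩
  obtain ⟨a, ha⟩ := Submodule.mem_span_singleton.1 x.1.2
  change z * ((x : I) : A) = algebraMap ℝ A δ * ((x : I) : A)
  rw [← ha, smul_eq_mul, ← mul_assoc, h.commute_top hm, mul_assoc, hδz, ← mul_assoc, ← mul_assoc,
    Algebra.commutes]

open Classical in
/-- There are two simple modules if the product of all generators is central of square `1`, and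
one otherwise. -/
theorem exists_simples [Nontrivial A] [τ.IsReal] (h : IsCliffordSystem s g θ τ) {r : ℕ}
    (hr : r = if Odd m ∧ revSign s m = 1 then 2 else 1) :
    ∃ S : Fin r → ModuleCat.{u} A,
      (∀ j, IsSimpleModule A (S j)) ∧
      (∀ (M : Type u) [AddCommGroup M] [Module A M] [IsSimpleModule A M],
        ∃ j, Nonempty (S j ≃ₗ[A] M)) ∧
      ∀ i j, i ≠ j → IsEmpty (S i ≃ₗ[A] S j) := by
  split_ifs at hr with hm <;> subst hr
  · obtain ⟨S₁, h₁, hz₁⟩ := h.exists_simple_top_smul hm.1 hm.2 (δ := 1) (by norm_num)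
    obtain ⟨S₂, h₂, hz₂⟩ := h.exists_simple_top_smul hm.1 hm.2 (δ := -1) (by norm_num)
    have hne : ∀ f : S₁ →ₗ[A] S₂, f = 0 := fun f => LinearMap.ext fun x => by
      have h1 := congrArg f (hz₁ x)
      rw [map_smul, map_smul, hz₂, map_neg, map_one, one_smul, neg_one_smul] at h1
      have h2 : (algebraMap ℝ A 2) • f x = 0 := by
        rw [map_ofNat, two_smul]
        nth_rw 1 [← h1]
        exact neg_add_cancel _
      have h3 := congrArg (fun y => algebraMap ℝ A 2⁻¹ • y) h2
      simp only [← mul_smul, ← map_mul, smul_zero] at h3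
      rw [inv_mul_cancel₀ two_ne_zero, map_one, one_smul] at h3
      exact h3
    have := IsSimpleModule.nontrivial A S₁
    obtain ⟨x, hx⟩ := exists_ne (0 : S₁)
    refine ⟨![S₁, S₂], fun j => ?_, fun M _ _ _ => ?_, fun i j hij => ⟨fun f => ?_⟩⟩
    · fin_cases j
      · exact h₁
      · exact h₂
    · obtain ⟨δ, hδ, hz⟩ := h.exists_top_smul' (M := M) hm.1 hm.2
      rcases mul_self_eq_one_iff.1 hδ with rfl | rfl
      · exact ⟨0, h.nonempty_linearEquiv (M := S₁) fun _ _ => ⟨1, hz₁, hz⟩⟩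
      · exact ⟨1, h.nonempty_linearEquiv (M := S₂) fun _ _ => ⟨-1, hz₂, hz⟩⟩
    · fin_cases i <;> fin_cases j
      · exact hij rfl
      · exact hx ((LinearEquiv.map_eq_zero_iff f).1 (LinearMap.congr_fun (hne f.toLinearMap) x))
      · exact hx ((LinearEquiv.map_eq_zero_iff f.symm).1
          (LinearMap.congr_fun (hne f.symm.toLinearMap) x))
      · exact hij rfl
  · have := h.isSemisimpleRing
    obtain ⟨S, hS⟩ := IsSemisimpleModule.exists_simple_submodule A A
    refine ⟨fun _ => ModuleCat.of A S, fun _ => hS, fun M _ _ _ => ?_,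
      fun i j hij => (hij (Subsingleton.elim i j)).elim⟩
    exact ⟨0, h.nonempty_linearEquiv (M := S) fun h1 h2 => absurd ⟨h1, h2⟩ hm⟩

end IsCliffordSystem

end CliffordSimple

/-! ### Witt groups from dimension counts -/

section CliffordWitt

lemma revSign_add_mul_eight {t : ℝ} (ht : t * t = 1) (j k : ℕ) :
    revSign t (j + 8 * k) = revSign t j := by
  induction k with
  | zero => rfl
  | succ k ih =>
    rw [← ih, mul_add, mul_one, ← add_assoc]
    generalize j + 8 * k = i
    have h4 : t * t * t * t = 1 := by linear_combination (t * t + 1) * ht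
    simp only [revSign, pow_succ]
    linear_combination ((-1 : ℝ) ^ i) ^ 8 * revSign t i * (t * t * t * t + 1) * h4 +
      revSign t i * (((-1 : ℝ) ^ i * (-1) ^ i) ^ 3 + ((-1 : ℝ) ^ i * (-1) ^ i) ^ 2 +
        (-1 : ℝ) ^ i * (-1) ^ i + 1) * neg_one_pow_mul_self i

/-- The table entry for a ring with `r` simple modules, each carrying a `p`-dimensional space of
forms. -/
def wittEntry (r p : ℕ) : ℕ × ℕ := if p = 0 then (0, 0) else if p = 1 then (r, 0) else (0, r)

variable {A : Type u} [Ring A] [Algebra ℝ A] {m : ℕ} {s : ℝ} {g : Fin m → A}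
variable {θ : A →ₐ[ℝ] A} {τ : RingInvo A}

open SymSpace

/-- The three types of a Witt group, according to the number of independent forms. -/
theorem nonempty_wittGroup_addEquiv [IsSemisimpleRing A] [Module.Finite ℝ A] {σ : RingInvo A}
    [σ.IsReal] {lam : A →ₗ[ℝ] ℝ} {r p : ℕ} {S : Fin r → ModuleCat.{u} A} {n d : ℤ}
    (hlam : IsInvTrace σ lam)
    (hnm : -n - d = d) {ε : ℝ} (hε : ε = (((n * (n + 1) / 2).negOnePow : ℤ) : ℝ))
    (hS : ∀ j, IsSimpleModule A (S j))
    (hex : ∀ (M : Type u) [AddCommGroup M] [Module A M] [IsSimpleModule A M],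
      ∃ j, Nonempty (S j ≃ₗ[A] M))
    (hne : ∀ i j, i ≠ j → IsEmpty (S i ≃ₗ[A] S j))
    (h : ∀ (M : Type u) [AddCommGroup M] [Module A M] [IsSimpleModule A M],
      Module.finrank ℝ (epsForms σ ε M) = p) :
    Nonempty (WittGroup σ n ≃+ TableGroup (wittEntry r p)) := by
  by_cases h0 : p = 0
  · rw [show wittEntry r p = (0, 0) from if_pos h0]
    have := subsingleton_wittGroup_of_epsForms hlam hnm hε fun M _ _ _ => by
      let _ : Module ℝ M := Module.compHom _ (algebraMap ℝ A)
      have : IsScalarTower ℝ A M := ⟨fun r a x => by rw [Algebra.smul_def, mul_smul]; rfl⟩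
      have : Module.Finite ℝ M := Module.Finite.trans A _
      exact epsForms_eq_bot ((h M).trans h0)
    have : Unique (WittGroup σ n) := Unique.mk' _
    have : Unique (TableGroup (0, 0)) :=
      @Unique.mk' _ ⟨0⟩ (inferInstanceAs (Subsingleton ((Fin 0 → ℤ) × (Fin 0 → ZMod 2))))
    exact ⟨AddEquiv.ofUnique⟩
  by_cases h1 : p = 1
  · rw [show wittEntry r p = (r, 0) from (if_neg h0).trans (if_pos h1)]
    obtain ⟨e⟩ := nonempty_addEquiv_int_of_epsForms hlam hnm hε hS hex hne
      fun M _ _ _ => (h M).trans h1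
    exact ⟨e.trans (AddEquiv.prodUnique (N := Fin 0 → ZMod 2)).symm⟩
  · rw [show wittEntry r p = (0, r) from (if_neg h0).trans (if_neg h1)]
    obtain ⟨e⟩ := nonempty_addEquiv_zmod_of_epsForms hlam hnm hε hS hex hne
      fun M _ _ _ => by rw [h M]; omega
    exact ⟨e.trans (AddEquiv.uniqueProd (N := Fin 0 → ℤ)).symm⟩

lemma eq_of_quadratic_eq {a b x y : ℝ} (ha : 0 < a) (hx : 0 < x) (hy : 0 < y)
    (h : a * x ^ 2 + b * x = a * y ^ 2 + b * y) (h0 : 0 < a * y ^ 2 + b * y) : x = y := by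
  have h1 : (x - y) * (a * (x + y) + b) = 0 := by linear_combination h
  rcases mul_eq_zero.1 h1 with h2 | h2
  · linarith
  · have : b = -(a * (x + y)) := by linarith
    rw [this] at h0
    nlinarith [mul_pos ha (mul_pos hx hy)]

open Classical in
/-- The Witt groups of an algebra generated by anticommuting elements. The period in the number
of generators is `8`; the normalised dimension `ν` of the simple modules is the positive solution
of a quadratic equation. -/
theorem IsCliffordSystem.hasWittGroups [Nontrivial A] [τ.IsReal] (h : IsCliffordSystem s g θ τ)
    {σ : RingInvo A} [σ.IsReal] {t : ℝ} (ht : t * t = 1) {w w' : A}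
    (hσ : ∀ v, (σ (cliffMon g v)).unop = revSign t (monDeg v) • (w * cliffMon g v * w'))
    (hw : w * w' = 1) (hw' : w' * w = 1)
    (hwt : w' = 1 ∨ t = 1 ∧ w' ∈ Submodule.span ℝ ({1} ∪ Set.range g))
    {j k p q : ℕ} (hm : m = j + 8 * k) {ν : ℝ} (hν : 0 < ν)
    (e0 : 2 * 2 ^ j = (if Odd j ∧ revSign s j = 1 then 2 else 1) * ν ^ 2 + signSum s j * ν)
    (e1 : 2 * 2 ^ j * p = (1 + if Odd j ∧ revSign s j = 1 then revSign t j else 0) * ν ^ 2 +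
      signSum t j * ν)
    (e2 : 2 * 2 ^ j * q = (1 + if Odd j ∧ revSign s j = 1 then revSign t j else 0) * ν ^ 2 -
      signSum t j * ν) :
    HasWittGroups σ (wittEntry (if Odd j ∧ revSign s j = 1 then 2 else 1) p,
      wittEntry (if Odd j ∧ revSign s j = 1 then 2 else 1) q) := by
  have := h.isSemisimpleRing
  have := h.finite
  have hoddiff : Odd m ↔ Odd j := by
    rw [hm, Nat.odd_add]
    exact iff_true_right (by exact ⟨4 * k, by ring⟩)
  have hcond : (Odd j ∧ revSign s j = 1) = (Odd m ∧ revSign s m = 1) := by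
    rw [hoddiff, hm, revSign_add_mul_eight h.sq_eq]
  have hrt : revSign t m = revSign t j := by rw [hm, revSign_add_mul_eight ht]
  have hSs : signSum s m = 16 ^ k * signSum s j := by rw [hm, signSum_add_mul_eight h.sq_eq]
  have hSt : signSum t m = 16 ^ k * signSum t j := by rw [hm, signSum_add_mul_eight ht]
  have h16 : (0 : ℝ) < 16 ^ k := by positivity
  have h2m : (2 : ℝ) ^ m = 2 ^ j * (16 ^ k * 16 ^ k) := by
    rw [hm, pow_add, pow_mul, ← mul_pow]; norm_num
  simp only [hcond] at e0 e1 e2 ⊢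
  rw [← hrt] at e1 e2
  obtain ⟨S, hS, hex, hne⟩ := h.exists_simples rfl
  have hlam := h.isInvTrace hσ hw'
  have hdim : ∀ (M : Type u) [AddCommGroup M] [Module A M] [IsSimpleModule A M] (ε : ℝ),
      ε * ε = 1 → 2 * 2 ^ j * (Module.finrank ℝ (epsForms σ ε M) : ℝ) =
        (1 + if Odd m ∧ revSign s m = 1 then revSign t m else 0) * ν ^ 2 +
          ε * signSum t j * ν := by
    intro M _ _ _ ε hε
    let _ : Module ℝ M := Module.compHom _ (algebraMap ℝ A)
    have : IsScalarTower ℝ A M := ⟨fun r a x => by rw [Algebra.smul_def, mul_smul]; rfl⟩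
    have : Module.Finite ℝ M := Module.Finite.trans A _
    have := IsSimpleModule.nontrivial A M
    have hN : 0 < (Module.finrank ℝ M : ℝ) := Nat.cast_pos.2 Module.finrank_pos
    have f0 := h.two_mul_two_pow_eq (M := M)
    have f1 := h.finrank_epsForms (M := M) hσ hw hw' (h.sum_conj_eq hwt) hε
    obtain ⟨x, hx⟩ : ∃ x, (Module.finrank ℝ M : ℝ) = 16 ^ k * x :=
      ⟨(Module.finrank ℝ M : ℝ) / 16 ^ k, by field_simp⟩
    rw [hx] at f0 f1 hN
    rw [h2m, hSs] at f0
    rw [h2m, hSt] at f1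
    have hx0 : 0 < x := pos_of_mul_pos_right hN h16.le
    have f0' : 2 * (2 : ℝ) ^ j =
        (if Odd m ∧ revSign s m = 1 then 2 else 1) * x ^ 2 + signSum s j * x := by
      refine mul_left_cancel₀ (mul_pos h16 h16).ne' ?_
      linear_combination f0
    have hxν : x = ν := by
      refine eq_of_quadratic_eq (a := if Odd m ∧ revSign s m = 1 then 2 else 1) ?_ hx0 hν
        (f0'.symm.trans e0) ?_
      · split_ifs <;> norm_num
      · rw [← e0]; positivity
    rw [← hxν]
    refine mul_left_cancel₀ (mul_pos h16 h16).ne' ?_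
    linear_combination f1
  have h2j : (2 * 2 ^ j : ℝ) ≠ 0 := by positivity
  refine fun i => ⟨fun hi => ?_, fun hi => ?_, fun hi => subsingleton_wittGroup_of_odd hi⟩
  · refine nonempty_wittGroup_addEquiv (d := -(i / 2)) hlam (by omega) (ε := 1) ?_ hS hex hne
      fun M _ _ _ => ?_
    · obtain ⟨c, rfl⟩ : ∃ c, i = 4 * c := ⟨i / 4, by omega⟩
      rw [show 4 * c * (4 * c + 1) / 2 = 2 * (c * (4 * c + 1)) from by
        rw [show 4 * c * (4 * c + 1) = 2 * (2 * (c * (4 * c + 1))) by ring]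
        exact Int.mul_ediv_cancel_left _ two_ne_zero, Int.negOnePow_two_mul]
      simp
    · have := hdim M 1 (by norm_num)
      rw [one_mul, ← e1] at this
      exact_mod_cast mul_left_cancel₀ h2j this
  · refine nonempty_wittGroup_addEquiv (d := -(i / 2)) hlam (by omega) (ε := -1) ?_ hS hex hne
      fun M _ _ _ => ?_
    · obtain ⟨c, rfl⟩ : ∃ c, i = 4 * c + 2 := ⟨i / 4, by omega⟩
      rw [show (4 * c + 2) * (4 * c + 2 + 1) / 2 = 2 * (4 * c * c + 5 * c + 1) + 1 from by
        rw [show (4 * c + 2) * (4 * c + 2 + 1) = 2 * (2 * (4 * c * c + 5 * c + 1) + 1) by ring]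
        exact Int.mul_ediv_cancel_left _ two_ne_zero, Int.negOnePow_two_mul_add_one]
      simp
    · have := hdim M (-1) (by norm_num)
      rw [neg_one_mul, neg_mul, ← sub_eq_add_neg, ← e2] at this
      exact_mod_cast mul_left_cancel₀ h2j this

end CliffordWitt

/-! ### Even Clifford algebras -/

section EvenClifford

open CliffordAlgebra MulOpposite

/-- The composite of two involutions, as an algebra endomorphism. -/
def RingInvo.compAlgHom {A : Type*} [Ring A] [Algebra ℝ A] (σ τ : RingInvo A) [σ.IsReal]
    [τ.IsReal] : A →ₐ[ℝ] A where
  toFun x := (σ (τ x).unop).unop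
  map_one' := by simp
  map_mul' x y := by simp
  map_zero' := by simp
  map_add' x y := by simp
  commutes' r := by
    rw [RingInvo.IsReal.apply_algebraMap (σ := τ), RingInvo.IsReal.apply_algebraMap (σ := σ)]

variable {p q : ℕ}

lemma coe_sigmaZero (x : C0 p q) : (((sigmaZero p q x).unop : C0 p q) :
    CliffordAlgebra (realForm p q)) = reverse (x : CliffordAlgebra (realForm p q)) := rfl

lemma coe_sigmaOne {v : Fin p ⊕ Fin q → ℝ} (hv : realForm p q v ≠ 0) (x : C0 p q) :
    (((sigmaOne v hv x).unop : C0 p q) : CliffordAlgebra (realForm p q)) =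
      ι (realForm p q) v * reverse (x : CliffordAlgebra (realForm p q)) * vecInv v := rfl

instance : (sigmaZero p q).IsReal :=
  ⟨fun r => Subtype.ext (by rw [coe_sigmaZero]; exact reverse.commutes r)⟩

instance {v : Fin p ⊕ Fin q → ℝ} (hv : realForm p q v ≠ 0) : (sigmaOne v hv).IsReal :=
  ⟨fun r => Subtype.ext (by
    rw [coe_sigmaOne]
    change _ * reverse (algebraMap ℝ (CliffordAlgebra (realForm p q)) r) * _ =
      algebraMap ℝ (CliffordAlgebra (realForm p q)) r
    rw [reverse.commutes, ← Algebra.commutes, mul_assoc, mul_vecInv hv, mul_one])⟩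

instance : Nontrivial (C0 p q) := by
  have : Invertible (2 : ℝ) := invertibleOfNonzero two_ne_zero
  infer_instance

/-- The product of two vectors, in the even Clifford algebra. -/
noncomputable def vecMul (a b : Fin p ⊕ Fin q → ℝ) : C0 p q :=
  ⟨ι (realForm p q) a * ι (realForm p q) b, ι_mul_ι_mem_evenOdd_zero _ a b⟩

lemma coe_vecMul (a b : Fin p ⊕ Fin q → ℝ) : ((vecMul a b : C0 p q) :
    CliffordAlgebra (realForm p q)) = ι (realForm p q) a * ι (realForm p q) b := rfl

/-- An orthogonal basis of `ℝ^{p+q}` that consists of a vector `f` of length `±1`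
and of vectors `b j` of length `1`. -/
structure IsAdaptedBasis {m : ℕ} (f : Fin p ⊕ Fin q → ℝ) (b : Fin m → Fin p ⊕ Fin q → ℝ) :
    Prop where
  sq_head : realForm p q f * realForm p q f = 1
  tail : ∀ j, realForm p q (b j) = 1
  ortho_head : ∀ j, (realForm p q).IsOrtho f (b j)
  ortho : ∀ i j, i ≠ j → (realForm p q).IsOrtho (b i) (b j)
  exists_eq : ∀ v, ∃ (r : ℝ) (c : Fin m → ℝ), v = r • f + ∑ j, c j • b j

namespace IsAdaptedBasis

variable {m : ℕ} {f : Fin p ⊕ Fin q → ℝ} {b : Fin m → Fin p ⊕ Fin q → ℝ}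

lemma ne_zero (h : IsAdaptedBasis f b) : realForm p q f ≠ 0 := fun h0 => by
  have := h.sq_head
  rw [h0, mul_zero] at this
  exact zero_ne_one this

lemma mem_span (h : IsAdaptedBasis f b) (v : Fin p ⊕ Fin q → ℝ) :
    (vecMul f v : C0 p q) ∈
      Submodule.span ℝ ({1} ∪ Set.range fun j => (vecMul f (b j) : C0 p q)) := by
  obtain ⟨r, c, rfl⟩ := h.exists_eq v
  have : (vecMul f (r • f + ∑ j, c j • b j) : C0 p q) =
      (r * realForm p q f) • (1 : C0 p q) + ∑ j, c j • vecMul f (b j) := by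
    refine Subtype.ext ?_
    rw [coe_vecMul, map_add, map_sum, map_smul, mul_add, mul_smul_comm, ι_sq_scalar,
      Finset.mul_sum]
    simp only [map_smul, mul_smul_comm]
    change _ = (r * realForm p q f) • (1 : CliffordAlgebra (realForm p q)) +
      ((∑ j, c j • vecMul f (b j) : C0 p q) : CliffordAlgebra (realForm p q))
    rw [AddSubmonoidClass.coe_finsetSum, Algebra.algebraMap_eq_smul_one, smul_smul]
    rfl
  rw [this]
  exact add_mem (Submodule.smul_mem _ _ (Submodule.subset_span (Or.inl rfl)))
    (sum_mem fun j _ => Submodule.smul_mem _ _ (Submodule.subset_span (Or.inr ⟨j, rfl⟩)))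

lemma adjoin_eq_top (h : IsAdaptedBasis f b) :
    Algebra.adjoin ℝ (Set.range fun j => (vecMul f (b j) : C0 p q)) = ⊤ := by
  set S := Algebra.adjoin ℝ (Set.range fun j => (vecMul f (b j) : C0 p q)) with hS
  have h1 : ∀ v, (vecMul f v : C0 p q) ∈ S := fun v => by
    have : Submodule.span ℝ ({1} ∪ Set.range fun j => (vecMul f (b j) : C0 p q)) ≤
        Subalgebra.toSubmodule S := by
      rw [Submodule.span_le]
      rintro x (rfl | hx)
      · exact one_mem S
      · exact Algebra.subset_adjoin hx
    exact this (h.mem_span v)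
  have h2 : ∀ v, (vecMul v f : C0 p q) ∈ S := fun v => by
    have : (vecMul v f : C0 p q) =
        algebraMap ℝ _ (QuadraticMap.polar (realForm p q) v f) - vecMul f v :=
      Subtype.ext (eq_sub_of_add_eq (ι_mul_ι_add_swap v f))
    rw [this]
    exact sub_mem (S.algebraMap_mem _) (h1 v)
  have h3 : ∀ v w, (vecMul v w : C0 p q) ∈ S := fun v w => by
    have : (vecMul v w : C0 p q) = realForm p q f • (vecMul v f * vecMul f w) := by
      refine Subtype.ext ?_
      change ι _ v * ι _ w = realForm p q f • (ι _ v * ι _ f * (ι _ f * ι _ w))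
      rw [mul_assoc, ← mul_assoc (ι _ f), ι_sq_scalar, ← Algebra.smul_def, mul_smul_comm,
        smul_smul, h.sq_head, one_smul]
    rw [this]
    exact S.smul_mem (mul_mem (h2 v) (h1 w)) _
  have h4 : ∀ (x : CliffordAlgebra (realForm p q)) (hx : x ∈ evenOdd (realForm p q) 0),
      (⟨x, hx⟩ : C0 p q) ∈ S := fun x hx => by
    induction x, hx using even_induction with
    | algebraMap r => exact S.algebraMap_mem r
    | add x y hx hy h1 h2 => exact add_mem h1 h2
    | ι_mul_ι_mul a c x hx h1 => exact mul_mem (h3 a c) h1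
  exact eq_top_iff.2 fun x _ => h4 x x.2

lemma sigmaZero_gen (h : IsAdaptedBasis f b) (j : Fin m) :
    (sigmaZero p q (vecMul f (b j))).unop = -vecMul f (b j) := by
  refine Subtype.ext ?_
  rw [coe_sigmaZero, coe_vecMul, reverse.map_mul, reverse_ι, reverse_ι]
  exact ι_mul_ι_comm_of_isOrtho (h.ortho_head j).symm

lemma sigmaOne_gen (h : IsAdaptedBasis f b) (j : Fin m) :
    (sigmaOne f h.ne_zero (vecMul f (b j))).unop = vecMul f (b j) := by
  refine Subtype.ext ?_
  rw [coe_sigmaOne, coe_vecMul, reverse.map_mul, reverse_ι, reverse_ι, mul_assoc, mul_assoc,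
    mul_vecInv h.ne_zero, mul_one]

/-- The even Clifford algebra is generated by the products `f b_j`, with the composite of
`σ_0` and `σ_1^f` as the automorphism that changes their signs. -/
lemma isCliffordSystem (h : IsAdaptedBasis f b) {τ : RingInvo (C0 p q)}
    (hτ : ∀ j, (τ (vecMul f (b j))).unop = (-realForm p q f) • vecMul f (b j)) :
    IsCliffordSystem (-realForm p q f) (fun j => (vecMul f (b j) : C0 p q))
      ((sigmaOne f h.ne_zero).compAlgHom (sigmaZero p q)) τ where
  sq j := by
    refine Subtype.ext ?_
    change ι _ f * ι _ (b j) * (ι _ f * ι _ (b j)) =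
      algebraMap ℝ (CliffordAlgebra (realForm p q)) (-realForm p q f)
    rw [mul_assoc, ← mul_assoc (ι _ (b j)), ι_mul_ι_comm_of_isOrtho (h.ortho_head j).symm,
      neg_mul, mul_assoc, ι_sq_scalar, h.tail, map_one, mul_one, mul_neg, ι_sq_scalar, map_neg]
  anti i j hij := by
    refine Subtype.ext ?_
    change ι _ f * ι _ (b i) * (ι _ f * ι _ (b j)) = -(ι _ f * ι _ (b j) * (ι _ f * ι _ (b i)))
    have e : ∀ k l, ι (realForm p q) f * ι _ (b k) * (ι _ f * ι _ (b l)) =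
        -(ι _ f * ι _ f * (ι _ (b k) * ι _ (b l))) := fun k l => by
      rw [mul_assoc, ← mul_assoc (ι _ (b k)), ι_mul_ι_comm_of_isOrtho (h.ortho_head k).symm]
      simp only [neg_mul, mul_neg, mul_assoc]
    rw [e, e, ι_mul_ι_comm_of_isOrtho (h.ortho i j hij), mul_neg]
  sq_eq := by rw [neg_mul_neg, h.sq_head]
  adjoin := h.adjoin_eq_top
  hom_gen j := by
    change (sigmaOne f h.ne_zero (sigmaZero p q (vecMul f (b j))).unop).unop = _
    rw [h.sigmaZero_gen, map_neg, unop_neg, h.sigmaOne_gen]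
  invo_gen := hτ

open Classical in
/-- The Witt groups for `σ_0`, by a dimension count. -/
theorem hasWittGroups_sigmaZero (h : IsAdaptedBasis f b) {τ : RingInvo (C0 p q)} [τ.IsReal] {s : ℝ}
    (hs : s = -realForm p q f) (hτ : ∀ j, (τ (vecMul f (b j))).unop = s • vecMul f (b j))
    {j k c d : ℕ} (hm : m = j + 8 * k) (ν : ℝ) (hν : 0 < ν)
    (e0 : 2 * 2 ^ j = (if Odd j ∧ revSign s j = 1 then 2 else 1) * ν ^ 2 + signSum s j * ν)
    (e1 : 2 * 2 ^ j * c = (1 + if Odd j ∧ revSign s j = 1 then revSign (-1) j else 0) * ν ^ 2 +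
      signSum (-1) j * ν)
    (e2 : 2 * 2 ^ j * d = (1 + if Odd j ∧ revSign s j = 1 then revSign (-1) j else 0) * ν ^ 2 -
      signSum (-1) j * ν) :
    HasWittGroups (sigmaZero p q) (wittEntry (if Odd j ∧ revSign s j = 1 then 2 else 1) c,
      wittEntry (if Odd j ∧ revSign s j = 1 then 2 else 1) d) := by
  subst hs
  have H := h.isCliffordSystem hτ
  refine H.hasWittGroups (t := -1) (w := 1) (w' := 1) (by norm_num) (fun v => ?_) (one_mul 1)
    (one_mul 1) (Or.inl rfl) hm hν e0 e1 e2
  rw [one_mul, mul_one]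
  exact H.invo_cliffMon _ (fun j => by rw [h.sigmaZero_gen, neg_one_smul]) v

open Classical in
/-- The Witt groups for `σ_1^v`, by a dimension count. -/
theorem hasWittGroups_sigmaOne (h : IsAdaptedBasis f b) {τ : RingInvo (C0 p q)} [τ.IsReal] {s : ℝ}
    (hs : s = -realForm p q f) (hτ : ∀ j, (τ (vecMul f (b j))).unop = s • vecMul f (b j))
    {v : Fin p ⊕ Fin q → ℝ} (hv : realForm p q v ≠ 0)
    {j k c d : ℕ} (hm : m = j + 8 * k) (ν : ℝ) (hν : 0 < ν)
    (e0 : 2 * 2 ^ j = (if Odd j ∧ revSign s j = 1 then 2 else 1) * ν ^ 2 + signSum s j * ν)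
    (e1 : 2 * 2 ^ j * c = (1 + if Odd j ∧ revSign s j = 1 then revSign 1 j else 0) * ν ^ 2 +
      signSum 1 j * ν)
    (e2 : 2 * 2 ^ j * d = (1 + if Odd j ∧ revSign s j = 1 then revSign 1 j else 0) * ν ^ 2 -
      signSum 1 j * ν) :
    HasWittGroups (sigmaOne v hv) (wittEntry (if Odd j ∧ revSign s j = 1 then 2 else 1) c,
      wittEntry (if Odd j ∧ revSign s j = 1 then 2 else 1) d) := by
  subst hs
  have H := h.isCliffordSystem hτ
  have hff : vecInv f * ι (realForm p q) f = 1 := vecInv_mul h.ne_zero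
  have hvv : vecInv v * ι (realForm p q) v = 1 := vecInv_mul hv
  -- `σ_1^v` and `σ_1^f` differ by the conjugation by `v f⁻¹`
  let w : C0 p q := (realForm p q f)⁻¹ • vecMul v f
  let w' : C0 p q := (realForm p q v)⁻¹ • vecMul f v
  have hwc : (w : CliffordAlgebra (realForm p q)) = ι _ v * vecInv f := by
    rw [vecInv, mul_smul_comm]; rfl
  have hwc' : (w' : CliffordAlgebra (realForm p q)) = ι _ f * vecInv v := by
    rw [vecInv, mul_smul_comm]; rfl
  have hww : w * w' = 1 := by
    refine Subtype.ext ?_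
    change (w : CliffordAlgebra (realForm p q)) * w' = 1
    rw [hwc, hwc', mul_assoc, ← mul_assoc (vecInv f), hff, one_mul, mul_vecInv hv]
  have hww' : w' * w = 1 := by
    refine Subtype.ext ?_
    change (w' : CliffordAlgebra (realForm p q)) * w = 1
    rw [hwc, hwc', mul_assoc, ← mul_assoc (vecInv v), hvv, one_mul, mul_vecInv h.ne_zero]
  refine H.hasWittGroups (t := 1) (w := w) (w' := w') (by norm_num) (fun x => ?_) hww
    hww' (Or.inr ⟨rfl, Submodule.smul_mem _ _ (h.mem_span v)⟩) hm hν e0 e1 e2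
  have e : ∀ x : C0 p q, (sigmaOne v hv x).unop = w * (sigmaOne f h.ne_zero x).unop * w' := by
    intro x
    refine Subtype.ext ?_
    change _ = (w : CliffordAlgebra (realForm p q)) *
      ((sigmaOne f h.ne_zero x).unop : C0 p q) * w'
    rw [coe_sigmaOne, coe_sigmaOne, hwc, hwc']
    calc ι _ v * reverse (x : CliffordAlgebra (realForm p q)) * vecInv v
        = ι _ v * (vecInv f * ι _ f) * reverse (x : CliffordAlgebra (realForm p q)) *
          (vecInv f * ι _ f) * vecInv v := by rw [hff, mul_one, mul_one]
      _ = _ := by simp only [mul_assoc]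
  clear_value w w'
  rw [e, H.invo_cliffMon _ (fun j => by rw [h.sigmaOne_gen, one_smul]) x, mul_smul_comm,
    smul_mul_assoc]

end IsAdaptedBasis

end EvenClifford

/-! ### The table -/

section TableComputation

open CliffordAlgebra

variable {p q : ℕ}

lemma realForm_single (i : Fin p ⊕ Fin q) :
    realForm p q (Pi.single i 1) = Sum.elim (fun _ => (-1 : ℝ)) (fun _ => (1 : ℝ)) i := by
  simp [realForm, QuadraticMap.weightedSumSquares_apply, Pi.single_apply]

lemma isOrtho_single {i k : Fin p ⊕ Fin q} (h : i ≠ k) :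
    (realForm p q).IsOrtho (Pi.single i 1) (Pi.single k 1) := by
  simp only [QuadraticMap.isOrtho_def, realForm, QuadraticMap.weightedSumSquares_apply,
    ← Finset.sum_add_distrib, Pi.add_apply]
  refine Finset.sum_congr rfl fun l _ => ?_
  rcases eq_or_ne l i with rfl | hl
  · simp [Pi.single_eq_of_ne h]
  · simp [Pi.single_eq_of_ne hl]

/-- The standard basis of the definite space. -/
lemma isAdaptedBasis_definite (m : ℕ) :
    IsAdaptedBasis (p := 0) (q := m + 1) (Pi.single (.inr 0) 1)
      (fun j : Fin m => Pi.single (.inr j.succ) 1) where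
  sq_head := by simp [realForm_single]
  tail j := by simp [realForm_single]
  ortho_head j := isOrtho_single (by simp [(Fin.succ_ne_zero j).symm])
  ortho i j hij := isOrtho_single (by simpa using hij)
  exists_eq v := by
    refine ⟨v (.inr 0), fun j => v (.inr j.succ), funext fun i => ?_⟩
    rcases i with i | i
    · exact i.elim0
    · refine Fin.cases ?_ (fun i => ?_) i
      · simp [(Fin.succ_ne_zero _).symm]
      · simp [Pi.single_apply, Fin.succ_ne_zero]

/-- The standard basis of the space with one negative vector. -/
lemma isAdaptedBasis_indefinite (m : ℕ) :
    IsAdaptedBasis (p := 1) (q := m) (Pi.single (.inl 0) 1)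
      (fun j : Fin m => Pi.single (.inr j) 1) where
  sq_head := by simp [realForm_single]
  tail j := by simp [realForm_single]
  ortho_head j := isOrtho_single (by simp)
  ortho i j hij := isOrtho_single (by simpa using hij)
  exists_eq v := by
    refine ⟨v (.inl 0), fun j => v (.inr j), funext fun i => ?_⟩
    rcases i with i | i
    · rw [Subsingleton.elim i 0]
      simp
    · simp [Pi.single_apply]

lemma hasWittGroups_sigmaZero_definite (m : ℕ) :
    HasWittGroups (sigmaZero 0 (m + 1)) (tableZeroDef (m + 1)) := by
  obtain ⟨j, k, hj, hm⟩ : ∃ j k, j < 8 ∧ m = j + 8 * k := ⟨m % 8, m / 8, by omega, by omega⟩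
  have key := fun c d => (isAdaptedBasis_definite m).hasWittGroups_sigmaZero (τ := sigmaZero _ _)
    (s := -1) (by simp [realForm_single])
    (fun j => by rw [(isAdaptedBasis_definite m).sigmaZero_gen, neg_one_smul]) (c := c) (d := d) hm
  have h8 : (m + 1) % 8 = (j + 1) % 8 := by omega
  -- the arguments are the numbers of independent symmetric and skew-symmetric forms, and the
  -- normalised dimension of the simple modules
  interval_cases j <;>
    [(convert key 1 0 1 ?_ ?_ ?_ ?_ using 1);
     (convert key 1 1 2 ?_ ?_ ?_ ?_ using 1);
     (convert key 1 3 4 ?_ ?_ ?_ ?_ using 1);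
     (convert key 1 3 4 ?_ ?_ ?_ ?_ using 1);
     (convert key 1 3 8 ?_ ?_ ?_ ?_ using 1);
     (convert key 1 1 8 ?_ ?_ ?_ ?_ using 1);
     (convert key 1 0 8 ?_ ?_ ?_ ?_ using 1);
     (convert key 1 0 8 ?_ ?_ ?_ ?_ using 1)] <;>
    norm_num [tableZeroDef, h8, wittEntry, signSum_succ, signSum_zero, revSign, Nat.odd_iff]

lemma hasWittGroups_sigmaZero_indefinite (m : ℕ) :
    HasWittGroups (sigmaZero 1 m) (tableZeroIndef (m + 1)) := by
  obtain ⟨j, k, hj, hm⟩ : ∃ j k, j < 8 ∧ m = j + 8 * k := ⟨m % 8, m / 8, by omega, by omega⟩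
  have key := fun c d => (isAdaptedBasis_indefinite m).hasWittGroups_sigmaZero
    (τ := sigmaOne _ (isAdaptedBasis_indefinite m).ne_zero)
    (s := 1) (by simp [realForm_single])
    (fun j => by rw [(isAdaptedBasis_indefinite m).sigmaOne_gen, one_smul]) (c := c) (d := d) hm
  have h8 : (m + 1) % 8 = (j + 1) % 8 := by omega
  -- the arguments are the numbers of independent symmetric and skew-symmetric forms, and the
  -- normalised dimension of the simple modules
  interval_cases j <;>
    [(convert key 1 0 1 ?_ ?_ ?_ ?_ using 1);
     (convert key 0 0 1 ?_ ?_ ?_ ?_ using 1);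
     (convert key 0 1 2 ?_ ?_ ?_ ?_ using 1);
     (convert key 0 2 4 ?_ ?_ ?_ ?_ using 1);
     (convert key 1 3 8 ?_ ?_ ?_ ?_ using 1);
     (convert key 0 0 8 ?_ ?_ ?_ ?_ using 1);
     (convert key 3 1 16 ?_ ?_ ?_ ?_ using 1);
     (convert key 2 0 16 ?_ ?_ ?_ ?_ using 1)] <;>
    norm_num [tableZeroIndef, h8, wittEntry, signSum_succ, signSum_zero, revSign, Nat.odd_iff]

lemma hasWittGroups_sigmaOne_definite (m : ℕ) {v : Fin 0 ⊕ Fin (m + 1) → ℝ}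
    (hv : realForm 0 (m + 1) v ≠ 0) :
    HasWittGroups (sigmaOne v hv) (tableOneDef (m + 1)) := by
  obtain ⟨j, k, hj, hm⟩ : ∃ j k, j < 8 ∧ m = j + 8 * k := ⟨m % 8, m / 8, by omega, by omega⟩
  have key := fun c d => (isAdaptedBasis_definite m).hasWittGroups_sigmaOne (τ := sigmaZero _ _)
    (s := -1) (by simp [realForm_single])
    (fun j => by rw [(isAdaptedBasis_definite m).sigmaZero_gen, neg_one_smul]) hv
    (c := c) (d := d) hm
  have h8 : (m + 1) % 8 = (j + 1) % 8 := by omega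
  -- the arguments are the numbers of independent symmetric and skew-symmetric forms, and the
  -- normalised dimension of the simple modules
  interval_cases j <;>
    [(convert key 1 0 1 ?_ ?_ ?_ ?_ using 1);
     (convert key 2 0 2 ?_ ?_ ?_ ?_ using 1);
     (convert key 3 1 4 ?_ ?_ ?_ ?_ using 1);
     (convert key 0 0 4 ?_ ?_ ?_ ?_ using 1);
     (convert key 1 3 8 ?_ ?_ ?_ ?_ using 1);
     (convert key 0 2 8 ?_ ?_ ?_ ?_ using 1);
     (convert key 0 1 8 ?_ ?_ ?_ ?_ using 1);
     (convert key 0 0 8 ?_ ?_ ?_ ?_ using 1)] <;>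
    norm_num [tableOneDef, h8, wittEntry, signSum_succ, signSum_zero, revSign, Nat.odd_iff]

lemma hasWittGroups_sigmaOne_indefinite (m : ℕ) {v : Fin 1 ⊕ Fin m → ℝ} (hv : realForm 1 m v ≠ 0) :
    HasWittGroups (sigmaOne v hv) (tableOneIndef (m + 1)) := by
  obtain ⟨j, k, hj, hm⟩ : ∃ j k, j < 8 ∧ m = j + 8 * k := ⟨m % 8, m / 8, by omega, by omega⟩
  have key := fun c d => (isAdaptedBasis_indefinite m).hasWittGroups_sigmaOne
    (τ := sigmaOne _ (isAdaptedBasis_indefinite m).ne_zero)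
    (s := 1) (by simp [realForm_single])
    (fun j => by rw [(isAdaptedBasis_indefinite m).sigmaOne_gen, one_smul]) hv (c := c) (d := d) hm
  have h8 : (m + 1) % 8 = (j + 1) % 8 := by omega
  -- the arguments are the numbers of independent symmetric and skew-symmetric forms, and the
  -- normalised dimension of the simple modules
  interval_cases j <;>
    [(convert key 1 0 1 ?_ ?_ ?_ ?_ using 1);
     (convert key 1 0 1 ?_ ?_ ?_ ?_ using 1);
     (convert key 1 0 2 ?_ ?_ ?_ ?_ using 1);
     (convert key 1 1 4 ?_ ?_ ?_ ?_ using 1);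
     (convert key 1 3 8 ?_ ?_ ?_ ?_ using 1);
     (convert key 1 3 8 ?_ ?_ ?_ ?_ using 1);
     (convert key 1 3 16 ?_ ?_ ?_ ?_ using 1);
     (convert key 1 1 16 ?_ ?_ ?_ ?_ using 1)] <;>
    norm_num [tableOneIndef, h8, wittEntry, signSum_succ, signSum_zero, revSign, Nat.odd_iff]

end TableComputation

theorem mainTheorem7 (n : ℕ) (hn : 1 ≤ n) :
    HasWittGroups (sigmaZero 0 n) (tableZeroDef n) ∧
    HasWittGroups (sigmaZero 1 (n - 1)) (tableZeroIndef n) ∧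
    (∀ (v : Fin 0 ⊕ Fin n → ℝ) (hv : realForm 0 n v ≠ 0),
      HasWittGroups (sigmaOne v hv) (tableOneDef n)) ∧
    (∀ (v : Fin 1 ⊕ Fin (n - 1) → ℝ) (hv : realForm 1 (n - 1) v ≠ 0),
      HasWittGroups (sigmaOne v hv) (tableOneIndef n)) := by
  obtain ⟨m, rfl⟩ : ∃ m, n = m + 1 := ⟨n - 1, by omega⟩
  exact ⟨hasWittGroups_sigmaZero_definite m, hasWittGroups_sigmaZero_indefinite m,
    fun _ hv => hasWittGroups_sigmaOne_definite m hv,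
    fun _ hv => hasWittGroups_sigmaOne_indefinite m hv⟩
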